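/- Let $d\in\mathbb N$, $T>0$, and let $\mathscr P_1(\mathbb R^d)$ be the set of Borel probability measures on $\mathbb R^d$ with finite first moment, with the $1$-Wasserstein distance $W_1(\mu,\nu)=\inf\int|x-y|\,d\gamma(x,y)$ (infimum over the couplings $\gamma$ of $\mu$ and $\nu$). Let $v:[0,T]\times\mathbb R^d\times\mathscr P_1(\mathbb R^d)\to\mathbb R^d$ be a Borel measurable vector field such that: - there is $c\in L^1(0,T)$ such that for a.e. $t\in[0,T]$, for all $x\in\mathbb R^d$ and $\mu\in\mathscr P_1(\mathbb R^d)$, $$|v(t,x,\mu)|\le c(t)\Bigl(1+|x|+\int_{\mathbb R^d}|y|\,d\mu(y)\Bigr);$$ - for every $\mu\in\mathscr P_1(\mathbb R^d)$ the map $(t,x)\mapsto v(t,x,\mu)$ is a Carathéodory function (measurable in $t$ for every $x$, continuous in $x$ for a.e. $t$); - whenever $\mu^n,\mu\in\mathscr P_1(\mathbb R^d)$ and $W_1(\mu^n,\mu)\to0$, then for every compact $C\subset\mathbb R^d$, $\ \sup_{x\in C}\sup_{t\in[0,T]}|v(t,x,\mu^n)-v(t,x,\mu)|\to0$. A solution with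 initial datum $\mu_0$ of the equation $$\partial_t\mu_t+\operatorname{div}\bigl(v(t,x,\mu_t)\mu_t\bigr)=0\qquad(\ast)$$ is a curve $\mu\in C([0,T];(\mathscr P_1(\mathbb R^d),W_1))$, equal to $\mu_0$ at $t=0$, with $\int_0^T\!\int|v(t,x,\mu_t)|\,d\mu_t\,dt<\infty$ and $$\int_0^T\!\int_{\mathbb R^d}\bigl(\partial_t\varphi(t,x)+v(t,x,\mu_t)\cdot\nabla_x\varphi(t,x)\bigr)\,d\mu_t(x)\,dt=0\qquad\text{for all }\varphi\in C_c^\infty((0,T)\times\mathbb R^d).$$ A function $\varphi:[0,\infty)\to[0,\infty)$ is admissible if $\varphi(0)=0$, $\varphi$ is strictly convex and of class $C^1$ with $\varphi'(0)=0$, $\varphi(r)/r\to\infty$ as $r\to\infty$, and $\varphi(2r)\le K(1+\varphi(r))$ for all $r\ge0$, for some $K>0$. A function $\psi:\mathbb R^d\to[0,\infty)$ is moderated if $\varphi(|x|)-1\le\psi(x)\le C(1+\varphi(|x|))$ for all $x$, for some admissible $\varphi$ and some $C>0$. Then: 1. If $\mu_0$ is a Borel probability measure on $\mathbb R^d$ with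 $\int\psi\,d\mu_0<\infty$ for some moderated $\psi$, then $(\ast)$ has a solution with initial datum $\mu_0$. 2. If moreover there is a constant $L$ with $|v(t,x,\mu)-v(t,y,\nu)|\le L(|x-y|+W_1(\mu,\nu))$ for all $t\in[0,T]$, $x,y\in\mathbb R^d$, $\mu,\nu\in\mathscr P_1(\mathbb R^d)$, then for every $\mu_0\in\mathscr P_1(\mathbb R^d)$ there is exactly one solution of $(\ast)$ with initial datum $\mu_0$. 3. If $\mu_0$ is a Borel probability measure with $\operatorname{supp}\mu_0\subset C$ for a compact set $C\subset\mathbb R^d$, then $(\ast)$ has a solution with initial datum $\mu_0$, and there is $R>0$ such that every solution $\mu$ with initial datum $\mu_0$ satisfies $\operatorname{supp}\mu_t\subset B(0,R)$ for every $t\in[0,T]$. -/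

import Mathlib

open MeasureTheory Set Filter Topology
open scoped ENNReal

noncomputable section

namespace Vlasov

/-- The space `ℝ^d` with its Euclidean norm. -/
abbrev Rd (d : ℕ) : Type := EuclideanSpace ℝ (Fin d)

/-- `P1 d` is the set of Borel probability measures on `ℝ^d` with finite first moment. -/
@[ext]
structure P1 (d : ℕ) where
  toMeasure : Measure (Rd d)
  isProb : IsProbabilityMeasure toMeasure
  finite_moment : ∫⁻ x, ‖x‖ₑ ∂toMeasure < ∞

attribute [instance] P1.isProb

/-- The transport cost `inf ∫ |x - y| dγ` over all couplings `γ` of `μ` and `ν`,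
as an extended nonnegative number. -/
def transportCost {d : ℕ} (μ ν : Measure (Rd d)) : ℝ≥0∞ :=
  ⨅ (γ : Measure (Rd d × Rd d)) (_ : γ.fst = μ ∧ γ.snd = ν), ∫⁻ p, edist p.1 p.2 ∂γ

/-- The transport cost between elements of `P1 d` is finite. -/
theorem transportCost_lt_top {d : ℕ} (μ ν : P1 d) :
    transportCost μ.toMeasure ν.toMeasure < ∞ := by
  have h1 : transportCost μ.toMeasure ν.toMeasure ≤
      ∫⁻ p, edist p.1 p.2 ∂(μ.toMeasure.prod ν.toMeasure) :=
    iInf₂_le (μ.toMeasure.prod ν.toMeasure) ⟨Measure.fst_prod, Measure.snd_prod⟩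
  have h2 : ∫⁻ p, edist p.1 p.2 ∂(μ.toMeasure.prod ν.toMeasure) ≤
      ∫⁻ p, (‖p.1‖ₑ + ‖p.2‖ₑ) ∂(μ.toMeasure.prod ν.toMeasure) := by
    refine lintegral_mono fun p => ?_
    rw [edist_eq_enorm_sub]
    exact enorm_sub_le
  have h3 : ∫⁻ p, (‖p.1‖ₑ + ‖p.2‖ₑ) ∂(μ.toMeasure.prod ν.toMeasure) < ∞ := by
    rw [lintegral_add_left (by fun_prop)]
    have e1 : ∫⁻ p : Rd d × Rd d, ‖p.1‖ₑ ∂(μ.toMeasure.prod ν.toMeasure)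
        = ∫⁻ x, ‖x‖ₑ ∂μ.toMeasure := by
      rw [lintegral_prod _ (by fun_prop)]; simp
    have e2 : ∫⁻ p : Rd d × Rd d, ‖p.2‖ₑ ∂(μ.toMeasure.prod ν.toMeasure)
        = ∫⁻ x, ‖x‖ₑ ∂ν.toMeasure := by
      rw [lintegral_prod _ (by fun_prop)]; simp
    rw [e1, e2]
    exact ENNReal.add_lt_top.2 ⟨μ.finite_moment, ν.finite_moment⟩
  exact (h1.trans h2).trans_lt h3

/-- The `1`-Wasserstein distance on `P1 d`. -/
def W1 {d : ℕ} (μ ν : P1 d) : ℝ := (transportCost μ.toMeasure ν.toMeasure).toReal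

/-- The topology of the distance `W1`: a set is open if it contains a `W1`-ball around each of
its points. -/
instance (d : ℕ) : TopologicalSpace (P1 d) where
  IsOpen U := ∀ μ ∈ U, ∃ ε > 0, ∀ ν, W1 μ ν < ε → ν ∈ U
  isOpen_univ := fun _ _ => ⟨1, one_pos, fun _ _ => mem_univ _⟩
  isOpen_inter := by
    rintro U V hU hV μ ⟨h1, h2⟩
    obtain ⟨a, ha, hUa⟩ := hU μ h1
    obtain ⟨b, hb, hVb⟩ := hV μ h2
    exact ⟨min a b, lt_min ha hb, fun ν hν =>
      ⟨hUa ν (hν.trans_le (min_le_left _ _)), hVb ν (hν.trans_le (min_le_right _ _))⟩⟩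
  isOpen_sUnion := by
    rintro S hS μ ⟨U, hUS, hU⟩
    obtain ⟨a, ha, hUa⟩ := hS U hUS μ hU
    exact ⟨a, ha, fun ν hν => ⟨U, hUS, hUa ν hν⟩⟩

/-- The Borel `σ`-algebra of `(P1 d, W1)`. -/
instance (d : ℕ) : MeasurableSpace (P1 d) := borel (P1 d)

instance (d : ℕ) : BorelSpace (P1 d) := ⟨rfl⟩

/-- Admissible functions `φ : [0,∞) → [0,∞)` (only the values on `[0,∞)` matter): `φ(0) = 0`,
strictly convex, of class `C^1` with `φ'(0) = 0`, superlinear at infinity, and doubling. -/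
structure IsAdmissible (φ : ℝ → ℝ) : Prop where
  nonneg : ∀ r, 0 ≤ r → 0 ≤ φ r
  map_zero : φ 0 = 0
  strictConvex : StrictConvexOn ℝ (Ici 0) φ
  contDiff : ContDiffOn ℝ 1 φ (Ici 0)
  deriv_zero : derivWithin φ (Ici 0) 0 = 0
  superlinear : Tendsto (fun r => φ r / r) atTop atTop
  doubling : ∃ K : ℝ, 0 < K ∧ ∀ r, 0 ≤ r → φ (2 * r) ≤ K * (1 + φ r)

/-- Moderated functions `ψ : ℝ^d → [0,∞)`: comparable with `φ(|x|)` for an admissible `φ`. -/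
structure IsModerated {d : ℕ} (ψ : Rd d → ℝ) : Prop where
  nonneg : ∀ x, 0 ≤ ψ x
  comparable : ∃ φ : ℝ → ℝ, IsAdmissible φ ∧ ∃ C : ℝ, 0 < C ∧
    ∀ x, φ ‖x‖ - 1 ≤ ψ x ∧ ψ x ≤ C * (1 + φ ‖x‖)

/-- Lebesgue measure on the interval `[0,T]`. -/
def leb (T : ℝ) : Measure (Icc (0 : ℝ) T) := (volume : Measure ℝ).comap Subtype.val

/-- Carathéodory functions of `(t, x)`: measurable in `t` for every `x`, and continuous in `x`
for almost every `t`. -/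
def IsCaratheodory {d : ℕ} {T : ℝ} (f : Icc (0 : ℝ) T → Rd d → Rd d) : Prop :=
  (∀ x, Measurable fun t => f t x) ∧ ∀ᵐ t ∂leb T, Continuous (f t)

/-- Test functions `φ ∈ C_c^∞((0,T) × ℝ^d)`. -/
structure IsTestFunction {d : ℕ} (T : ℝ) (φ : ℝ × Rd d → ℝ) : Prop where
  smooth : ContDiff ℝ (⊤ : ℕ∞) φ
  compact : HasCompactSupport φ
  support_subset : tsupport φ ⊆ Ioo 0 T ×ˢ univ

/-- `μ ∈ C([0,T]; P_1(ℝ^d))` is a distributional solution of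
`∂_t μ_t + div (v(t, x, μ_t) μ_t) = 0` in `(0,T) × ℝ^d` with initial datum `μ₀`. -/
structure IsSolution {d : ℕ} {T : ℝ} (hT : 0 < T)
    (v : Icc (0 : ℝ) T → Rd d → P1 d → Rd d) (μ₀ : Measure (Rd d))
    (μ : Icc (0 : ℝ) T → P1 d) : Prop where
  continuous : ∀ t, Tendsto (fun s => W1 (μ s) (μ t)) (𝓝 t) (𝓝 0)
  initial : (μ ⟨0, left_mem_Icc.2 hT.le⟩).toMeasure = μ₀
  integrable : ∫⁻ t, ∫⁻ x, ‖v t x (μ t)‖ₑ ∂(μ t).toMeasure ∂leb T < ∞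
  weak : ∀ φ : ℝ × Rd d → ℝ, IsTestFunction T φ →
    ∫ t, ∫ x, (deriv (fun s => φ (s, x)) t
      + inner ℝ (v t x (μ t)) (gradient (fun y => φ (t, y)) x)) ∂(μ t).toMeasure ∂leb T = 0

end Vlasov

end

open MeasureTheory Set Filter Topology
open scoped ENNReal

noncomputable section

namespace Vlasov

/-! Existence. Particles started from a datum in `P1` are moved by an Euler scheme in which the
field is frozen, on each short time cell, at the current position and the current law. Linear growth
and a discrete Gronwall argument bound the trajectories by `B * (1 + ‖x‖)` and give a modulus of
continuity in time, both independent of the time step. All laws are then images of one fixed measure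
under maps of uniform linear growth, so their first moments are uniformly integrable. Weak
compactness together with uniform integrability is `W1`-compactness (`isCompact_tailBound`,
`tendsto_W1_of_tendsto_toPM`), and a subsequence converges at every time
(`exists_subseq_tendsto_W1_curve`). Only the laws converge, not the trajectories. This suffices,
because up to a vanishing error the integrand of the weak formulation is a fixed bounded continuous
function evaluated along the law (`tendsto_integral_transport`, `IsField.exists_isWeakSol`).

Uniqueness. With the law frozen along a given solution, the equation becomes a linear continuity
equation with a field Lipschitz in space. Any weak solution of it is the `W1`-limit of the images of
its initial datum under Euler maps (`IsWeakSol.tendsto_integral_eulerMap`,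
`IsWeakSol.tendsto_W1_eulerMap`). To see this, the solution is tested against Lipschitz functions
composed with the Euler steps still to come, mollified so that a Taylor expansion is available. For
two solutions with the same datum, Euler trajectories issued from the same point separate by at most
a constant times the time integral of the `W1` distance between the solutions. Pushing the common
datum by both maps gives a coupling, hence an integral inequality for that distance, and Gronwall
makes it vanish.

Supports. Smooth observables of bounded gradient may be inserted in the equation
(`IsWeakSol.integral_sub_eq_integral_rate`). High powers of a saturated version of `1 + ‖x‖ ^ 2`
grow by at most a fixed factor per power, so the mass in the region where this function is twice
that bound is at most `2 ^ (-k)` for all `k`, hence zero. A moment bound common to all solutions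
makes the radius uniform.

Finally, a moderated function dominates `‖x‖` up to a constant, and so does membership in a compact
support, so the data of all three statements lie in `P1`. -/

/-! ### Metric properties of the transport cost. -/

open ProbabilityTheory in
/-- Triangle inequality for two couplings sharing the marginal `ν`. -/
theorem transportCost_le_of_couplings {d : ℕ} {μ ν ρ : Measure (Rd d)}
    [IsProbabilityMeasure ν] {γ₁ γ₂ : Measure (Rd d × Rd d)}
    (h₁ : γ₁.fst = μ ∧ γ₁.snd = ν) (h₂ : γ₂.fst = ν ∧ γ₂.snd = ρ) :
    transportCost μ ρ ≤ ∫⁻ p, edist p.1 p.2 ∂γ₁ + ∫⁻ p, edist p.1 p.2 ∂γ₂ := by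
  have hs : (γ₁.map Prod.swap).fst = ν := by rw [Measure.fst_map_swap, h₁.2]
  have hp1 : IsProbabilityMeasure (γ₁.map Prod.swap) := by
    constructor
    rw [← Measure.fst_univ, hs]; exact measure_univ
  have hp2 : IsProbabilityMeasure γ₂ := by
    constructor
    rw [← Measure.fst_univ, h₂.1]; exact measure_univ
  set κ₁ := (γ₁.map Prod.swap).condKernel
  set κ₂ := γ₂.condKernel
  have e₁ : ν ⊗ₘ κ₁ = γ₁.map Prod.swap := by
    rw [← hs]; exact Measure.disintegrate _ _
  have e₂ : ν ⊗ₘ κ₂ = γ₂ := by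
    rw [← h₂.1]; exact Measure.disintegrate _ _
  -- Gluing: the outer variables are made conditionally independent given the shared one, which is
  -- the first coordinate of `π`. The law of the outer pair is then the competitor.
  set π : Measure (Rd d × Rd d × Rd d) := ν ⊗ₘ (κ₁ ×ₖ κ₂)
  have f₁ : π.map (Prod.map id Prod.fst) = γ₁.map Prod.swap := by
    rw [← Measure.compProd_map measurable_fst, ← e₁, ← Kernel.fst_eq, Kernel.fst_prod]
  have f₂ : π.map (Prod.map id Prod.snd) = γ₂ := by
    rw [← Measure.compProd_map measurable_snd, ← Kernel.snd_eq, Kernel.snd_prod, e₂]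
  have g₁ : γ₁ = π.map fun p => (p.2.1, p.1) := by
    have : γ₁ = (γ₁.map Prod.swap).map Prod.swap := by
      rw [Measure.map_map measurable_swap measurable_swap]; simp
    rw [this, ← f₁, Measure.map_map measurable_swap (by fun_prop)]
    rfl
  have g₂ : γ₂ = π.map fun p => (p.1, p.2.2) := by
    rw [← f₂]; rfl
  have c₁ : (π.map Prod.snd).fst = μ := by
    rw [← h₁.1, g₁, Measure.fst, Measure.fst, Measure.map_map (by fun_prop) (by fun_prop),
      Measure.map_map (by fun_prop) (by fun_prop)]
    rfl
  have c₂ : (π.map Prod.snd).snd = ρ := by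
    rw [← h₂.2, g₂, Measure.snd, Measure.snd, Measure.map_map (by fun_prop) (by fun_prop),
      Measure.map_map (by fun_prop) (by fun_prop)]
    rfl
  refine (iInf₂_le (π.map Prod.snd) ⟨c₁, c₂⟩).trans ?_
  rw [lintegral_map (by fun_prop) measurable_snd, g₁, g₂,
    lintegral_map (by fun_prop) (by fun_prop), lintegral_map (by fun_prop) (by fun_prop),
    ← lintegral_add_left (by fun_prop)]
  refine lintegral_mono fun p => ?_
  refine (edist_triangle p.2.1 p.1 p.2.2)

theorem transportCost_triangle {d : ℕ} (μ ν ρ : Measure (Rd d)) [IsProbabilityMeasure ν] :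
    transportCost μ ρ ≤ transportCost μ ν + transportCost ν ρ := by
  conv_rhs => simp only [transportCost, ENNReal.iInf_add, ENNReal.add_iInf]
  exact le_iInf fun γ₂ => le_iInf fun h₂ => le_iInf fun γ₁ => le_iInf fun h₁ =>
    transportCost_le_of_couplings h₁ h₂

theorem transportCost_comm_le {d : ℕ} (μ ν : Measure (Rd d)) :
    transportCost μ ν ≤ transportCost ν μ := by
  refine le_iInf fun γ => le_iInf fun h => ?_
  refine (iInf₂_le (γ.map Prod.swap)
    ⟨by rw [Measure.fst_map_swap, h.2], by rw [Measure.snd_map_swap, h.1]⟩).trans ?_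
  rw [lintegral_map (by fun_prop) measurable_swap]
  exact le_of_eq (lintegral_congr fun p => edist_comm _ _)

theorem transportCost_map_le {d : ℕ} {Ω : Type*} [MeasurableSpace Ω] (P : Measure Ω)
    {X Y : Ω → Rd d} (hX : Measurable X) (hY : Measurable Y) :
    transportCost (P.map X) (P.map Y) ≤ ∫⁻ ω, edist (X ω) (Y ω) ∂P := by
  refine (iInf₂_le (P.map fun ω => (X ω, Y ω))
    ⟨Measure.fst_map_prodMk hY, Measure.snd_map_prodMk hX⟩).trans ?_
  rw [lintegral_map (by fun_prop) (hX.prodMk hY)]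

theorem transportCost_self {d : ℕ} (μ : Measure (Rd d)) : transportCost μ μ = 0 := by
  have := transportCost_map_le μ (X := id) (Y := id) measurable_id measurable_id
  simpa using this

theorem W1_nonneg {d : ℕ} (μ ν : P1 d) : 0 ≤ W1 μ ν := ENNReal.toReal_nonneg

theorem W1_self {d : ℕ} (μ : P1 d) : W1 μ μ = 0 := by simp [W1, transportCost_self]

theorem W1_comm {d : ℕ} (μ ν : P1 d) : W1 μ ν = W1 ν μ := by
  unfold W1
  rw [le_antisymm (transportCost_comm_le μ.toMeasure ν.toMeasure) (transportCost_comm_le _ _)]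

theorem W1_triangle {d : ℕ} (μ ν ρ : P1 d) : W1 μ ρ ≤ W1 μ ν + W1 ν ρ := by
  unfold W1
  rw [← ENNReal.toReal_add (transportCost_lt_top _ _).ne (transportCost_lt_top _ _).ne]
  exact ENNReal.toReal_mono (ENNReal.add_ne_top.2
    ⟨(transportCost_lt_top _ _).ne, (transportCost_lt_top _ _).ne⟩) (transportCost_triangle _ _ _)

theorem abs_W1_sub_le {d : ℕ} (μ μ' ν ν' : P1 d) :
    |W1 μ ν - W1 μ' ν'| ≤ W1 μ μ' + W1 ν ν' := by
  have h1 := W1_triangle μ μ' ν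
  have h2 := W1_triangle μ' ν' ν
  have h3 := W1_triangle μ' μ ν'
  have h4 := W1_triangle μ ν ν'
  rw [W1_comm ν' ν] at h2
  rw [W1_comm μ' μ] at h3
  rw [abs_le]; constructor <;> linarith

theorem transportCost_eq_ofReal {d : ℕ} (μ ν : P1 d) :
    transportCost μ.toMeasure ν.toMeasure = ENNReal.ofReal (W1 μ ν) :=
  (ENNReal.ofReal_toReal (transportCost_lt_top _ _).ne).symm

theorem W1_le_of_transportCost_le {d : ℕ} {μ ν : P1 d} {r : ℝ} (hr : 0 ≤ r)
    (h : transportCost μ.toMeasure ν.toMeasure ≤ ENNReal.ofReal r) : W1 μ ν ≤ r :=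
  ENNReal.toReal_le_of_le_ofReal hr h

/-- Nearly optimal couplings. -/
theorem exists_coupling {d : ℕ} (μ ν : P1 d) {ε : ℝ} (hε : 0 < ε) :
    ∃ γ : Measure (Rd d × Rd d), γ.fst = μ.toMeasure ∧ γ.snd = ν.toMeasure ∧
      ∫⁻ p, edist p.1 p.2 ∂γ ≤ ENNReal.ofReal (W1 μ ν + ε) := by
  have : transportCost μ.toMeasure ν.toMeasure < ENNReal.ofReal (W1 μ ν + ε) := by
    rw [transportCost_eq_ofReal]
    exact (ENNReal.ofReal_lt_ofReal_iff (by linarith [W1_nonneg μ ν])).2 (by linarith)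
  simp only [transportCost, iInf_lt_iff] at this
  obtain ⟨γ, h, h'⟩ := this
  exact ⟨γ, h.1, h.2, h'.le⟩

/-- The first moment. -/
def moment {d : ℕ} (μ : P1 d) : ℝ := ∫ y, ‖y‖ ∂μ.toMeasure

theorem moment_nonneg {d : ℕ} (μ : P1 d) : 0 ≤ moment μ := integral_nonneg fun _ => norm_nonneg _

theorem integrable_norm {d : ℕ} (μ : P1 d) : Integrable (fun x : Rd d => ‖x‖) μ.toMeasure :=
  ⟨by fun_prop, by simpa [HasFiniteIntegral] using μ.finite_moment⟩

theorem integrable_of_le_norm {d : ℕ} (μ : P1 d) {E : Type*} [NormedAddCommGroup E]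
    {g : Rd d → E} (hg : AEStronglyMeasurable g μ.toMeasure) {a b : ℝ}
    (h : ∀ x, ‖g x‖ ≤ a + b * ‖x‖) : Integrable g μ.toMeasure :=
  (((integrable_const a).add ((integrable_norm μ).const_mul b))).mono' hg (ae_of_all _ h)

theorem norm_le_add_of_lipschitz {d : ℕ} {E : Type*} [NormedAddCommGroup E]
    {g : Rd d → E} {K : NNReal} (hg : LipschitzWith K g) (x : Rd d) :
    ‖g x‖ ≤ ‖g 0‖ + K * ‖x‖ := by
  have := hg.norm_sub_le x 0
  rw [sub_zero] at this
  have h2 := norm_le_norm_add_norm_sub' (g x) (g 0)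
  linarith

theorem integrable_of_lipschitz {d : ℕ} (μ : P1 d) {g : Rd d → ℝ} {K : NNReal}
    (hg : LipschitzWith K g) : Integrable g μ.toMeasure :=
  integrable_of_le_norm μ hg.continuous.aestronglyMeasurable (a := ‖g 0‖) (b := K)
    (norm_le_add_of_lipschitz hg)

/-- A bound for differences of integrals in terms of `W1`, with a weight integrable for the first
measure. -/
theorem abs_integral_sub_integral_le {d : ℕ} (μ ν : P1 d) {g h : Rd d → ℝ} {K : ℝ} (hK : 0 ≤ K)
    (hgμ : Integrable g μ.toMeasure) (hgν : Integrable g ν.toMeasure)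
    (hh : Integrable h μ.toMeasure)
    (hg : ∀ x y, |g x - g y| ≤ K * dist x y + h x) :
    |∫ x, g x ∂μ.toMeasure - ∫ x, g x ∂ν.toMeasure| ≤ K * W1 μ ν + ∫ x, h x ∂μ.toMeasure := by
  refine le_of_forall_pos_le_add fun ε hε => ?_
  have hε' : 0 < ε / (K + 1) := by positivity
  obtain ⟨γ, h1, h2, hc⟩ := exists_coupling μ ν hε'
  have m1 : MeasurePreserving Prod.fst γ μ.toMeasure := ⟨measurable_fst, h1⟩
  have m2 : MeasurePreserving Prod.snd γ ν.toMeasure := ⟨measurable_snd, h2⟩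
  have i1 : Integrable (fun p : Rd d × Rd d => g p.1) γ := m1.integrable_comp_of_integrable hgμ
  have i2 : Integrable (fun p : Rd d × Rd d => g p.2) γ := m2.integrable_comp_of_integrable hgν
  have i3 : Integrable (fun p : Rd d × Rd d => h p.1) γ := m1.integrable_comp_of_integrable hh
  have i4 : Integrable (fun p : Rd d × Rd d => dist p.1 p.2) γ := by
    refine ⟨by fun_prop, ?_⟩
    simp only [HasFiniteIntegral, ← edist_dist, Real.enorm_of_nonneg dist_nonneg]
    exact hc.trans_lt ENNReal.ofReal_lt_top
  have e1 : ∫ x, g x ∂μ.toMeasure = ∫ p, g p.1 ∂γ := by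
    rw [← h1, Measure.fst, integral_map (by fun_prop)]
    have := hgμ.aestronglyMeasurable
    rw [← h1, Measure.fst] at this; exact this
  have e2 : ∫ x, g x ∂ν.toMeasure = ∫ p, g p.2 ∂γ := by
    rw [← h2, Measure.snd, integral_map (by fun_prop)]
    have := hgν.aestronglyMeasurable
    rw [← h2, Measure.snd] at this; exact this
  have e3 : ∫ x, h x ∂μ.toMeasure = ∫ p, h p.1 ∂γ := by
    rw [← h1, Measure.fst, integral_map (by fun_prop)]
    have := hh.aestronglyMeasurable
    rw [← h1, Measure.fst] at this; exact this
  have e4 : ∫ p, dist p.1 p.2 ∂γ ≤ W1 μ ν + ε / (K + 1) := by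
    rw [integral_eq_lintegral_of_nonneg_ae (ae_of_all _ fun _ => dist_nonneg) (by fun_prop)]
    refine ENNReal.toReal_le_of_le_ofReal (by linarith [W1_nonneg μ ν]) ?_
    simpa only [← edist_dist] using hc
  rw [e1, e2, e3, ← integral_sub i1 i2]
  calc |∫ p, (g p.1 - g p.2) ∂γ| ≤ ∫ p, |g p.1 - g p.2| ∂γ := abs_integral_le_integral_abs
    _ ≤ ∫ p, (K * dist p.1 p.2 + h p.1) ∂γ :=
        integral_mono (i1.sub i2).abs ((i4.const_mul K).add i3) fun p => hg _ _
    _ = K * ∫ p, dist p.1 p.2 ∂γ + ∫ p, h p.1 ∂γ := by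
        rw [integral_add (i4.const_mul K) i3, integral_const_mul]
    _ ≤ K * (W1 μ ν + ε / (K + 1)) + ∫ p, h p.1 ∂γ := by gcongr
    _ ≤ K * W1 μ ν + ∫ p, h p.1 ∂γ + ε := by
        have : K * (ε / (K + 1)) ≤ ε := by
          rw [mul_div_assoc', div_le_iff₀ (by positivity)]; nlinarith
        linarith

theorem abs_integral_sub_integral_le_of_lipschitz {d : ℕ} (μ ν : P1 d) {g : Rd d → ℝ} {K : NNReal}
    (hg : LipschitzWith K g) :
    |∫ x, g x ∂μ.toMeasure - ∫ x, g x ∂ν.toMeasure| ≤ K * W1 μ ν := by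
  have := abs_integral_sub_integral_le μ ν (h := fun _ => 0) K.2 (integrable_of_lipschitz μ hg)
    (integrable_of_lipschitz ν hg) (integrable_zero _ _ _)
    (fun x y => by simpa [Real.dist_eq] using hg.dist_le_mul x y)
  simpa using this

/-- The underlying element of Mathlib's space of probability measures. -/
def P1.toPM {d : ℕ} (μ : P1 d) : ProbabilityMeasure (Rd d) := ⟨μ.toMeasure, μ.isProb⟩

theorem tendsto_toPM_of_W1 {d : ℕ} {ι : Type*} {l : Filter ι} [l.IsCountablyGenerated]
    {μs : ι → P1 d} {μ : P1 d}
    (h : Tendsto (fun i => W1 (μs i) μ) l (𝓝 0)) :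
    Tendsto (fun i => (μs i).toPM) l (𝓝 μ.toPM) := by
  rw [tendsto_iff_forall_lipschitz_integral_tendsto]
  rintro f - ⟨K, hK⟩
  rw [tendsto_iff_dist_tendsto_zero]
  refine squeeze_zero (fun _ => dist_nonneg)
    (fun i => abs_integral_sub_integral_le_of_lipschitz (μs i) μ hK) ?_
  simpa using h.const_mul (K : ℝ)

/-- A constant sequence at distance zero converges weakly to both measures, and weak limits are
unique. No optimal coupling is needed. -/
theorem eq_of_W1_eq_zero {d : ℕ} {μ ν : P1 d} (h : W1 μ ν = 0) : μ = ν := by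
  have h1 : Tendsto (fun _ : ℕ => μ.toPM) atTop (𝓝 ν.toPM) :=
    tendsto_toPM_of_W1 (by simp [h])
  have h2 := tendsto_nhds_unique h1 tendsto_const_nhds
  ext1
  exact congrArg Subtype.val h2.symm

theorem continuous_of_W1 {d : ℕ} {X : Type*} [TopologicalSpace X] {m : X → P1 d}
    (h : ∀ t, Tendsto (fun s => W1 (m s) (m t)) (𝓝 t) (𝓝 0)) : Continuous m := by
  refine continuous_def.2 fun U hU => isOpen_iff_mem_nhds.2 fun t ht => ?_
  obtain ⟨ε, hε, hU'⟩ := hU (m t) ht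
  filter_upwards [(h t).eventually_lt_const hε] with s hs
  exact hU' _ (by rwa [W1_comm])

end Vlasov

/-! ### Weak convergence with uniformly integrable norms is convergence in `W1`. -/

namespace Vlasov

/-- Transport between two measures carried by the same finite family of points. -/
theorem transportCost_sum_dirac_le {d : ℕ} {ι : Type*} [Fintype ι] (p : ι → Rd d) {D : ℝ≥0∞}
    (hD : ∀ i j, edist (p i) (p j) ≤ D) (a b : ι → ℝ≥0∞) (ha : ∑ i, a i = 1) (hb : ∑ i, b i = 1) :
    transportCost (∑ i, a i • Measure.dirac (p i)) (∑ i, b i • Measure.dirac (p i)) ≤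
      D * ∑ i, (a i - b i) := by
  -- Subtraction is truncated, so `r` is the total surplus of `a` over `b`. It equals the total
  -- deficit because both families have mass one.
  set r := ∑ i, (a i - b i) with hr
  have hr' : r = ∑ i, (b i - a i) := by
    have h1 : r + ∑ i, min (a i) (b i) = 1 := by
      rw [hr, ← Finset.sum_add_distrib, ← ha]
      exact Finset.sum_congr rfl fun i _ => tsub_add_min
    have h2 : ∑ i, (b i - a i) + ∑ i, min (a i) (b i) = 1 := by
      rw [← Finset.sum_add_distrib, ← hb]
      refine Finset.sum_congr rfl fun i _ => ?_
      rw [min_comm]; exact tsub_add_min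
    have h3 : ∑ i, min (a i) (b i) ≠ ∞ := by
      intro h; rw [h] at h1; simp at h1
    exact (ENNReal.add_left_inj h3).1 (h1.trans h2.symm)
  have hr1 : r ≠ ∞ := by
    refine ((Finset.sum_le_sum fun i _ => tsub_le_self).trans_lt (?_ : ∑ i, a i < ∞)).ne
    rw [ha]; exact ENNReal.one_lt_top
  have hcancel : ∀ c : ℝ≥0∞, c ≤ r → r⁻¹ * c * r = c := by
    intro c hc
    rcases eq_or_ne r 0 with h0 | h0
    · rw [h0] at hc; simp [le_zero_iff.1 hc]
    · rw [mul_comm r⁻¹, mul_assoc, ENNReal.inv_mul_cancel h0 hr1, mul_one]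
  -- The common mass `min (a i) (b i)` stays in place. Each surplus is spread over the deficits in
  -- proportion to their size. When `r = 0` the factor `r⁻¹` is infinite, but it multiplies zero.
  set γ : Measure (Rd d × Rd d) := ∑ i, min (a i) (b i) • Measure.dirac (p i, p i) +
    ∑ i, ∑ j, (r⁻¹ * (a i - b i) * (b j - a j)) • Measure.dirac (p i, p j) with hγ
  have h1 : γ.fst = ∑ i, a i • Measure.dirac (p i) := by
    ext s hs
    rw [Measure.fst_apply hs]
    simp only [hγ, Measure.coe_add, Pi.add_apply, Measure.coe_finsetSum, Finset.sum_apply,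
      Measure.smul_apply, smul_eq_mul, Measure.dirac_apply' _ (measurable_fst hs),
      Measure.dirac_apply' _ hs]
    rw [← Finset.sum_add_distrib]
    refine Finset.sum_congr rfl fun i _ => ?_
    have : ∀ j, (Prod.fst ⁻¹' s).indicator (1 : Rd d × Rd d → ℝ≥0∞) (p i, p j) =
      s.indicator 1 (p i) := fun j => rfl
    simp only [this]
    rw [← Finset.sum_mul, ← Finset.mul_sum, ← hr',
      hcancel _ (Finset.single_le_sum (f := fun i => a i - b i) (fun _ _ => zero_le)
        (Finset.mem_univ i)), ← add_mul, add_comm, tsub_add_min]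
  have h2 : γ.snd = ∑ i, b i • Measure.dirac (p i) := by
    ext s hs
    rw [Measure.snd_apply hs]
    simp only [hγ, Measure.coe_add, Pi.add_apply, Measure.coe_finsetSum, Finset.sum_apply,
      Measure.smul_apply, smul_eq_mul, Measure.dirac_apply' _ (measurable_snd hs),
      Measure.dirac_apply' _ hs]
    rw [Finset.sum_comm, ← Finset.sum_add_distrib]
    refine Finset.sum_congr rfl fun j _ => ?_
    have : ∀ i, (Prod.snd ⁻¹' s).indicator (1 : Rd d × Rd d → ℝ≥0∞) (p i, p j) =
      s.indicator 1 (p j) := fun i => rfl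
    simp only [this]
    have e : ∀ i, r⁻¹ * (a i - b i) * (b j - a j) = r⁻¹ * (b j - a j) * (a i - b i) :=
      fun i => by ring
    simp only [e]
    rw [← Finset.sum_mul, ← Finset.mul_sum, ← hr,
      hcancel _ (hr' ▸ Finset.single_le_sum (f := fun i => b i - a i) (fun _ _ => zero_le)
        (Finset.mem_univ j)), ← add_mul, add_comm, min_comm, tsub_add_min]
  refine (iInf₂_le γ ⟨h1, h2⟩).trans ?_
  simp only [hγ, lintegral_add_measure, lintegral_finsetSum_measure, lintegral_smul_measure,
    lintegral_dirac, edist_self, smul_eq_mul, mul_zero, Finset.sum_const_zero, zero_add]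
  calc ∑ i, ∑ j, r⁻¹ * (a i - b i) * (b j - a j) * edist (p i) (p j)
      ≤ ∑ i, ∑ j, r⁻¹ * (a i - b i) * (b j - a j) * D := by
        refine Finset.sum_le_sum fun i _ => Finset.sum_le_sum fun j _ => ?_
        gcongr
        exact hD i j
    _ = ∑ i, (a i - b i) * D := by
        refine Finset.sum_congr rfl fun i _ => ?_
        rw [← Finset.sum_mul, ← Finset.mul_sum, ← hr',
          hcancel _ (Finset.single_le_sum (f := fun i => a i - b i) (fun _ _ => zero_le)
            (Finset.mem_univ i))]
    _ = D * r := by rw [← Finset.sum_mul, mul_comm]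

/-- The cost of moving `μ` to a finite set of points along a partition of unity. -/
theorem transportCost_quantize_le {d : ℕ} {ι : Type*} [Fintype ι] (p : ι → Rd d)
    (χ : ι → Rd d → ℝ≥0∞) (hχ : ∀ i, Measurable (χ i)) (hsum : ∀ x, ∑ i, χ i x = 1)
    (μ : Measure (Rd d)) :
    transportCost μ (∑ i, (∫⁻ x, χ i x ∂μ) • Measure.dirac (p i)) ≤
      ∫⁻ x, ∑ i, χ i x * edist x (p i) ∂μ := by
  -- The portion of `μ` with density `χ i` is sent to the point `p i`.
  set γ : Measure (Rd d × Rd d) := ∑ i, (μ.withDensity (χ i)).map fun x => (x, p i) with hγ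
  have hm : ∀ i, Measurable fun x : Rd d => (x, p i) := fun i => by fun_prop
  have h1 : γ.fst = μ := by
    ext s hs
    rw [Measure.fst_apply hs]
    simp only [hγ, Measure.coe_finsetSum, Finset.sum_apply,
      Measure.map_apply (hm _) (measurable_fst hs)]
    have : ∀ i, (fun x : Rd d => (x, p i)) ⁻¹' (Prod.fst ⁻¹' s) = s := fun i => rfl
    simp only [this, withDensity_apply _ hs]
    rw [← lintegral_finsetSum _ fun i _ => hχ i]
    simp [hsum]
  have h2 : γ.snd = ∑ i, (∫⁻ x, χ i x ∂μ) • Measure.dirac (p i) := by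
    ext s hs
    rw [Measure.snd_apply hs]
    simp only [hγ, Measure.coe_finsetSum, Finset.sum_apply,
      Measure.map_apply (hm _) (measurable_snd hs), Measure.smul_apply, smul_eq_mul,
      Measure.dirac_apply' _ hs]
    refine Finset.sum_congr rfl fun i _ => ?_
    by_cases h : p i ∈ s
    · have : (fun x : Rd d => (x, p i)) ⁻¹' (Prod.snd ⁻¹' s) = univ := by ext; simp [h]
      simp [this, h]
    · have : (fun x : Rd d => (x, p i)) ⁻¹' (Prod.snd ⁻¹' s) = ∅ := by ext; simp [h]
      simp [this, h]
  refine (iInf₂_le γ ⟨h1, h2⟩).trans (le_of_eq ?_)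
  rw [hγ, lintegral_finsetSum_measure, lintegral_finsetSum _ fun i _ => by fun_prop]
  refine Finset.sum_congr rfl fun i _ => ?_
  rw [lintegral_map (by fun_prop) (hm i), lintegral_withDensity_eq_lintegral_mul _ (hχ i)
    (by fun_prop)]
  rfl

/-- Quantitative integrability of the norm. -/
def TailBound {d : ℕ} (τ : ℕ → ℝ≥0∞) (μ : Measure (Rd d)) : Prop :=
  ∀ n : ℕ, ∫⁻ x, ENNReal.ofReal (‖x‖ - n) ∂μ ≤ τ n

theorem TailBound.lintegral_enorm_lt_top {d : ℕ} {τ : ℕ → ℝ≥0∞} (hτ : Tendsto τ atTop (𝓝 0))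
    {μ : Measure (Rd d)} [IsFiniteMeasure μ] (h : TailBound τ μ) : ∫⁻ x, ‖x‖ₑ ∂μ < ∞ := by
  obtain ⟨n, hn⟩ := (hτ.eventually_lt_const (ENNReal.zero_lt_top)).exists
  calc ∫⁻ x, ‖x‖ₑ ∂μ ≤ ∫⁻ x, ((n : ℝ≥0∞) + ENNReal.ofReal (‖x‖ - n)) ∂μ := by
        refine lintegral_mono fun x => ?_
        rw [← ofReal_norm, ← ENNReal.ofReal_natCast]
        refine le_trans (le_of_eq ?_) ENNReal.ofReal_add_le
        congr 1; ring
    _ = n * μ univ + ∫⁻ x, ENNReal.ofReal (‖x‖ - n) ∂μ := by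
        rw [lintegral_add_left (by fun_prop), lintegral_const]
    _ < ∞ := ENNReal.add_lt_top.2 ⟨ENNReal.mul_lt_top (ENNReal.natCast_lt_top n)
        (measure_lt_top _ _), (h n).trans_lt hn⟩

theorem tendsto_tail {Ω : Type*} [MeasurableSpace Ω] (P : Measure Ω) [IsFiniteMeasure P]
    {f : Ω → ℝ} (hf : Integrable f P) :
    Tendsto (fun n : ℕ => ∫⁻ ω, ENNReal.ofReal (f ω - n) ∂P) atTop (𝓝 0) := by
  have : Tendsto (fun n : ℕ => ∫⁻ ω, ENNReal.ofReal (f ω - n) ∂P) atTop (𝓝 (∫⁻ _, 0 ∂P)) := by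
    refine tendsto_lintegral_of_dominated_convergence' (fun ω => ‖f ω‖ₑ) (fun n => ?_)
      (fun n => ae_of_all _ fun ω => ?_) hf.2.ne (ae_of_all _ fun ω => ?_)
    · exact (hf.1.aemeasurable.sub_const _).ennreal_ofReal
    · dsimp only
      rw [← ofReal_norm]
      refine ENNReal.ofReal_le_ofReal ?_
      have := Real.le_norm_self (f ω)
      have : (0 : ℝ) ≤ n := n.cast_nonneg
      linarith
    · refine tendsto_const_nhds.congr' ?_
      obtain ⟨N, hN⟩ := exists_nat_ge (f ω)
      filter_upwards [eventually_ge_atTop N] with n hn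
      have : (N : ℝ) ≤ n := by exact_mod_cast hn
      rw [ENNReal.ofReal_of_nonpos (by linarith)]
  simpa using this

/-- Prokhorov's theorem. The tail bounds pass to weak limits by lower semicontinuity of integrals of
nonnegative continuous functions, and they give tightness by Markov's inequality. -/
theorem isCompact_tailBound {d : ℕ} {τ : ℕ → ℝ≥0∞} (hτ : Tendsto τ atTop (𝓝 0)) :
    IsCompact {ν : ProbabilityMeasure (Rd d) | TailBound τ (ν : Measure (Rd d))} := by
  set S := {ν : ProbabilityMeasure (Rd d) | TailBound τ (ν : Measure (Rd d))} with hS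
  have hclosed : IsClosed S := by
    refine IsSeqClosed.isClosed fun νs ν hνs hν n => ?_
    have h0 : ∀ x : Rd d, ENNReal.ofReal (‖x‖ - n) = ENNReal.ofReal (max (‖x‖ - n) 0) := by
      intro x; simp
    have := lintegral_le_liminf_lintegral_of_forall_isOpen_measure_le_liminf_measure
      (μ := (ν : Measure (Rd d))) (μs := fun i => (νs i : Measure (Rd d)))
      (f := fun x => max (‖x‖ - n) 0) (by fun_prop) (fun x => le_max_right _ _)
      (fun G hG => ProbabilityMeasure.le_liminf_measure_open_of_tendsto hν hG)
    simp only [← h0] at this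
    refine this.trans ?_
    refine (liminf_le_liminf (Eventually.of_forall fun i => hνs i n)).trans ?_
    simp
  have htight : IsTightMeasureSet {x : Measure (Rd d) | ∃ μ ∈ S, (μ : Measure (Rd d)) = x} := by
    rw [isTightMeasureSet_iff_exists_isCompact_measure_compl_le]
    intro ε hε
    obtain ⟨n, hn⟩ := (hτ.eventually_lt_const hε).exists
    -- Outside the ball of radius `n + 1` the integrand `‖x‖ - n` of the tail bound is at least one.
    refine ⟨Metric.closedBall 0 (n + 1), isCompact_closedBall _ _, ?_⟩
    rintro _ ⟨μ, hμ, rfl⟩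
    refine le_trans ?_ ((hμ n).trans hn.le)
    rw [← lintegral_indicator_one Metric.isClosed_closedBall.measurableSet.compl]
    refine lintegral_mono fun x => ?_
    by_cases hx : x ∈ (Metric.closedBall (0 : Rd d) (n + 1))ᶜ
    · simp only [indicator_of_mem hx, Pi.one_apply]
      rw [← ENNReal.ofReal_one]
      refine ENNReal.ofReal_le_ofReal ?_
      simp at hx
      linarith
    · simp [indicator_of_notMem hx]
  have := isCompact_closure_of_isTightMeasureSet htight
  rwa [hclosed.closure_eq] at this

/-- A continuous partition of unity subordinate to small balls and the exterior of a large ball. -/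
theorem exists_partition {d : ℕ} {ε : ℝ} (hε : 0 < ε) (n : ℕ) :
    ∃ (s : Finset (Rd d)) (p : Option s → Rd d) (χ : Option s → Rd d → ℝ),
      (∀ i, Continuous (χ i)) ∧ (∀ i x, 0 ≤ χ i x) ∧ (∀ x, ∑ i, χ i x = 1) ∧
      ∀ x, ∑ i, χ i x * dist x (p i) ≤ 2 * ε + 2 * max (‖x‖ - n) 0 := by
  obtain ⟨t, ht, htf, hcov⟩ := Metric.totallyBounded_iff.1
    (isCompact_closedBall (0 : Rd d) (2 * n + 1)).totallyBounded ε hε |>.imp fun t h =>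
      (⟨trivial, h.1, h.2⟩ : True ∧ _ ∧ _)
  set s := htf.toFinset
  set p : Option s → Rd d := fun i => i.elim 0 (fun y => y.1) with hp
  -- The bumps have radius `2 * ε` around an `ε`-net of the ball of radius `2 * n + 1`, and the
  -- exterior bump starts at `2 * n`, so the sum is positive everywhere. The exterior piece is sent
  -- to the origin, which costs `‖x‖ ≤ 2 * (‖x‖ - n)` where that bump is nonzero.
  set a : Option s → Rd d → ℝ := fun i x =>
    i.elim (max (‖x‖ - 2 * n) 0) (fun y => max (2 * ε - dist x y.1) 0) with ha
  have hac : ∀ i, Continuous (a i) := by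
    rintro (_ | y)
    · simp only [ha, Option.elim]; fun_prop
    · simp only [ha, Option.elim]; fun_prop
  have ha0 : ∀ i x, 0 ≤ a i x := by
    rintro (_ | y) x <;> exact le_max_right _ _
  have hpos : ∀ x, 0 < ∑ i, a i x := by
    intro x
    obtain ⟨i, hi⟩ : ∃ i, 0 < a i x := by
      by_cases hx : x ∈ Metric.closedBall (0 : Rd d) (2 * n + 1)
      · have := hcov hx
        simp only [mem_iUnion, Metric.mem_ball] at this
        obtain ⟨y, hy, hxy⟩ := this
        refine ⟨some ⟨y, htf.mem_toFinset.2 hy⟩, ?_⟩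
        simp only [ha, Option.elim]
        exact lt_max_of_lt_left (by linarith)
      · refine ⟨none, ?_⟩
        simp at hx
        simp only [ha, Option.elim]
        exact lt_max_of_lt_left (by linarith)
    exact Finset.sum_pos' (fun i _ => ha0 i x) ⟨i, Finset.mem_univ _, hi⟩
  have hS : Continuous fun x => ∑ i, a i x := continuous_finsetSum _ fun i _ => hac i
  have h1 : ∀ x, ∑ i, a i x / ∑ j, a j x = 1 := fun x => by
    rw [← Finset.sum_div, div_self (hpos x).ne']
  refine ⟨s, p, fun i x => a i x / ∑ j, a j x, fun i => (hac i).div hS fun x => (hpos x).ne',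
    fun i x => div_nonneg (ha0 i x) (hpos x).le, h1, fun x => ?_⟩
  calc ∑ i, a i x / (∑ j, a j x) * dist x (p i)
      ≤ ∑ i, a i x / (∑ j, a j x) * (2 * ε + 2 * max (‖x‖ - n) 0) := by
        refine Finset.sum_le_sum fun i _ => ?_
        rw [div_mul_eq_mul_div, div_mul_eq_mul_div]
        refine div_le_div_of_nonneg_right ?_ (hpos x).le
        rcases i with _ | y
        · simp only [ha, hp, Option.elim, dist_zero_right]
          rcases le_or_gt (‖x‖ - 2 * n) 0 with h | h
          · simp [max_eq_right h]
          · refine mul_le_mul_of_nonneg_left ?_ (le_max_right _ _)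
            have := le_max_left (‖x‖ - n) 0
            linarith
        · simp only [ha, hp, Option.elim]
          rcases le_or_gt (2 * ε - dist x y) 0 with h | h
          · simp [max_eq_right h]
          · refine mul_le_mul_of_nonneg_left ?_ (le_max_right _ _)
            have := le_max_right (‖x‖ - n) 0
            linarith
    _ = _ := by rw [← Finset.sum_mul, h1, one_mul]

/-- Weak convergence and uniform integrability imply convergence of the transport cost. -/
theorem tendsto_W1_of_tendsto_toPM {d : ℕ} {ι : Type*} {l : Filter ι} {μs : ι → P1 d} {μ : P1 d}
    {τ : ℕ → ℝ≥0∞} (hτ : Tendsto τ atTop (𝓝 0)) (hs : ∀ i, TailBound τ (μs i).toMeasure)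
    (hw : Tendsto (fun i => (μs i).toPM) l (𝓝 μ.toPM)) :
    Tendsto (fun i => W1 (μs i) μ) l (𝓝 0) := by
  have htail : Tendsto (fun n : ℕ => ∫⁻ x, ENNReal.ofReal (‖x‖ - n) ∂μ.toMeasure) atTop (𝓝 0) :=
    tendsto_tail _ (integrable_norm μ)
  rw [Metric.tendsto_nhds]
  intro ε' hε'
  -- Quantizing each of the two measures costs at most `4 * ε`, and transport between the quantized
  -- measures costs at most `ε` once their weights are close. The total is `9 * ε < ε'`.
  set ε := ε' / 16 with hε
  have hε0 : 0 < ε := by positivity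
  have hεE : 0 < ENNReal.ofReal ε := ENNReal.ofReal_pos.2 hε0
  obtain ⟨n, hn1, hn2⟩ := ((hτ.eventually_lt_const hεE).and
    (htail.eventually_lt_const hεE)).exists
  obtain ⟨s, p, χ, hχc, hχ0, hχ1, hχd⟩ := exists_partition (d := d) hε0 n
  have hsum : ∀ x, ∑ i, ENNReal.ofReal (χ i x) = 1 := fun x => by
    rw [← ENNReal.ofReal_sum_of_nonneg fun i _ => hχ0 i x, hχ1, ENNReal.ofReal_one]
  have hcost : ∀ ν : P1 d, ∫⁻ x, ENNReal.ofReal (‖x‖ - n) ∂ν.toMeasure ≤ ENNReal.ofReal ε →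
      transportCost ν.toMeasure (∑ i, (∫⁻ x, ENNReal.ofReal (χ i x) ∂ν.toMeasure) •
        Measure.dirac (p i)) ≤ ENNReal.ofReal (4 * ε) := by
    intro ν hν
    refine (transportCost_quantize_le p (fun i x => ENNReal.ofReal (χ i x))
      (fun i => (hχc i).measurable.ennreal_ofReal) hsum ν.toMeasure).trans ?_
    calc ∫⁻ x, ∑ i, ENNReal.ofReal (χ i x) * edist x (p i) ∂ν.toMeasure
        ≤ ∫⁻ x, (ENNReal.ofReal (2 * ε) + 2 * ENNReal.ofReal (‖x‖ - n)) ∂ν.toMeasure := by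
          refine lintegral_mono fun x => ?_
          have : ∑ i, ENNReal.ofReal (χ i x) * edist x (p i) =
              ENNReal.ofReal (∑ i, χ i x * dist x (p i)) := by
            rw [ENNReal.ofReal_sum_of_nonneg fun i _ => mul_nonneg (hχ0 i x) dist_nonneg]
            refine Finset.sum_congr rfl fun i _ => ?_
            rw [ENNReal.ofReal_mul (hχ0 i x), edist_dist]
          dsimp only
          rw [this]
          refine (ENNReal.ofReal_le_ofReal (hχd x)).trans ?_
          refine ENNReal.ofReal_add_le.trans ?_
          rw [ENNReal.ofReal_mul zero_le_two (q := max _ _)]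
          simp
      _ = ENNReal.ofReal (2 * ε) + 2 * ∫⁻ x, ENNReal.ofReal (‖x‖ - n) ∂ν.toMeasure := by
          rw [lintegral_add_left (by fun_prop), lintegral_const_mul _ (by fun_prop)]
          simp
      _ ≤ ENNReal.ofReal (2 * ε) + 2 * ENNReal.ofReal ε := by gcongr
      _ = ENNReal.ofReal (4 * ε) := by
          rw [show (2 : ℝ≥0∞) = ENNReal.ofReal 2 by simp, ← ENNReal.ofReal_mul zero_le_two,
            ← ENNReal.ofReal_add (by positivity) (by positivity)]
          congr 1; ring
  have hq1 : ∀ ν : P1 d, ∑ i, ∫⁻ x, ENNReal.ofReal (χ i x) ∂ν.toMeasure = 1 := fun ν => by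
    rw [← lintegral_finsetSum _ fun i _ => (hχc i).measurable.ennreal_ofReal]
    simp [hsum]
  have hχ1' : ∀ i x, χ i x ≤ 1 := fun i x => by
    rw [← hχ1 x]; exact Finset.single_le_sum (f := fun i => χ i x) (fun j _ => hχ0 j x)
      (Finset.mem_univ i)
  -- The partition functions are bounded and continuous, so the weights of the atoms converge under
  -- weak convergence. This is why a continuous partition of unity replaces a measurable one.
  have hqlim : ∀ i, Tendsto (fun k => ∫⁻ x, ENNReal.ofReal (χ i x) ∂(μs k).toMeasure) l
      (𝓝 (∫⁻ x, ENNReal.ofReal (χ i x) ∂μ.toMeasure)) := by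
    intro i
    have := (ProbabilityMeasure.tendsto_iff_forall_integral_tendsto.1 hw)
      (BoundedContinuousFunction.ofNormedAddCommGroup (χ i) (hχc i) 1 fun x => by
        rw [Real.norm_of_nonneg (hχ0 i x)]; exact hχ1' i x)
    have h2 := (ENNReal.continuous_ofReal.tendsto _).comp this
    have h3 : ∀ ν : P1 d, ENNReal.ofReal (∫ x, χ i x ∂ν.toMeasure) =
        ∫⁻ x, ENNReal.ofReal (χ i x) ∂ν.toMeasure := fun ν => by
      refine ofReal_integral_eq_lintegral_ofReal ?_ (ae_of_all _ (hχ0 i))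
      exact (integrable_const (1 : ℝ)).mono' (hχc i).aestronglyMeasurable
        (ae_of_all _ fun x => by rw [Real.norm_of_nonneg (hχ0 i x)]; exact hχ1' i x)
    rw [← h3]
    simp only [← h3]
    exact h2
  set D : ℝ≥0∞ := ∑ i, ∑ j, edist (p i) (p j) with hD
  have hDtop : D ≠ ∞ := ENNReal.sum_ne_top.2 fun i _ => ENNReal.sum_ne_top.2 fun j _ =>
    edist_ne_top _ _
  have hDle : ∀ i j, edist (p i) (p j) ≤ D := fun i j =>
    (Finset.single_le_sum (f := fun j => edist (p i) (p j)) (fun _ _ => zero_le)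
      (Finset.mem_univ j)).trans
    (Finset.single_le_sum (f := fun i => ∑ j, edist (p i) (p j)) (fun _ _ => zero_le)
      (Finset.mem_univ i))
  have hmid : Tendsto (fun k => D * ∑ i, ((∫⁻ x, ENNReal.ofReal (χ i x) ∂(μs k).toMeasure) -
      ∫⁻ x, ENNReal.ofReal (χ i x) ∂μ.toMeasure)) l (𝓝 0) := by
    have h1 : Tendsto (fun k => ∑ i, ((∫⁻ x, ENNReal.ofReal (χ i x) ∂(μs k).toMeasure) -
      ∫⁻ x, ENNReal.ofReal (χ i x) ∂μ.toMeasure)) l (𝓝 (∑ i : Option s, 0)) := by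
      refine tendsto_finsetSum _ fun i _ => ?_
      have hfin : ∫⁻ x, ENNReal.ofReal (χ i x) ∂μ.toMeasure ≠ ∞ := by
        refine ne_top_of_le_ne_top ENNReal.one_ne_top ?_
        rw [← hq1 μ]
        exact Finset.single_le_sum (f := fun i => ∫⁻ x, ENNReal.ofReal (χ i x) ∂μ.toMeasure)
          (fun _ _ => zero_le) (Finset.mem_univ i)
      have := ENNReal.Tendsto.sub (hqlim i) (tendsto_const_nhds
        (x := ∫⁻ x, ENNReal.ofReal (χ i x) ∂μ.toMeasure)) (Or.inl hfin)
      simpa using this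
    have h2 := ENNReal.Tendsto.const_mul (a := D) h1 (Or.inr hDtop)
    simpa using h2
  filter_upwards [hmid.eventually_lt_const hεE] with k hk
  have hprob : ∀ ν : P1 d, IsProbabilityMeasure (∑ i, (∫⁻ x, ENNReal.ofReal (χ i x) ∂ν.toMeasure) •
        Measure.dirac (p i)) := fun ν => ⟨by
      simp only [Measure.coe_finsetSum, Finset.sum_apply, Measure.smul_apply, measure_univ,
        smul_eq_mul, mul_one]
      exact hq1 ν⟩
  have := hprob (μs k)
  have := hprob μ
  have h1 : transportCost (μs k).toMeasure μ.toMeasure ≤ ENNReal.ofReal (9 * ε) := by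
    refine (transportCost_triangle _ (∑ i, (∫⁻ x, ENNReal.ofReal (χ i x) ∂(μs k).toMeasure) •
        Measure.dirac (p i)) _).trans ?_
    rw [show 9 * ε = 4 * ε + (ε + 4 * ε) by ring, ENNReal.ofReal_add (by positivity)
      (by positivity), ENNReal.ofReal_add (by positivity) (by positivity)]
    refine add_le_add (hcost _ ((hs k n).trans hn1.le)) ?_
    refine (transportCost_triangle _ (∑ i, (∫⁻ x, ENNReal.ofReal (χ i x) ∂μ.toMeasure) •
        Measure.dirac (p i)) _).trans ?_
    refine add_le_add ?_ ((transportCost_comm_le _ _).trans (hcost _ hn2.le))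
    exact (transportCost_sum_dirac_le p hDle _ _ (hq1 _) (hq1 _)).trans hk.le
  rw [Real.dist_eq, sub_zero, abs_of_nonneg (W1_nonneg _ _)]
  refine (W1_le_of_transportCost_le (by positivity) h1).trans_lt ?_
  rw [hε]; linarith

end Vlasov

/-! ### Linear continuity equations tested against compactly supported observables. -/

namespace Vlasov

theorem abs_moment_sub_le {d : ℕ} (μ ν : P1 d) : |moment μ - moment ν| ≤ W1 μ ν := by
  simpa [moment] using abs_integral_sub_integral_le_of_lipschitz μ ν
    (g := fun x => ‖x‖) (K := 1) lipschitzWith_one_norm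

/-- The kernel of a `W1`-continuous curve. -/
theorem measurable_toMeasure_of_W1 {d : ℕ} {m : ℝ → P1 d}
    (h : ∀ t, Tendsto (fun s => W1 (m s) (m t)) (𝓝 t) (𝓝 0)) :
    Measurable fun t => (m t).toMeasure := by
  refine Measurable.measure_of_isPiSystem_of_isProbabilityMeasure (S := {s | IsOpen s})
    (BorelSpace.measurable_eq) isPiSystem_isOpen fun G hG => ?_
  -- By the portmanteau theorem the mass of an open set is lower semicontinuous along the curve, and
  -- open sets form a generating π-system.
  refine LowerSemicontinuous.measurable (lowerSemicontinuous_iff_le_liminf.2 fun t => ?_)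
  exact ProbabilityMeasure.le_liminf_measure_open_of_tendsto (tendsto_toPM_of_W1 (h t)) hG

theorem stronglyMeasurable_integral_curve {d : ℕ} {m : ℝ → P1 d} {E : Type*}
    [NormedAddCommGroup E] [NormedSpace ℝ E]
    (h : ∀ t, Tendsto (fun s => W1 (m s) (m t)) (𝓝 t) (𝓝 0)) {f : ℝ × Rd d → E}
    (hf : StronglyMeasurable f) :
    StronglyMeasurable fun t => ∫ x, f (t, x) ∂(m t).toMeasure := by
  let κ : ProbabilityTheory.Kernel ℝ (Rd d) := ⟨_, measurable_toMeasure_of_W1 h⟩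
  have : ProbabilityTheory.IsMarkovKernel κ := ⟨fun t => (m t).isProb⟩
  exact hf.integral_kernel_prod_right' (κ := κ)

theorem continuous_integral_curve {d : ℕ} {m : ℝ → P1 d}
    (h : ∀ t, Tendsto (fun s => W1 (m s) (m t)) (𝓝 t) (𝓝 0)) {g : Rd d → ℝ} {K : NNReal}
    (hg : LipschitzWith K g) : Continuous fun t => ∫ x, g x ∂(m t).toMeasure := by
  refine continuous_iff_continuousAt.2 fun t => tendsto_iff_dist_tendsto_zero.2 ?_
  refine squeeze_zero (fun _ => dist_nonneg)
    (fun s => abs_integral_sub_integral_le_of_lipschitz (m s) (m t) hg) ?_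
  simpa using (h t).const_mul (K : ℝ)

/-- Curves of measures solving a linear continuity equation with a field of linear growth. -/
structure IsWeakSol {d : ℕ} (T : ℝ) (w : ℝ → Rd d → Rd d) (a : ℝ → ℝ) (m : ℝ → P1 d) : Prop where
  measurable : Measurable fun p : ℝ × Rd d => w p.1 p.2
  nonneg : ∀ t, 0 ≤ a t
  integrable : Integrable a
  growth : ∀ᵐ t, ∀ x, ‖w t x‖ ≤ a t * (1 + ‖x‖)
  cont : ∀ t, Tendsto (fun s => W1 (m s) (m t)) (𝓝 t) (𝓝 0)
  bdd : ∃ M, ∀ t, moment (m t) ≤ M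
  weak : ∀ φ : ℝ × Rd d → ℝ, IsTestFunction T φ →
    ∫ t, ∫ x, (deriv (fun s => φ (s, x)) t + fderiv ℝ (fun y => φ (t, y)) x (w t x))
      ∂(m t).toMeasure = 0

theorem measurable_fderiv_apply {d : ℕ} {g : Rd d → ℝ} (hg : ContDiff ℝ (⊤ : ℕ∞) g)
    {w : ℝ → Rd d → Rd d} (hw : Measurable fun p : ℝ × Rd d => w p.1 p.2) :
    StronglyMeasurable fun p : ℝ × Rd d => fderiv ℝ g p.2 (w p.1 p.2) := by
  have h1 : Continuous (fderiv ℝ g) := hg.continuous_fderiv (by simp)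
  have h2 : Continuous fun q : (Rd d →L[ℝ] ℝ) × Rd d => q.1 q.2 := by fun_prop
  exact (h2.measurable.comp
    ((h1.measurable.comp measurable_snd).prodMk hw)).stronglyMeasurable

/-- The rate of change of `∫ g`. -/
def rate {d : ℕ} (w : ℝ → Rd d → Rd d) (m : ℝ → P1 d) (g : Rd d → ℝ) (t : ℝ) : ℝ :=
  ∫ x, fderiv ℝ g x (w t x) ∂(m t).toMeasure

namespace IsWeakSol

variable {d : ℕ} {T : ℝ} {w : ℝ → Rd d → Rd d} {a : ℝ → ℝ} {m : ℝ → P1 d}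

theorem stronglyMeasurable_rate (h : IsWeakSol T w a m) {g : Rd d → ℝ}
    (hg : ContDiff ℝ (⊤ : ℕ∞) g) : StronglyMeasurable (rate w m g) :=
  stronglyMeasurable_integral_curve h.cont (measurable_fderiv_apply hg h.measurable)

theorem integrable_rate_inner (h : IsWeakSol T w a m) {g : Rd d → ℝ}
    (hg : ContDiff ℝ (⊤ : ℕ∞) g) {Λ : ℝ} (hΛ : ∀ x, ‖fderiv ℝ g x‖ ≤ Λ) {t : ℝ}
    (ht : ∀ x, ‖w t x‖ ≤ a t * (1 + ‖x‖)) :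
    Integrable (fun x => fderiv ℝ g x (w t x)) (m t).toMeasure := by
  have hΛ0 : 0 ≤ Λ := (norm_nonneg _).trans (hΛ 0)
  refine integrable_of_le_norm (m t) (a := Λ * a t) (b := Λ * a t) ?_ fun x => ?_
  · exact ((measurable_fderiv_apply hg h.measurable).comp_measurable
      (measurable_prodMk_left (x := t))).aestronglyMeasurable
  · refine ((fderiv ℝ g x).le_opNorm _).trans ?_
    calc _ ≤ Λ * (a t * (1 + ‖x‖)) := mul_le_mul (hΛ x) (ht x) (norm_nonneg _) hΛ0
      _ = _ := by ring

theorem integral_one_add_norm (μ : P1 d) : ∫ x, (1 + ‖x‖) ∂μ.toMeasure = 1 + moment μ := by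
  rw [integral_add (integrable_const _) (integrable_norm μ)]; simp [moment]

theorem norm_rate_le (h : IsWeakSol T w a m) {M : ℝ} (hM : ∀ t, moment (m t) ≤ M) {g : Rd d → ℝ}
    {Λ : ℝ} (hΛ : ∀ x, ‖fderiv ℝ g x‖ ≤ Λ) :
    ∀ᵐ t, ‖rate w m g t‖ ≤ Λ * (1 + M) * a t := by
  have hΛ0 : 0 ≤ Λ := (norm_nonneg _).trans (hΛ 0)
  filter_upwards [h.growth] with t ht
  have hi : Integrable (fun x : Rd d => 1 + ‖x‖) (m t).toMeasure :=
    (integrable_const _).add (integrable_norm _)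
  calc ‖rate w m g t‖ ≤ ∫ x, Λ * a t * (1 + ‖x‖) ∂(m t).toMeasure := by
        refine norm_integral_le_of_norm_le (hi.const_mul _) (ae_of_all _ fun x => ?_)
        refine ((fderiv ℝ g x).le_opNorm _).trans ?_
        rw [mul_assoc]
        exact mul_le_mul (hΛ x) (ht x) (norm_nonneg _) hΛ0
    _ = Λ * a t * (1 + moment (m t)) := by rw [integral_const_mul, integral_one_add_norm]
    _ ≤ Λ * a t * (1 + M) := by
        have := h.nonneg t
        gcongr
        exact hM t
    _ = _ := by ring

theorem integrable_rate (h : IsWeakSol T w a m) {g : Rd d → ℝ}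
    (hg : ContDiff ℝ (⊤ : ℕ∞) g) {Λ : ℝ} (hΛ : ∀ x, ‖fderiv ℝ g x‖ ≤ Λ) :
    Integrable (rate w m g) := by
  obtain ⟨M, hM⟩ := h.bdd
  exact (h.integrable.const_mul _).mono' (h.stronglyMeasurable_rate hg).aestronglyMeasurable
    (h.norm_rate_le hM hΛ)

theorem lipschitzWith_of_fderiv_le {g : Rd d → ℝ} (hg : ContDiff ℝ (⊤ : ℕ∞) g) {Λ : ℝ}
    (hΛ : ∀ x, ‖fderiv ℝ g x‖ ≤ Λ) : LipschitzWith Λ.toNNReal g := by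
  refine lipschitzWith_of_nnnorm_fderiv_le (𝕜 := ℝ) (hg.differentiable (by simp)) fun x => ?_
  rw [← NNReal.coe_le_coe, coe_nnnorm]
  exact (hΛ x).trans (Real.le_coe_toNNReal Λ)

/-- Testing with products `η t * g x` says that `∫ g` has distributional derivative `rate w m g` on
`(0, T)`. -/
theorem integral_deriv_mul_add (h : IsWeakSol T w a m) {g : Rd d → ℝ}
    (hg : ContDiff ℝ (⊤ : ℕ∞) g) (hgc : HasCompactSupport g) {η : ℝ → ℝ}
    (hη : ContDiff ℝ (⊤ : ℕ∞) η) (hηc : HasCompactSupport η) (hηs : tsupport η ⊆ Ioo 0 T) :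
    ∫ t, (deriv η t * ∫ x, g x ∂(m t).toMeasure + η t * rate w m g t) = 0 := by
  obtain ⟨Λ, hΛ⟩ := (hgc.fderiv ℝ).exists_bound_of_continuous (hg.continuous_fderiv (by simp))
  have hsupp : tsupport (fun p : ℝ × Rd d => η p.1 * g p.2) ⊆ tsupport η ×ˢ tsupport g := by
    refine closure_minimal (fun p hp => ?_) ((isClosed_tsupport _).prod (isClosed_tsupport _))
    have := mul_ne_zero_iff.1 hp
    exact ⟨subset_tsupport _ this.1, subset_tsupport _ this.2⟩
  have htest : IsTestFunction T fun p : ℝ × Rd d => η p.1 * g p.2 := by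
    refine ⟨(hη.comp contDiff_fst).mul (hg.comp contDiff_snd), ?_, ?_⟩
    · exact (hηc.prod hgc).of_isClosed_subset (isClosed_tsupport _) hsupp
    · exact hsupp.trans (prod_mono hηs (subset_univ _))
  rw [← h.weak _ htest]
  refine integral_congr_ae ?_
  filter_upwards [h.growth] with t ht
  have e1 : ∀ x, deriv (fun s => η s * g x) t = deriv η t * g x := fun x =>
    deriv_mul_const (hη.differentiable (by simp) t) _
  have e2 : ∀ x, fderiv ℝ (fun y => η t * g y) x (w t x) = η t * fderiv ℝ g x (w t x) := fun x => by
    rw [fderiv_const_mul (hg.differentiable (by simp) x)]; rfl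
  simp only [e1, e2]
  rw [integral_add, integral_const_mul, integral_const_mul, rate]
  · exact (integrable_of_lipschitz (m t) (lipschitzWith_of_fderiv_le hg hΛ)).const_mul _
  · exact (h.integrable_rate_inner hg hΛ ht).const_mul _

end IsWeakSol

open Real in
theorem integrable_deriv_smoothTransition : Integrable (deriv smoothTransition) := by
  refine Continuous.integrable_of_hasCompactSupport ?_ ?_
  · exact (smoothTransition.contDiff (n := 1)).continuous_deriv le_rfl
  · refine HasCompactSupport.intro (K := Icc 0 1) isCompact_Icc fun x hx => ?_
    rw [mem_Icc, not_and_or, not_le, not_le] at hx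
    rcases hx with hx | hx
    · have : smoothTransition =ᶠ[𝓝 x] fun _ => 0 := by
        filter_upwards [gt_mem_nhds hx] with y hy
        exact smoothTransition.zero_of_nonpos hy.le
      rw [this.deriv_eq]; simp
    · have : smoothTransition =ᶠ[𝓝 x] fun _ => 1 := by
        filter_upwards [lt_mem_nhds hx] with y hy
        exact smoothTransition.one_of_one_le hy.le
      rw [this.deriv_eq]; simp

open Real in
theorem integral_deriv_smoothTransition : ∫ u, deriv smoothTransition u = 1 := by
  have := integral_of_hasDerivAt_of_tendsto (f := smoothTransition) (m := 0) (n := 1)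
    (fun x => ((smoothTransition.contDiff (n := 1)).differentiable (by simp) x).hasDerivAt)
    integrable_deriv_smoothTransition
    (tendsto_const_nhds.congr' (by
      filter_upwards [eventually_le_atBot 0] with x hx
      exact (smoothTransition.zero_of_nonpos hx).symm))
    (tendsto_const_nhds.congr' (by
      filter_upwards [eventually_ge_atTop 1] with x hx
      exact (smoothTransition.one_of_one_le hx).symm))
  simpa using this

open Real in
/-- Smoothed Heaviside functions. -/
def step (ε s r : ℝ) : ℝ := smoothTransition (ε⁻¹ * (r - s))

open Real in
theorem contDiff_step (ε s : ℝ) : ContDiff ℝ (⊤ : ℕ∞) (step ε s) :=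
  smoothTransition.contDiff.comp (contDiff_const.mul (contDiff_id.sub contDiff_const))

open Real in
theorem deriv_step (ε s r : ℝ) :
    deriv (step ε s) r = ε⁻¹ * deriv smoothTransition (ε⁻¹ * (r - s)) := by
  have h1 : HasDerivAt (fun r : ℝ => ε⁻¹ * (r - s)) (ε⁻¹ * 1) r :=
    ((hasDerivAt_id r).sub_const s).const_mul _
  have h2 := ((smoothTransition.contDiff (n := 1)).differentiable (by simp)
    (ε⁻¹ * (r - s))).hasDerivAt.comp r h1
  rw [mul_one] at h2
  rw [mul_comm]
  exact h2.deriv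

-- The derivative of `step ε s` is an approximate identity of unit mass to the right of `s`. The
-- substitution `r = s + ε * u` moves the dependence on `ε` into the continuous bounded factor,
-- where dominated convergence applies.
open Real in
theorem tendsto_integral_deriv_step {y : ℝ → ℝ} (hy : Continuous y) {B : ℝ} (hB : ∀ r, ‖y r‖ ≤ B)
    (s : ℝ) : Tendsto (fun ε => ∫ r, deriv (step ε s) r * y r) (𝓝[>] 0) (𝓝 (y s)) := by
  have h1 : Tendsto (fun ε => ∫ u, deriv smoothTransition u * y (s + ε * u)) (𝓝[>] 0)
      (𝓝 (∫ u, deriv smoothTransition u * y s)) := by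
    refine tendsto_integral_filter_of_dominated_convergence
      (fun u => ‖deriv smoothTransition u‖ * B) (Eventually.of_forall fun ε => ?_)
      (Eventually.of_forall fun ε => ae_of_all _ fun u => ?_)
      (integrable_deriv_smoothTransition.norm.mul_const B) (ae_of_all _ fun u => ?_)
    · exact integrable_deriv_smoothTransition.aestronglyMeasurable.mul
        (by fun_prop : Continuous fun u => y (s + ε * u)).aestronglyMeasurable
    · rw [norm_mul]
      exact mul_le_mul_of_nonneg_left (hB _) (norm_nonneg _)
    · refine Tendsto.const_mul _ ?_
      have : Tendsto (fun ε : ℝ => y (s + ε * u)) (𝓝 0) (𝓝 (y (s + 0 * u))) :=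
        (by fun_prop : Continuous fun ε : ℝ => y (s + ε * u)).tendsto 0
      simpa using this.mono_left nhdsWithin_le_nhds
  rw [integral_mul_const, integral_deriv_smoothTransition, one_mul] at h1
  refine h1.congr' ?_
  filter_upwards [self_mem_nhdsWithin] with ε hε
  have hε' : (0 : ℝ) < ε := hε
  have e1 := integral_sub_right_eq_self
    (fun r => deriv smoothTransition (ε⁻¹ * r) * y (s + r)) s (μ := volume)
  have e2 := Measure.integral_comp_mul_left
    (fun u => deriv smoothTransition u * y (s + ε * u)) ε⁻¹
  rw [inv_inv, abs_of_pos hε', smul_eq_mul] at e2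
  have e3 : ∀ r, ε * (ε⁻¹ * r) = r := fun r => by field_simp
  simp only [e3] at e2
  rw [e2] at e1
  have e4 : ∀ r, deriv (step ε s) r * y r =
      ε⁻¹ * (deriv smoothTransition (ε⁻¹ * (r - s)) * y (s + (r - s))) := fun r => by
    rw [deriv_step, show s + (r - s) = r by ring]; ring
  simp only [e4]
  rw [integral_const_mul, e1, ← mul_assoc, inv_mul_cancel₀ hε'.ne', one_mul]

open Real in
theorem tendsto_step (s r : ℝ) :
    Tendsto (fun ε => step ε s r) (𝓝[>] 0) (𝓝 ((Ioi s).indicator 1 r)) := by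
  refine tendsto_const_nhds.congr' ?_
  rcases le_or_gt r s with h | h
  · filter_upwards [self_mem_nhdsWithin] with ε hε
    have hε' : (0 : ℝ) < ε := hε
    rw [indicator_of_notMem (by simpa using h)]
    exact (smoothTransition.zero_of_nonpos (mul_nonpos_of_nonneg_of_nonpos (by positivity)
      (by linarith))).symm
  · have : Ioo (0 : ℝ) (r - s) ∈ 𝓝[>] (0 : ℝ) := Ioo_mem_nhdsGT (by linarith)
    filter_upwards [this] with ε hε
    rw [indicator_of_mem (by simpa using h)]
    refine (smoothTransition.one_of_one_le ?_).symm
    rw [← div_eq_inv_mul, le_div_iff₀ hε.1]; linarith [hε.2]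

theorem norm_step_le (ε s r : ℝ) : ‖step ε s r‖ ≤ 1 := by
  rw [step, Real.norm_of_nonneg (Real.smoothTransition.nonneg _)]
  exact Real.smoothTransition.le_one _

namespace IsWeakSol

variable {d : ℕ} {T : ℝ} {w : ℝ → Rd d → Rd d} {a : ℝ → ℝ} {m : ℝ → P1 d}

/-- The time test function is `step ε s - step ε t`, a smoothed indicator of `(s, t]`. As `ε → 0`
its derivative isolates the values of `∫ g` at `s` and `t`. -/
theorem integral_sub_of_Ioo (h : IsWeakSol T w a m) {g : Rd d → ℝ}
    (hg : ContDiff ℝ (⊤ : ℕ∞) g) (hgc : HasCompactSupport g) {s t : ℝ} (hs : 0 < s) (hst : s ≤ t)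
    (ht : t < T) :
    ∫ x, g x ∂(m t).toMeasure - ∫ x, g x ∂(m s).toMeasure = ∫ r in s..t, rate w m g r := by
  obtain ⟨Λ, hΛ⟩ := (hgc.fderiv ℝ).exists_bound_of_continuous (hg.continuous_fderiv (by simp))
  obtain ⟨B, hB⟩ := hgc.exists_bound_of_continuous hg.continuous
  set y : ℝ → ℝ := fun t => ∫ x, g x ∂(m t).toMeasure with hy
  have hyc : Continuous y := continuous_integral_curve h.cont (lipschitzWith_of_fderiv_le hg hΛ)
  have hyB : ∀ r, ‖y r‖ ≤ B := fun r => by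
    simpa using norm_integral_le_of_norm_le_const (μ := (m r).toMeasure) (ae_of_all _ hB)
  have hb := h.integrable_rate hg hΛ
  have key : ∀ᶠ ε in 𝓝[>] (0 : ℝ), (∫ r, deriv (step ε s) r * y r) - (∫ r, deriv (step ε t) r * y r)
      + ∫ r, (step ε s r - step ε t r) * rate w m g r = 0 := by
    -- The smoothed indicator is supported in `[s, t + ε]`, which must stay inside `(0, T)`.
    have hmem : Ioo (0 : ℝ) (T - t) ∈ 𝓝[>] (0 : ℝ) := Ioo_mem_nhdsGT (by linarith)
    filter_upwards [hmem] with ε hε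
    have hε0 : 0 < ε⁻¹ := inv_pos.2 hε.1
    have hsm : ContDiff ℝ (⊤ : ℕ∞) fun r => step ε s r - step ε t r :=
      (contDiff_step ε s).sub (contDiff_step ε t)
    have hzero : ∀ r ∉ Icc s (t + ε), step ε s r - step ε t r = 0 := by
      intro r hr
      rw [mem_Icc, not_and_or, not_le, not_le] at hr
      unfold step
      rcases hr with hr | hr
      · rw [Real.smoothTransition.zero_of_nonpos, Real.smoothTransition.zero_of_nonpos, sub_zero]
        · exact mul_nonpos_of_nonneg_of_nonpos hε0.le (by linarith)
        · exact mul_nonpos_of_nonneg_of_nonpos hε0.le (by linarith)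
      · rw [Real.smoothTransition.one_of_one_le, Real.smoothTransition.one_of_one_le, sub_self]
        · rw [← div_eq_inv_mul, le_div_iff₀ hε.1]; linarith
        · rw [← div_eq_inv_mul, le_div_iff₀ hε.1]; linarith
    have hts : tsupport (fun r => step ε s r - step ε t r) ⊆ Icc s (t + ε) :=
      closure_minimal (fun r hr => by_contra fun h' => hr (hzero r h')) isClosed_Icc
    have hcs : HasCompactSupport fun r => step ε s r - step ε t r :=
      HasCompactSupport.intro isCompact_Icc hzero
    have := h.integral_deriv_mul_add hg hgc hsm hcs (hts.trans fun r hr =>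
      ⟨by linarith [hr.1], by linarith [hr.2, hε.2]⟩)
    have hstep : ∀ u, Integrable fun r => deriv (step ε u) r * y r := fun u => by
      have h1 : Integrable (deriv (step ε u)) := by
        have h2 := ((integrable_deriv_smoothTransition.comp_mul_left' hε0.ne').comp_sub_right
          u).const_mul ε⁻¹
        refine h2.congr (ae_of_all _ fun r => ?_)
        rw [deriv_step]
      exact h1.mul_bdd (c := B) hyc.aestronglyMeasurable (ae_of_all _ hyB)
    rw [← integral_sub (hstep s) (hstep t), ← integral_add
      (f := fun r => deriv (step ε s) r * y r - deriv (step ε t) r * y r)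
      ((hstep s).sub (hstep t)), ← this]
    · refine integral_congr_ae (ae_of_all _ fun r => ?_)
      have : deriv (fun r => step ε s r - step ε t r) r = deriv (step ε s) r - deriv (step ε t) r :=
        deriv_fun_sub ((contDiff_step ε s).differentiable (by simp) r)
          ((contDiff_step ε t).differentiable (by simp) r)
      simp only [this, hy]
      ring
    · refine hb.bdd_mul (c := 2) hsm.continuous.aestronglyMeasurable (ae_of_all _ fun r => ?_)
      refine (norm_sub_le _ _).trans ?_
      linarith [norm_step_le ε s r, norm_step_le ε t r]
  have l1 := tendsto_integral_deriv_step hyc hyB s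
  have l2 := tendsto_integral_deriv_step hyc hyB t
  have l3 : Tendsto (fun ε => ∫ r, (step ε s r - step ε t r) * rate w m g r) (𝓝[>] 0)
      (𝓝 (∫ r, ((Ioi s).indicator 1 r - (Ioi t).indicator 1 r) * rate w m g r)) := by
    refine tendsto_integral_filter_of_dominated_convergence (fun r => 2 * ‖rate w m g r‖)
      (Eventually.of_forall fun ε => ?_) (Eventually.of_forall fun ε => ae_of_all _ fun r => ?_)
      (hb.norm.const_mul 2) (ae_of_all _ fun r => ?_)
    · exact ((contDiff_step ε s).continuous.sub
        (contDiff_step ε t).continuous).aestronglyMeasurable.mul hb.aestronglyMeasurable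
    · rw [norm_mul]
      refine mul_le_mul_of_nonneg_right ((norm_sub_le _ _).trans ?_) (norm_nonneg _)
      linarith [norm_step_le ε s r, norm_step_le ε t r]
    · exact ((tendsto_step s r).sub (tendsto_step t r)).mul_const _
  have l4 := tendsto_nhds_unique ((l1.sub l2).add l3 |>.congr' key) tendsto_const_nhds
  have e : ∫ r in s..t, rate w m g r =
      ∫ r, ((Ioi s).indicator 1 r - (Ioi t).indicator 1 r) * rate w m g r := by
    rw [intervalIntegral.integral_of_le hst, ← integral_indicator measurableSet_Ioc]
    refine integral_congr_ae (ae_of_all _ fun r => ?_)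
    by_cases h1 : s < r <;> by_cases h2 : t < r
    · simp [indicator, h1, h2]
    · simp [indicator, h1, h2, not_lt.1 h2]
    · exact absurd (hst.trans_lt h2) h1
    · simp [indicator, h1, h2]
  rw [e]
  linarith

/-- The difference between `∫ g` and the primitive of its rate is constant on the open interval and
continuous on the line, hence constant up to the endpoints. This links the weak formulation to the
initial datum. -/
theorem integral_sub_of_hasCompactSupport (h : IsWeakSol T w a m) (hT : 0 < T) {g : Rd d → ℝ}
    (hg : ContDiff ℝ (⊤ : ℕ∞) g) (hgc : HasCompactSupport g) {s t : ℝ} (hs : s ∈ Icc 0 T)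
    (ht : t ∈ Icc 0 T) :
    ∫ x, g x ∂(m t).toMeasure - ∫ x, g x ∂(m s).toMeasure = ∫ r in s..t, rate w m g r := by
  obtain ⟨Λ, hΛ⟩ := (hgc.fderiv ℝ).exists_bound_of_continuous (hg.continuous_fderiv (by simp))
  have hb := h.integrable_rate hg hΛ
  have hyc : Continuous fun t => ∫ x, g x ∂(m t).toMeasure :=
    continuous_integral_curve h.cont (lipschitzWith_of_fderiv_le hg hΛ)
  set F : ℝ → ℝ := fun t => ∫ x, g x ∂(m t).toMeasure - ∫ r in (0 : ℝ)..t, rate w m g r with hF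
  have hFc : Continuous F := hyc.sub (hb.continuous_primitive 0)
  have hii : ∀ u v, IntervalIntegrable (rate w m g) volume u v := fun u v => hb.intervalIntegrable
  have hconst : EqOn F (fun _ => F (T / 2)) (Ioo 0 T) := by
    have aux : ∀ s t, 0 < s → s ≤ t → t < T → F t = F s := fun s t h1 h2 h3 => by
      have e := h.integral_sub_of_Ioo hg hgc h1 h2 h3
      rw [← intervalIntegral.integral_interval_sub_left (hii 0 t) (hii 0 s)] at e
      simp only [hF]; linarith
    intro r hr
    rcases le_total r (T / 2) with h1 | h1
    · exact (aux r (T / 2) hr.1 h1 (by linarith)).symm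
    · exact aux (T / 2) r (by linarith) h1 hr.2
  have hcl := hconst.closure hFc continuous_const
  rw [closure_Ioo hT.ne] at hcl
  have e := (hcl ht).trans (hcl hs).symm
  rw [← intervalIntegral.integral_interval_sub_left (hii 0 t) (hii 0 s)]
  simp only [hF] at e
  linarith

end IsWeakSol

end Vlasov

/-! ### Observables with bounded gradient, and uniformity in time along a curve. -/

namespace Vlasov

theorem exists_cutoff (d : ℕ) : ∃ f : Rd d → ℝ, ContDiff ℝ (⊤ : ℕ∞) f ∧ HasCompactSupport f ∧
    (∀ x, 0 ≤ f x) ∧ (∀ x, f x ≤ 1) ∧ (∀ x, ‖x‖ ≤ 1 → f x = 1) ∧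
    ∀ x, 2 < ‖x‖ → fderiv ℝ f x = 0 := by
  let f : ContDiffBump (0 : Rd d) := ⟨1, 2, one_pos, one_lt_two⟩
  refine ⟨f, f.contDiff, f.hasCompactSupport, fun x => f.nonneg, fun x => f.le_one,
    fun x hx => f.one_of_mem_closedBall (mem_closedBall_zero_iff.2 hx), fun x hx => ?_⟩
  refine image_eq_zero_of_notMem_tsupport fun hmem => hx.not_ge ?_
  have := tsupport_fderiv_subset ℝ hmem
  rwa [f.tsupport_eq, mem_closedBall_zero_iff] at this

/-- Smooth truncation of a function with bounded gradient. -/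
theorem exists_truncation {d : ℕ} {g : Rd d → ℝ} (hg : ContDiff ℝ (⊤ : ℕ∞) g) {Λ : ℝ}
    (hΛ : ∀ x, ‖fderiv ℝ g x‖ ≤ Λ) :
    ∃ (gs : ℕ → Rd d → ℝ) (Λ' : ℝ), (∀ k, ContDiff ℝ (⊤ : ℕ∞) (gs k)) ∧
      (∀ k, HasCompactSupport (gs k)) ∧ (∀ k x, ‖fderiv ℝ (gs k) x‖ ≤ Λ') ∧
      (∀ k x, ‖gs k x‖ ≤ ‖g x‖) ∧
      (∀ x, ∀ᶠ k in atTop, gs k x = g x ∧ fderiv ℝ (gs k) x = fderiv ℝ g x) := by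
  have hΛ0 : 0 ≤ Λ := (norm_nonneg _).trans (hΛ 0)
  obtain ⟨f, hf, hfc, hf0, hf1, hf2, hf3⟩ := exists_cutoff d
  obtain ⟨C, hC⟩ := (hfc.fderiv ℝ).exists_bound_of_continuous
    (hf.continuous_fderiv (by simp))
  have hC0 : 0 ≤ C := (norm_nonneg _).trans (hC 0)
  have hgx : ∀ x, ‖g x‖ ≤ ‖g 0‖ + Λ * ‖x‖ := fun x => by
    have := norm_le_add_of_lipschitz (IsWeakSol.lipschitzWith_of_fderiv_le hg hΛ) x
    rwa [Real.coe_toNNReal _ hΛ0] at this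
  have hd : ∀ (k : ℕ) x, HasFDerivAt (fun x : Rd d => f (((k : ℝ) + 1)⁻¹ • x))
      (((k : ℝ) + 1)⁻¹ • fderiv ℝ f (((k : ℝ) + 1)⁻¹ • x)) x := by
    intro k x
    have h1 : HasFDerivAt (fun x : Rd d => ((k : ℝ) + 1)⁻¹ • x)
        (((k : ℝ) + 1)⁻¹ • ContinuousLinearMap.id ℝ (Rd d)) x :=
      (((k : ℝ) + 1)⁻¹ • ContinuousLinearMap.id ℝ (Rd d)).hasFDerivAt
    have h2 := (hf.differentiable (by simp) (((k : ℝ) + 1)⁻¹ • x)).hasFDerivAt.comp x h1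
    exact h2.congr_fderiv (by ext v; simp)
  have hd2 : ∀ (k : ℕ) x, fderiv ℝ (fun x => f (((k : ℝ) + 1)⁻¹ • x) * g x) x =
      f (((k : ℝ) + 1)⁻¹ • x) • fderiv ℝ g x +
        g x • (((k : ℝ) + 1)⁻¹ • fderiv ℝ f (((k : ℝ) + 1)⁻¹ • x)) := fun k x => by
    rw [fderiv_fun_mul (hd k x).differentiableAt (hg.differentiable (by simp) x), (hd k x).fderiv]
  -- The cutoff at scale `k + 1` has gradient at most `C / (k + 1)`, vanishing beyond radius `2 * (k
  -- + 1)`, while `‖g x‖ ≤ ‖g 0‖ + Λ * ‖x‖`. The product of the two is bounded independently of `k`.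
  refine ⟨fun k x => f (((k : ℝ) + 1)⁻¹ • x) * g x, Λ + (‖g 0‖ + 2 * Λ) * C, fun k => ?_,
    fun k => ?_, fun k x => ?_, fun k x => ?_, fun x => ?_⟩
  · exact (hf.comp (contDiff_const_smul (𝕜 := ℝ) (((k : ℝ) + 1)⁻¹))).mul hg
  · refine HasCompactSupport.mul_right ?_
    exact hfc.comp_homeomorph
      (Homeomorph.smulOfNeZero (((k : ℝ) + 1)⁻¹) (by positivity))
  · rw [hd2]
    refine (norm_add_le _ _).trans (add_le_add ?_ ?_)
    · rw [norm_smul, Real.norm_of_nonneg (hf0 _)]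
      calc _ ≤ 1 * Λ := mul_le_mul (hf1 _) (hΛ x) (norm_nonneg _) zero_le_one
        _ = Λ := one_mul _
    · have hk : (1 : ℝ) ≤ k + 1 := by linarith [(k.cast_nonneg : (0 : ℝ) ≤ k)]
      by_cases hx : ‖x‖ ≤ 2 * (k + 1)
      · rw [norm_smul, norm_smul, Real.norm_of_nonneg (by positivity : (0 : ℝ) ≤ ((k : ℝ) + 1)⁻¹),
          ← mul_assoc]
        refine mul_le_mul ?_ (hC _) (norm_nonneg _) (by positivity)
        rw [← div_eq_mul_inv, div_le_iff₀ (by positivity)]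
        have h1 : ‖g 0‖ ≤ ‖g 0‖ * (k + 1) := le_mul_of_one_le_right (norm_nonneg _) hk
        have h2 : Λ * ‖x‖ ≤ Λ * (2 * (k + 1)) := mul_le_mul_of_nonneg_left hx hΛ0
        linarith [hgx x]
      · have hz : fderiv ℝ f (((k : ℝ) + 1)⁻¹ • x) = 0 := by
          refine hf3 _ ?_
          rw [norm_smul, norm_inv, Real.norm_of_nonneg (by positivity : (0 : ℝ) ≤ (k : ℝ) + 1),
            ← div_eq_inv_mul, lt_div_iff₀ (by positivity)]
          exact not_le.1 hx
        rw [hz, smul_zero, smul_zero, norm_zero]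
        positivity
  · rw [norm_mul, Real.norm_of_nonneg (hf0 _)]
    exact mul_le_of_le_one_left (norm_nonneg _) (hf1 _)
  · obtain ⟨N, hN⟩ := exists_nat_gt ‖x‖
    filter_upwards [eventually_ge_atTop N] with k hk
    have hk' : ‖x‖ < (k : ℝ) + 1 := by
      have : (N : ℝ) ≤ k := by exact_mod_cast hk
      linarith
    have hev : ∀ᶠ y in 𝓝 x, f (((k : ℝ) + 1)⁻¹ • y) * g y = g y := by
      have : ∀ᶠ y : Rd d in 𝓝 x, ‖y‖ < k + 1 :=
        (continuous_norm.tendsto x).eventually_lt_const hk'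
      filter_upwards [this] with y hy
      rw [hf2, one_mul]
      rw [norm_smul, norm_inv,
        Real.norm_of_nonneg (by positivity : (0 : ℝ) ≤ (k : ℝ) + 1), ← div_eq_inv_mul,
        div_le_iff₀ (by positivity)]
      linarith
    exact ⟨hev.self_of_nhds, Filter.EventuallyEq.fderiv_eq hev⟩

namespace IsWeakSol

variable {d : ℕ} {T : ℝ} {w : ℝ → Rd d → Rd d} {a : ℝ → ℝ} {m : ℝ → P1 d}

/-- Truncations of `g` have uniformly bounded gradients and eventually agree with `g` near each
point. The first moments and the linear growth of the field supply the dominating functions. All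
later estimates use the equation in this form. -/
theorem integral_sub_eq_integral_rate (h : IsWeakSol T w a m) (hT : 0 < T) {g : Rd d → ℝ}
    (hg : ContDiff ℝ (⊤ : ℕ∞) g) {Λ : ℝ} (hΛ : ∀ x, ‖fderiv ℝ g x‖ ≤ Λ) {s t : ℝ}
    (hs : s ∈ Icc 0 T) (ht : t ∈ Icc 0 T) :
    ∫ x, g x ∂(m t).toMeasure - ∫ x, g x ∂(m s).toMeasure = ∫ r in s..t, rate w m g r := by
  obtain ⟨gs, Λ', h1, h2, h3, h4, h5⟩ := exists_truncation hg hΛ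
  obtain ⟨M, hM⟩ := h.bdd
  have hΛ'0 : 0 ≤ Λ' := (norm_nonneg _).trans (h3 0 0)
  have l1 : ∀ t, Tendsto (fun k => ∫ x, gs k x ∂(m t).toMeasure) atTop
      (𝓝 (∫ x, g x ∂(m t).toMeasure)) := fun t => by
    refine tendsto_integral_filter_of_dominated_convergence (fun x => ‖g x‖)
      (Eventually.of_forall fun k => (h1 k).continuous.aestronglyMeasurable)
      (Eventually.of_forall fun k => ae_of_all _ fun x => h4 k x)
      (integrable_of_lipschitz (m t) (lipschitzWith_of_fderiv_le hg hΛ)).norm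
      (ae_of_all _ fun x => ?_)
    refine tendsto_const_nhds.congr' ?_
    filter_upwards [h5 x] with k hk using hk.1.symm
  have l2 : Tendsto (fun k => ∫ r in s..t, rate w m (gs k) r) atTop
      (𝓝 (∫ r in s..t, rate w m g r)) := by
    refine intervalIntegral.tendsto_integral_filter_of_dominated_convergence
      (fun r => Λ' * (1 + M) * a r)
      (Eventually.of_forall fun k => (h.stronglyMeasurable_rate (h1 k)).aestronglyMeasurable)
      (Eventually.of_forall fun k => ?_) (h.integrable.const_mul _).intervalIntegrable ?_
    · filter_upwards [h.norm_rate_le hM (h3 k)] with r hr _ using hr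
    · filter_upwards [h.growth] with r hr _
      refine tendsto_integral_filter_of_dominated_convergence
        (fun x => Λ' * (a r * (1 + ‖x‖)))
        (Eventually.of_forall fun k =>
          (h.integrable_rate_inner (h1 k) (h3 k) hr).aestronglyMeasurable)
        (Eventually.of_forall fun k => ae_of_all _ fun x => ?_) ?_ (ae_of_all _ fun x => ?_)
      · refine ((fderiv ℝ (gs k) x).le_opNorm _).trans ?_
        exact mul_le_mul (h3 k x) (hr x) (norm_nonneg _) hΛ'0
      · exact (((integrable_const _).add (integrable_norm _)).const_mul _).const_mul _
      · refine tendsto_const_nhds.congr' ?_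
        filter_upwards [h5 x] with k hk
        rw [hk.2]
  refine tendsto_nhds_unique (((l1 t).sub (l1 s)).congr fun k => ?_) l2
  exact h.integral_sub_of_hasCompactSupport hT (h1 k) (h2 k) hs ht

end IsWeakSol

/-- Uniform integrability along a `W1`-continuous curve. -/
theorem tendsto_sup_tail {d : ℕ} {m : ℝ → P1 d}
    (h : ∀ t, Tendsto (fun s => W1 (m s) (m t)) (𝓝 t) (𝓝 0)) (T : ℝ) {ε : ℝ} (hε : 0 < ε) :
    ∃ n : ℕ, ∀ t ∈ Icc 0 T, ∫ x, max (‖x‖ - n) 0 ∂(m t).toMeasure ≤ ε := by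
  have hlip : ∀ n : ℕ, LipschitzWith 1 fun x : Rd d => max (‖x‖ - n) 0 := fun n => by
    refine LipschitzWith.of_le_add fun x y => max_le ?_ (add_nonneg (le_max_right _ _) dist_nonneg)
    have h1 := le_max_left (‖y‖ - n) 0
    have h2 := norm_le_norm_add_norm_sub' x y
    rw [← dist_eq_norm] at h2
    linarith
  -- Dini's theorem: the tails decrease to zero at each time and depend continuously on time over a
  -- compact interval.
  have hD := Antitone.tendstoUniformly_of_forall_tendsto (α := Icc (0 : ℝ) T)
    (F := fun (n : ℕ) t => ∫ x, max (‖x‖ - n) 0 ∂(m t).toMeasure) (f := fun _ => 0)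
    (fun n => (continuous_integral_curve h (hlip n)).comp continuous_subtype_val)
    (fun n k hnk t => ?_) continuous_const (fun t => ?_)
  · rw [Metric.tendstoUniformly_iff] at hD
    obtain ⟨n, hn⟩ := (hD ε hε).exists
    refine ⟨n, fun t ht => ?_⟩
    have := hn ⟨t, ht⟩
    rw [dist_comm, Real.dist_eq, sub_zero] at this
    exact (le_abs_self _).trans this.le
  · refine integral_mono (integrable_of_lipschitz _ (hlip k)) (integrable_of_lipschitz _ (hlip n))
      fun x => ?_
    have : (n : ℝ) ≤ k := by exact_mod_cast hnk
    exact max_le_max (by linarith) le_rfl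
  · have h1 := (ENNReal.tendsto_toReal ENNReal.zero_ne_top).comp
      (tendsto_tail _ (integrable_norm (m t)))
    refine h1.congr fun n => ?_
    rw [integral_eq_lintegral_of_nonneg_ae (f := fun x : Rd d => max (‖x‖ - n) 0)
      (ae_of_all _ fun x => le_max_right _ _)
      (hlip n).continuous.aestronglyMeasurable]
    simp only [Function.comp]
    congr 1
    refine lintegral_congr fun x => ?_
    simp

/-- Uniform continuity of a `W1`-continuous curve on a compact interval. -/
theorem exists_modulus {d : ℕ} {m : ℝ → P1 d}
    (h : ∀ t, Tendsto (fun s => W1 (m s) (m t)) (𝓝 t) (𝓝 0)) (T : ℝ) {ε : ℝ} (hε : 0 < ε) :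
    ∃ δ > 0, ∀ s ∈ Icc 0 T, ∀ t ∈ Icc 0 T, |s - t| < δ → W1 (m s) (m t) ≤ ε := by
  by_contra! hcon
  choose s hs t ht hst hW using fun n : ℕ => hcon (1 / ((n : ℝ) + 1)) Nat.one_div_pos_of_nat
  obtain ⟨r, -, φ, hφ, hlim⟩ := isCompact_Icc.tendsto_subseq hs
  have h0 : Tendsto (fun n => s (φ n) - t (φ n)) atTop (𝓝 0) := by
    refine squeeze_zero_norm (fun n => (hst (φ n)).le) ?_
    exact (tendsto_one_div_add_atTop_nhds_zero_nat (𝕜 := ℝ)).comp hφ.tendsto_atTop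
  have hlim2 : Tendsto (fun n => t (φ n)) atTop (𝓝 r) := by
    have := hlim.sub h0
    simpa using this
  have h1 := ((h r).comp hlim).add ((h r).comp hlim2)
  rw [add_zero] at h1
  obtain ⟨n, hn⟩ := (h1.eventually_lt_const hε).exists
  have h2 := W1_triangle (m (s (φ n))) (m r) (m (t (φ n)))
  rw [W1_comm (m r)] at h2
  simp only [Function.comp] at hn
  linarith [hW (φ n)]

end Vlasov

/-! ### Mollification, frozen displacements and Taylor remainders. -/

namespace Vlasov

open ContinuousLinearMap in
/-- Mollification of Lipschitz functions at scale `ε`. -/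
theorem exists_mollifier (d : ℕ) {ε : ℝ} (hε : 0 < ε) :
    ∃ (C : ℝ) (S : (Rd d → ℝ) → Rd d → ℝ), 0 ≤ C ∧ ∀ (u : Rd d → ℝ) (Λ : NNReal),
      LipschitzWith Λ u → ContDiff ℝ (⊤ : ℕ∞) (S u) ∧ LipschitzWith Λ (S u) ∧
      (∀ x, |S u x - u x| ≤ Λ * ε) ∧
      (∀ x y, ‖fderiv ℝ (S u) x - fderiv ℝ (S u) y‖ ≤ C * Λ * ‖x - y‖) ∧
      ∀ (W : Rd d → Rd d) (K : ℝ), 0 ≤ K → (∀ x y, ‖W x - W y‖ ≤ K * ‖x - y‖) →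
        ∀ x, |S u (x + W x) - S (fun y => u (y + W y)) x| ≤ Λ * (K * ε) := by
  let f : ContDiffBump (0 : Rd d) := ⟨ε / 2, ε, half_pos hε, half_lt_self hε⟩
  obtain ⟨ρ, hρ⟩ : ∃ ρ : Rd d → ℝ, ρ = f.normed volume := ⟨_, rfl⟩
  have hρs : ContDiff ℝ (⊤ : ℕ∞) ρ := hρ ▸ f.contDiff_normed
  have hρc : HasCompactSupport ρ := hρ ▸ f.hasCompactSupport_normed
  have hρ0 : ∀ x, 0 ≤ ρ x := fun x => hρ ▸ f.nonneg_normed x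
  have hρ1 : ∫ x, ρ x = 1 := hρ ▸ f.integral_normed
  have hρz : ∀ x, ε ≤ ‖x‖ → ρ x = 0 := fun x hx => by
    by_contra h
    have : x ∈ Function.support (f.normed volume) := hρ ▸ h
    rw [f.support_normed_eq, mem_ball_zero_iff] at this
    exact this.not_ge hx
  clear hρ f
  have hρi : Integrable ρ := hρs.continuous.integrable_of_hasCompactSupport hρc
  have hint : ∀ u : Rd d → ℝ, Continuous u → ∀ x, Integrable fun y => ρ y * u (x - y) :=
    fun u hu x => (hρs.continuous.mul (by fun_prop)).integrable_of_hasCompactSupport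
      hρc.mul_right
  -- All comparisons below reduce to this one: two averages against the same kernel of mass one
  -- differ by no more than their integrands do at shifts shorter than `ε`.
  have hcmp : ∀ u₁ u₂ : Rd d → ℝ, Continuous u₁ → Continuous u₂ → ∀ x₁ x₂ B,
      (∀ y, ‖y‖ < ε → |u₁ (x₁ - y) - u₂ (x₂ - y)| ≤ B) →
      |(∫ y, ρ y * u₁ (x₁ - y)) - ∫ y, ρ y * u₂ (x₂ - y)| ≤ B := by
    intro u₁ u₂ h₁ h₂ x₁ x₂ B hB
    rw [← integral_sub (hint u₁ h₁ x₁) (hint u₂ h₂ x₂)]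
    rw [← Real.norm_eq_abs]
    calc _ ≤ ∫ y, ρ y * B := by
          refine norm_integral_le_of_norm_le (hρi.mul_const B) (ae_of_all _ fun y => ?_)
          rw [← mul_sub, norm_mul, Real.norm_of_nonneg (hρ0 y)]
          rcases lt_or_ge ‖y‖ ε with h | h
          · exact mul_le_mul_of_nonneg_left (hB y h) (hρ0 y)
          · simp [hρz y h]
      _ = B := by rw [integral_mul_const, hρ1, one_mul]
  have hDc : HasCompactSupport (fderiv ℝ ρ) := hρc.fderiv ℝ
  have hDcont : Continuous (fderiv ℝ ρ) := hρs.continuous_fderiv (by simp)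
  have hDi : Integrable fun y => ‖fderiv ℝ ρ y‖ :=
    (hDcont.integrable_of_hasCompactSupport hDc).norm
  set L : ℝ →L[ℝ] ℝ →L[ℝ] ℝ := ContinuousLinearMap.mul ℝ ℝ with hL
  have hL' : ∀ (A : Rd d →L[ℝ] ℝ) (b : ℝ), precompL (Rd d) L A b = b • A := fun A b => by
    ext v; simp [hL, mul_comm]
  -- Differentiating the kernel rather than `u` bounds the Lipschitz constant of the gradient. The
  -- resulting `C` depends on the scale `ε` alone, not on `u`.
  refine ⟨∫ y, ‖fderiv ℝ ρ y‖, fun u x => ∫ y, ρ y * u (x - y),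
    integral_nonneg fun y => norm_nonneg _, fun u Λ hu => ?_⟩
  have hconv : (fun x => ∫ y, ρ y * u (x - y)) = convolution ρ u L volume := by
    ext x; simp [convolution, hL]
  have hul : LocallyIntegrable u := hu.continuous.locallyIntegrable
  have hdu := fun x => (HasCompactSupport.hasFDerivAt_convolution_left (μ := volume) L hρc
    (hρs.of_le (by simp)) hul x).fderiv
  rw [← hconv] at hdu
  refine ⟨?_, ?_, fun x => ?_, fun x z => ?_, fun W K hK hW x => ?_⟩
  · dsimp only
    rw [hconv]
    exact hρc.contDiff_convolution_left L hρs hul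
  · refine LipschitzWith.of_dist_le_mul fun x z => ?_
    rw [Real.dist_eq]
    refine hcmp u u hu.continuous hu.continuous x z _ fun y _ => ?_
    rw [← Real.dist_eq]
    refine (hu.dist_le_mul _ _).trans (le_of_eq ?_)
    rw [dist_sub_right]
  · have := hcmp u (fun _ => u x) hu.continuous continuous_const x x (Λ * ε) fun y hy => by
      rw [← Real.dist_eq]
      refine (hu.dist_le_mul _ _).trans ?_
      gcongr
      rw [dist_eq_norm]; simpa using hy.le
    rwa [integral_mul_const, hρ1, one_mul] at this
  · rw [hdu, hdu]
    have hi : ∀ x, Integrable fun y => u (x - y) • fderiv ℝ ρ y := fun x => by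
      have h1 : HasCompactSupport fun y => u (x - y) • fderiv ℝ ρ y :=
        hDc.mono fun y hy h0 => hy (by simp only [h0, smul_zero])
      have h2 : Continuous fun y => u (x - y) :=
        hu.continuous.comp (continuous_const.sub continuous_id)
      exact (h2.smul hDcont).integrable_of_hasCompactSupport h1
    simp only [convolution, hL']
    rw [← integral_sub (hi x) (hi z), mul_assoc, ← integral_mul_const]
    refine norm_integral_le_of_norm_le (hDi.mul_const _) (ae_of_all _ fun y => ?_)
    rw [← sub_smul, norm_smul, mul_comm]
    refine mul_le_mul_of_nonneg_left ?_ (norm_nonneg _)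
    rw [← dist_eq_norm, ← dist_eq_norm]
    refine (hu.dist_le_mul _ _).trans (le_of_eq ?_)
    rw [dist_sub_right]
  -- Commutator of mollification and displacement: the two averages evaluate `u` at points differing
  -- by `W x - W (x - y)`, of size at most `K * ε`. With `K` proportional to the time step, this
  -- error can be summed over all steps.
  · have hWc : Continuous W := (LipschitzWith.of_dist_le_mul (K := ⟨K, hK⟩) fun x y => by
      rw [dist_eq_norm, dist_eq_norm]; exact hW x y).continuous
    refine hcmp u (fun y => u (y + W y)) hu.continuous
      (hu.continuous.comp (continuous_id.add hWc)) (x + W x) x _ fun y hy => ?_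
    rw [← Real.dist_eq]
    refine (hu.dist_le_mul _ _).trans ?_
    gcongr
    rw [dist_eq_norm, show x + W x - y - (x - y + W (x - y)) = W x - W (x - y) by abel]
    refine (hW _ _).trans ?_
    gcongr
    simpa using hy.le

/-- The displacement produced by freezing the position. -/
def drift {d : ℕ} (w : ℝ → Rd d → Rd d) (s t : ℝ) (x : Rd d) : Rd d := ∫ r in s..t, w r x

namespace IsWeakSol

variable {d : ℕ} {T : ℝ} {w : ℝ → Rd d → Rd d} {a : ℝ → ℝ} {m : ℝ → P1 d}

theorem integrable_apply (h : IsWeakSol T w a m) (x : Rd d) : Integrable fun r => w r x := by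
  refine (h.integrable.mul_const (1 + ‖x‖)).mono'
    (h.measurable.comp measurable_prodMk_right).aestronglyMeasurable ?_
  filter_upwards [h.growth] with r hr using hr x

theorem norm_drift_le (h : IsWeakSol T w a m) {s t : ℝ} (hst : s ≤ t) (x : Rd d) :
    ‖drift w s t x‖ ≤ (∫ r in s..t, a r) * (1 + ‖x‖) := by
  rw [← intervalIntegral.integral_mul_const]
  refine intervalIntegral.norm_integral_le_of_norm_le hst ?_
    (h.integrable.mul_const _).intervalIntegrable
  filter_upwards [h.growth] with r hr _ using hr x

theorem norm_drift_sub_le (h : IsWeakSol T w a m) {L : ℝ}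
    (hL : ∀ t x y, ‖w t x - w t y‖ ≤ L * ‖x - y‖) {s t : ℝ} (hst : s ≤ t) (x y : Rd d) :
    ‖drift w s t x - drift w s t y‖ ≤ (t - s) * L * ‖x - y‖ := by
  unfold drift
  rw [← intervalIntegral.integral_sub (h.integrable_apply x).intervalIntegrable
    (h.integrable_apply y).intervalIntegrable]
  refine (intervalIntegral.norm_integral_le_of_norm_le_const fun r _ => hL r x y).trans
    (le_of_eq ?_)
  rw [abs_of_nonneg (by linarith)]; ring

end IsWeakSol

/-- The mean value inequality is applied on the segment to `g` minus its linear part at `x`. The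
displacement may grow linearly and only first moments are available, so the quadratic bound serves
on a large ball and the linear one on the tail. -/
theorem taylor_bound {d : ℕ} {g : Rd d → ℝ} (hg : ContDiff ℝ (⊤ : ℕ∞) g) {Λ K : ℝ}
    (hΛ : ∀ x, ‖fderiv ℝ g x‖ ≤ Λ) (hK : ∀ x y, ‖fderiv ℝ g x - fderiv ℝ g y‖ ≤ K * ‖x - y‖)
    (hK0 : 0 ≤ K) (x z : Rd d) :
    |g (x + z) - g x - fderiv ℝ g x z| ≤ min (2 * Λ) (K * ‖z‖) * ‖z‖ := by
  have hd : ∀ y, HasFDerivAt (fun y => g y - fderiv ℝ g x y) (fderiv ℝ g y - fderiv ℝ g x) y :=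
    fun y => ((hg.differentiable (by simp) y).hasFDerivAt).sub (fderiv ℝ g x).hasFDerivAt
  have := (convex_segment x (x + z)).norm_image_sub_le_of_norm_hasFDerivWithin_le
    (f := fun y => g y - fderiv ℝ g x y) (C := min (2 * Λ) (K * ‖z‖))
    (fun y _ => (hd y).hasFDerivWithinAt) (fun y hy => ?_) (left_mem_segment ℝ x (x + z))
    (right_mem_segment ℝ x (x + z))
  · rw [add_sub_cancel_left, Real.norm_eq_abs] at this
    convert this using 2
    rw [map_add]; ring
  · refine le_min ((norm_sub_le _ _).trans ?_) ((hK y x).trans ?_)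
    · linarith [hΛ x, hΛ y]
    · gcongr
      rw [segment_eq_image'] at hy
      obtain ⟨θ, hθ, rfl⟩ := hy
      simp only [add_sub_cancel_left]
      rw [norm_smul, Real.norm_of_nonneg hθ.1]
      exact mul_le_of_le_one_left (norm_nonneg _) hθ.2

end Vlasov

/-! ### Weak solutions follow Euler steps. -/

namespace Vlasov

namespace IsWeakSol

variable {d : ℕ} {T : ℝ} {w : ℝ → Rd d → Rd d} {a : ℝ → ℝ} {m : ℝ → P1 d}

theorem integrable_prod_fderiv (h : IsWeakSol T w a m) {g : Rd d → ℝ}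
    (hg : ContDiff ℝ (⊤ : ℕ∞) g) {Λ : ℝ} (hΛ : ∀ x, ‖fderiv ℝ g x‖ ≤ Λ) (μ : P1 d) :
    Integrable (fun p : ℝ × Rd d => fderiv ℝ g p.2 (w p.1 p.2)) (volume.prod μ.toMeasure) := by
  have hΛ0 : 0 ≤ Λ := (norm_nonneg _).trans (hΛ 0)
  have h1 : Integrable (fun x : Rd d => 1 + ‖x‖) μ.toMeasure :=
    (integrable_const _).add (integrable_norm _)
  refine ((h.integrable.mul_prod h1).const_mul Λ).mono'
    (measurable_fderiv_apply hg h.measurable).aestronglyMeasurable ?_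
  filter_upwards [Measure.quasiMeasurePreserving_fst.ae h.growth] with p hp
  refine ((fderiv ℝ g p.2).le_opNorm _).trans ?_
  exact mul_le_mul (hΛ _) (hp _) (norm_nonneg _) hΛ0

/-- By Fubini, the first-order effect of the frozen displacement is the time integral of the rate
computed with the law frozen at the initial time. The field needs only to be integrable in time for
this. -/
theorem integral_fderiv_drift (h : IsWeakSol T w a m) {g : Rd d → ℝ}
    (hg : ContDiff ℝ (⊤ : ℕ∞) g) {Λ : ℝ} (hΛ : ∀ x, ‖fderiv ℝ g x‖ ≤ Λ) (μ : P1 d) {s t : ℝ}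
    (hst : s ≤ t) :
    ∫ x, fderiv ℝ g x (drift w s t x) ∂μ.toMeasure =
      ∫ r in s..t, ∫ x, fderiv ℝ g x (w r x) ∂μ.toMeasure := by
  have e : ∀ x, fderiv ℝ g x (drift w s t x) = ∫ r in s..t, fderiv ℝ g x (w r x) := fun x =>
    ((fderiv ℝ g x).intervalIntegral_comp_comm (h.integrable_apply x).intervalIntegrable).symm
  simp only [e, intervalIntegral.integral_of_le hst]
  rw [integral_integral_swap]
  have := (h.integrable_prod_fderiv hg hΛ μ).mono_measure
    (Measure.prod_mono (Measure.restrict_le_self (s := Ioc s t)) (le_refl μ.toMeasure))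
  exact this.swap

theorem stronglyMeasurable_drift (h : IsWeakSol T w a m) {s t : ℝ} (hst : s ≤ t) :
    StronglyMeasurable (drift w s t) := by
  unfold drift
  simp only [intervalIntegral.integral_of_le hst]
  exact StronglyMeasurable.integral_prod_right (f := fun x r => w r x)
    (h.measurable.comp measurable_swap).stronglyMeasurable

/-- Comparison of the evolution over a short time with a frozen displacement. -/
theorem one_step (h : IsWeakSol T w a m) (hT : 0 < T) {L : ℝ} (hL0 : 0 ≤ L)
    (hL : ∀ t x y, ‖w t x - w t y‖ ≤ L * ‖x - y‖) {g : Rd d → ℝ}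
    (hg : ContDiff ℝ (⊤ : ℕ∞) g) {Λ K : ℝ} (hΛ : ∀ x, ‖fderiv ℝ g x‖ ≤ Λ) (hK0 : 0 ≤ K)
    (hK : ∀ x y, ‖fderiv ℝ g x - fderiv ℝ g y‖ ≤ K * ‖x - y‖)
    {n : ℕ} {κ : ℝ} (hκ : ∀ r ∈ Icc 0 T, ∫ x, max (‖x‖ - n) 0 ∂(m r).toMeasure ≤ κ)
    {s t ω : ℝ} (hs : 0 ≤ s) (hst : s ≤ t) (ht : t ≤ T)
    (hω : ∀ r ∈ Icc s t, W1 (m s) (m r) ≤ ω) :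
    |∫ x, g x ∂(m t).toMeasure - ∫ x, g (x + drift w s t x) ∂(m s).toMeasure| ≤
      (t - s) * (Λ * L * ω) + (∫ r in s..t, a r) *
        ((1 + n) * K * ω + 6 * Λ * κ + K * (∫ r in s..t, a r) * (2 * n + 2) ^ 2) := by
  have hΛ0 : 0 ≤ Λ := (norm_nonneg _).trans (hΛ 0)
  set α := ∫ r in s..t, a r with hα
  have hα0 : 0 ≤ α := intervalIntegral.integral_nonneg hst fun r _ => h.nonneg r
  have hsI : s ∈ Icc 0 T := ⟨hs, hst.trans ht⟩
  have htI : t ∈ Icc 0 T := ⟨hs.trans hst, ht⟩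
  have hω0 : 0 ≤ ω := (W1_nonneg _ _).trans (hω s ⟨le_rfl, hst⟩)
  have hκ' := hκ s hsI
  have htail : Integrable (fun x : Rd d => max (‖x‖ - n) 0) (m s).toMeasure :=
    ((integrable_norm _).sub (integrable_const _)).sup (integrable_const _)
  have hn : (0 : ℝ) ≤ n := n.cast_nonneg
  have hgl := lipschitzWith_of_fderiv_le hg hΛ
  have hWm := h.stronglyMeasurable_drift hst
  -- the frozen rate
  set b : ℝ → ℝ := fun r => ∫ x, fderiv ℝ g x (w r x) ∂(m s).toMeasure with hb
  have hbi : Integrable b := (h.integrable_prod_fderiv hg hΛ (m s)).integral_prod_left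
  have hA := h.integral_sub_eq_integral_rate hT hg hΛ hsI htI
  have hB := h.integral_fderiv_drift hg hΛ (m s) hst
  -- the rates are close
  have hC : ∀ᵐ r, r ∈ Icc s t → |rate w m g r - b r| ≤
      Λ * L * ω + a r * ((1 + n) * K * ω + 2 * Λ * κ) := by
    filter_upwards [h.growth] with r hr hrI
    have ha := h.nonneg r
    -- The integrand is not globally Lipschitz, since the field grows. Splitting `1 + ‖x‖ ≤ (1 + n)
    -- + max (‖x‖ - n) 0`, the bounded part uses the Lipschitz gradient and contributes a multiple
    -- of `dist x y`. The tail part uses only `2 * Λ` and becomes the weight at `x`.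
    have key : ∀ x y, |fderiv ℝ g x (w r x) - fderiv ℝ g y (w r y)| ≤
        (Λ * L + a r * ((1 + n) * K)) * dist x y + a r * (2 * Λ) * max (‖x‖ - n) 0 := by
      intro x y
      have e : fderiv ℝ g x (w r x) - fderiv ℝ g y (w r y) =
          (fderiv ℝ g x - fderiv ℝ g y) (w r x) + fderiv ℝ g y (w r x - w r y) := by
        simp
      rw [e, dist_eq_norm]
      have h1 : |fderiv ℝ g y (w r x - w r y)| ≤ Λ * (L * ‖x - y‖) :=
        ((fderiv ℝ g y).le_opNorm _).trans (mul_le_mul (hΛ _) (hL _ _ _) (norm_nonneg _) hΛ0)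
      have h2 : |(fderiv ℝ g x - fderiv ℝ g y) (w r x)| ≤
          ‖fderiv ℝ g x - fderiv ℝ g y‖ * (a r * (1 + ‖x‖)) :=
        ((fderiv ℝ g x - fderiv ℝ g y).le_opNorm _).trans
          (mul_le_mul_of_nonneg_left (hr x) (norm_nonneg _))
      have h3 : ‖fderiv ℝ g x - fderiv ℝ g y‖ ≤ 2 * Λ :=
        (norm_sub_le _ _).trans (by linarith [hΛ x, hΛ y])
      have h4 : 1 + ‖x‖ ≤ (1 + n) + max (‖x‖ - n) 0 := by linarith [le_max_left (‖x‖ - n) 0]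
      have h5 : ‖fderiv ℝ g x - fderiv ℝ g y‖ * (a r * (1 + ‖x‖)) ≤
          a r * ((1 + n) * (K * ‖x - y‖) + max (‖x‖ - n) 0 * (2 * Λ)) := by
        calc _ ≤ ‖fderiv ℝ g x - fderiv ℝ g y‖ * (a r * ((1 + n) + max (‖x‖ - n) 0)) := by gcongr
          _ = a r * ((1 + n) * ‖fderiv ℝ g x - fderiv ℝ g y‖ +
              max (‖x‖ - n) 0 * ‖fderiv ℝ g x - fderiv ℝ g y‖) := by ring
          _ ≤ _ := by
              have := le_max_right (‖x‖ - n) 0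
              have := hK x y
              gcongr
      refine (abs_add_le _ _).trans ?_
      linarith
    have hrT : r ∈ Icc 0 T := ⟨hs.trans hrI.1, hrI.2.trans ht⟩
    have hi : ∀ μ : P1 d, Integrable (fun x => fderiv ℝ g x (w r x)) μ.toMeasure := fun μ => by
      refine integrable_of_le_norm μ (a := Λ * a r) (b := Λ * a r) ?_ fun x => ?_
      · exact ((measurable_fderiv_apply hg h.measurable).comp_measurable
          (measurable_prodMk_left (x := r))).aestronglyMeasurable
      · refine ((fderiv ℝ g x).le_opNorm _).trans ?_
        calc _ ≤ Λ * (a r * (1 + ‖x‖)) := mul_le_mul (hΛ x) (hr x) (norm_nonneg _) hΛ0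
          _ = _ := by ring
    have := abs_integral_sub_integral_le (m s) (m r) (by positivity) (hi _) (hi _)
      (htail.const_mul _) key
    rw [abs_sub_comm]
    refine this.trans ?_
    rw [integral_const_mul]
    have h6 := hω r hrI
    calc _ ≤ (Λ * L + a r * ((1 + n) * K)) * ω + a r * (2 * Λ) * κ := by gcongr
      _ = _ := by ring
  -- the Taylor remainder
  have hR : |∫ x, (g (x + drift w s t x) - g x - fderiv ℝ g x (drift w s t x)) ∂(m s).toMeasure| ≤
      α * (K * α * (2 * n + 2) ^ 2 + 4 * Λ * κ) := by
    have hbound : ∀ x, |g (x + drift w s t x) - g x - fderiv ℝ g x (drift w s t x)| ≤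
        α * (K * α * (2 * n + 2) ^ 2 + 4 * Λ * max (‖x‖ - n) 0) := by
      intro x
      refine (taylor_bound hg hΛ hK hK0 x _).trans ?_
      have hW := h.norm_drift_le hst x
      have hm := le_max_right (‖x‖ - n) 0
      -- Beyond radius `2 * n + 1` one has `1 + ‖x‖ ≤ 2 * (‖x‖ - n)`, so the linear remainder bound
      -- is controlled by the tail.
      rcases le_or_gt ‖x‖ (2 * n + 1) with hx | hx
      · have h1 : ‖drift w s t x‖ ≤ α * (2 * n + 2) :=
          hW.trans (mul_le_mul_of_nonneg_left (by linarith) hα0)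
        calc _ ≤ (K * ‖drift w s t x‖) * ‖drift w s t x‖ :=
              mul_le_mul_of_nonneg_right (min_le_right _ _) (norm_nonneg _)
          _ ≤ (K * (α * (2 * n + 2))) * (α * (2 * n + 2)) := by gcongr
          _ = α * (K * α * (2 * n + 2) ^ 2) := by ring
          _ ≤ _ := by
              gcongr
              have := mul_nonneg (mul_nonneg (by norm_num : (0 : ℝ) ≤ 4) hΛ0) hm
              linarith
      · have h2 : 1 + ‖x‖ ≤ 2 * max (‖x‖ - n) 0 := by linarith [le_max_left (‖x‖ - n) 0]
        calc _ ≤ (2 * Λ) * ‖drift w s t x‖ :=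
              mul_le_mul_of_nonneg_right (min_le_left _ _) (norm_nonneg _)
          _ ≤ (2 * Λ) * (α * (2 * max (‖x‖ - n) 0)) := by
              gcongr
              exact hW.trans (mul_le_mul_of_nonneg_left h2 hα0)
          _ = α * (4 * Λ * max (‖x‖ - n) 0) := by ring
          _ ≤ _ := by
              gcongr
              have : 0 ≤ K * α * (2 * n + 2) ^ 2 := by positivity
              linarith
    rw [← Real.norm_eq_abs]
    calc _ ≤ ∫ x, α * (K * α * (2 * n + 2) ^ 2 + 4 * Λ * max (‖x‖ - n) 0) ∂(m s).toMeasure :=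
          norm_integral_le_of_norm_le (((integrable_const _).add (htail.const_mul _)).const_mul _)
            (ae_of_all _ hbound)
      _ = α * (K * α * (2 * n + 2) ^ 2 + 4 * Λ * ∫ x, max (‖x‖ - n) 0 ∂(m s).toMeasure) := by
          rw [integral_const_mul, integral_add (integrable_const _) (htail.const_mul _),
            integral_const, integral_const_mul]
          simp
      _ ≤ _ := by gcongr
  have i1 : Integrable (fun x => g (x + drift w s t x)) (m s).toMeasure := by
    refine integrable_of_le_norm (m s) (a := ‖g 0‖ + Λ * α) (b := Λ + Λ * α)
      (hg.continuous.comp_stronglyMeasurable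
        (stronglyMeasurable_id.add hWm)).aestronglyMeasurable fun x => ?_
    have h1 := norm_le_add_of_lipschitz hgl (x + drift w s t x)
    rw [Real.coe_toNNReal _ hΛ0] at h1
    have h2 := mul_le_mul_of_nonneg_left ((norm_add_le x (drift w s t x)).trans
      (add_le_add_right (h.norm_drift_le hst x) _)) hΛ0
    linarith
  have i2 : Integrable g (m s).toMeasure := integrable_of_lipschitz _ hgl
  have i3 : Integrable (fun x => fderiv ℝ g x (drift w s t x)) (m s).toMeasure := by
    refine integrable_of_le_norm (m s) (a := Λ * α) (b := Λ * α) ?_ fun x => ?_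
    · have h2 : Continuous fun q : (Rd d →L[ℝ] ℝ) × Rd d => q.1 q.2 := by fun_prop
      exact (h2.comp_stronglyMeasurable ((hg.continuous_fderiv (by simp)).stronglyMeasurable.prodMk
        hWm)).aestronglyMeasurable
    · refine ((fderiv ℝ g x).le_opNorm _).trans ?_
      calc _ ≤ Λ * (α * (1 + ‖x‖)) :=
            mul_le_mul (hΛ x) (h.norm_drift_le hst x) (norm_nonneg _) hΛ0
        _ = _ := by ring
  have hri := h.integrable_rate hg hΛ
  -- The frozen first-order terms cancel, leaving the change of the rate over the step and the
  -- Taylor remainder. Their tail contributions, `2 * Λ * κ` and `4 * Λ * κ`, add up to the factor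
  -- six.
  have hsplit : ∫ x, g x ∂(m t).toMeasure - ∫ x, g (x + drift w s t x) ∂(m s).toMeasure =
      (∫ r in s..t, (rate w m g r - b r)) -
      ∫ x, (g (x + drift w s t x) - g x - fderiv ℝ g x (drift w s t x)) ∂(m s).toMeasure := by
    rw [intervalIntegral.integral_sub hri.intervalIntegrable hbi.intervalIntegrable, ← hA, ← hB,
      integral_sub (f := fun x => g (x + drift w s t x) - g x) (i1.sub i2) i3, integral_sub i1 i2]
    ring
  have hD : |∫ r in s..t, (rate w m g r - b r)| ≤
      (t - s) * (Λ * L * ω) + α * ((1 + n) * K * ω + 2 * Λ * κ) := by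
    rw [← Real.norm_eq_abs]
    calc _ ≤ ∫ r in s..t, (Λ * L * ω + a r * ((1 + n) * K * ω + 2 * Λ * κ)) := by
          refine intervalIntegral.norm_integral_le_of_norm_le hst ?_
            (intervalIntegrable_const.add (h.integrable.mul_const _).intervalIntegrable)
          filter_upwards [hC] with r hr hrI using hr (Ioc_subset_Icc_self hrI)
      _ = _ := by
          rw [intervalIntegral.integral_add intervalIntegrable_const
            (h.integrable.mul_const _).intervalIntegrable,
            intervalIntegral.integral_const, intervalIntegral.integral_mul_const, smul_eq_mul]
  rw [hsplit]
  refine (abs_sub _ _).trans ?_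
  linarith

end IsWeakSol

/-- Euler maps with time step `δ`. -/
def eulerMap {d : ℕ} (w : ℝ → Rd d → Rd d) (δ : ℝ) : ℕ → Rd d → Rd d
  | 0 => id
  | i + 1 => fun x => eulerMap w δ i x + drift w (i * δ) ((i + 1 : ℕ) * δ) (eulerMap w δ i x)

namespace IsWeakSol

variable {d : ℕ} {T : ℝ} {w : ℝ → Rd d → Rd d} {a : ℝ → ℝ} {m : ℝ → P1 d}

/-- Each Euler step multiplies Lipschitz constants by at most `1 + (t - s) * L`, so over all the
steps they stay below a fixed exponential factor. -/
theorem lipschitz_comp_add (h : IsWeakSol T w a m) {L : NNReal}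
    (hL : ∀ t x y, ‖w t x - w t y‖ ≤ L * ‖x - y‖) {s t : ℝ} (hst : s ≤ t) {ψ : Rd d → ℝ}
    {Λ : NNReal} (hψ : LipschitzWith Λ ψ) :
    LipschitzWith (Λ * (1 + (t - s).toNNReal * L)) fun x => ψ (x + drift w s t x) := by
  refine hψ.comp (LipschitzWith.of_dist_le_mul fun x y => ?_)
  rw [dist_eq_norm, dist_eq_norm,
    show x + drift w s t x - (y + drift w s t y) =
      (x - y) + (drift w s t x - drift w s t y) by abel]
  refine (norm_add_le _ _).trans ?_
  have := h.norm_drift_sub_le hL hst x y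
  push_cast
  rw [Real.coe_toNNReal _ (by linarith)]
  linarith

/-- The Euler maps follow the solution, for mollified observables. -/
theorem euler_mollified (h : IsWeakSol T w a m) (hT : 0 < T) {L : NNReal}
    (hL : ∀ t x y, ‖w t x - w t y‖ ≤ L * ‖x - y‖) {ε C : ℝ} {S : (Rd d → ℝ) → Rd d → ℝ}
    (hC : 0 ≤ C)
    (hS : ∀ (u : Rd d → ℝ) (Λ : NNReal),
      LipschitzWith Λ u → ContDiff ℝ (⊤ : ℕ∞) (S u) ∧ LipschitzWith Λ (S u) ∧
      (∀ x, |S u x - u x| ≤ Λ * ε) ∧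
      (∀ x y, ‖fderiv ℝ (S u) x - fderiv ℝ (S u) y‖ ≤ C * Λ * ‖x - y‖) ∧
      ∀ (W : Rd d → Rd d) (K : ℝ), 0 ≤ K → (∀ x y, ‖W x - W y‖ ≤ K * ‖x - y‖) →
        ∀ x, |S u (x + W x) - S (fun y => u (y + W y)) x| ≤ Λ * (K * ε))
    {n : ℕ} {κ : ℝ} (hκ : ∀ r ∈ Icc 0 T, ∫ x, max (‖x‖ - n) 0 ∂(m r).toMeasure ≤ κ)
    {δ ω η : ℝ} (hδ : 0 ≤ δ)
    (hω : ∀ s ∈ Icc 0 T, ∀ t ∈ Icc 0 T, |s - t| ≤ δ → W1 (m s) (m t) ≤ ω)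
    (hη : ∀ s ∈ Icc 0 T, ∀ t ∈ Icc 0 T, |s - t| ≤ δ → |∫ r in s..t, a r| ≤ η) (Λ : NNReal) :
    ∀ (k : ℕ) (ψ : Rd d → ℝ) (l : NNReal), k * δ ≤ T → LipschitzWith l ψ →
      l * (1 + δ.toNNReal * L) ^ k ≤ Λ →
      |∫ x, S ψ x ∂(m (k * δ)).toMeasure -
          ∫ x, S (fun y => ψ (eulerMap w δ k y)) x ∂(m 0).toMeasure|
        ≤ k * δ * (Λ * L * ω + Λ * L * ε) + (∫ r in (0 : ℝ)..(k * δ), a r) *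
          ((1 + n) * (C * Λ) * ω + 6 * Λ * κ + C * Λ * η * (2 * n + 2) ^ 2) := by
  have h0I : (0 : ℝ) ∈ Icc 0 T := ⟨le_rfl, hT.le⟩
  intro k
  induction k with
  | zero => intro ψ l _ _ _; simp [eulerMap]
  | succ k ih =>
    intro ψ l hk hψ hl
    set s : ℝ := k * δ with hs
    set t : ℝ := (k + 1 : ℕ) * δ with ht
    have hts : t - s = δ := by rw [ht, hs]; push_cast; ring
    have hst : s ≤ t := by linarith
    have hs0 : 0 ≤ s := by positivity
    -- The last Euler step is absorbed into the observable, so that `u` composed with `k` steps is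
    -- `ψ` composed with `k + 1` steps. The induction therefore ranges over all Lipschitz
    -- observables whose constant leaves room for the remaining steps.
    set u : Rd d → ℝ := fun x => ψ (x + drift w s t x) with hu
    have hul : LipschitzWith (l * (1 + δ.toNNReal * L)) u := by
      have := h.lipschitz_comp_add hL hst hψ
      rwa [hts] at this
    have hone : (1 : NNReal) ≤ 1 + δ.toNNReal * L := le_self_add
    have hlΛ : l ≤ Λ := (le_mul_of_one_le_right zero_le (one_le_pow₀ hone)).trans hl
    have ih' := ih u _ (by linarith) hul (by rw [mul_assoc, ← pow_succ']; exact hl)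
    obtain ⟨p1, p2, -, p4, p5⟩ := hS ψ Λ (hψ.weaken hlΛ)
    have hsI : s ∈ Icc 0 T := ⟨hs0, by linarith⟩
    have htI : t ∈ Icc 0 T := ⟨by linarith, hk⟩
    have hdist : |s - t| ≤ δ := by rw [abs_sub_comm, hts, abs_of_nonneg hδ]
    have step1 := h.one_step hT (NNReal.coe_nonneg L) hL p1
      (fun x => norm_fderiv_le_of_lipschitz ℝ p2)
      (K := C * Λ) (by positivity) p4 hκ hs0 hst hk
      (fun r hr => hω s hsI r ⟨by linarith [hr.1], by linarith [hr.2]⟩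
        (by rw [abs_sub_comm, abs_of_nonneg (by linarith [hr.1])]; linarith [hr.2]))
    have hKL : ∀ x y, ‖drift w s t x - drift w s t y‖ ≤ δ * L * ‖x - y‖ := fun x y => by
      have := h.norm_drift_sub_le hL hst x y
      rwa [hts] at this
    -- Mollifying `u` afresh keeps the second-order bound `C * Λ` at every step. The price is the
    -- commutator error `Λ * δ * L * ε`, which sums to a multiple of `ε`. Comparing `S u` with `u`
    -- at each step would cost `Λ * ε` per step instead.
    have step2 := p5 (drift w s t) (δ * L) (by positivity) hKL
    obtain ⟨q1, q2, -, -, -⟩ := hS u _ hul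
    have i1 : Integrable (fun x => S ψ (x + drift w s t x)) (m s).toMeasure :=
      integrable_of_lipschitz _ (h.lipschitz_comp_add hL hst p2)
    have i2 : Integrable (S u) (m s).toMeasure := integrable_of_lipschitz _ q2
    have step3 : |∫ x, S ψ (x + drift w s t x) ∂(m s).toMeasure - ∫ x, S u x ∂(m s).toMeasure| ≤
        Λ * (δ * L * ε) := by
      rw [← integral_sub i1 i2]
      have := norm_integral_le_of_norm_le_const (μ := (m s).toMeasure)
        (f := fun x => S ψ (x + drift w s t x) - S u x) (ae_of_all _ step2)
      simpa using this
    have hα := hη s hsI t htI hdist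
    set α := ∫ r in s..t, a r with hαd
    have hα0 : 0 ≤ α := intervalIntegral.integral_nonneg hst fun r _ => h.nonneg r
    rw [abs_of_nonneg hα0] at hα
    have hadd : ∫ r in (0 : ℝ)..t, a r = (∫ r in (0 : ℝ)..s, a r) + α :=
      (intervalIntegral.integral_add_adjacent_intervals h.integrable.intervalIntegrable
        h.integrable.intervalIntegrable).symm
    have hcomp : (fun y => u (eulerMap w δ k y)) = fun y => ψ (eulerMap w δ (k + 1) y) := rfl
    rw [hcomp] at ih'
    rw [hts] at step1
    have hsq : α * (C * Λ * α * (2 * n + 2) ^ 2) ≤ α * (C * Λ * η * (2 * n + 2) ^ 2) := by gcongr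
    have htri : ∀ A B C D : ℝ, |A - D| ≤ |A - B| + |B - C| + |C - D| := fun A B C D => by
      have e : A - D = (A - B) + (B - C) + (C - D) := by ring
      rw [e]; exact (abs_add_le _ _).trans (add_le_add_left (abs_add_le _ _) _)
    refine (htri _ _ _ _).trans ((add_le_add (add_le_add step1 step3) ih').trans ?_)
    rw [hadd, show t = s + δ by linarith]
    linear_combination hsq

end IsWeakSol

end Vlasov

/-! ### Gronwall's inequality and convergence of the Euler maps. -/

namespace Vlasov

theorem exists_delta_integral_le {a : ℝ → ℝ} (ha : ∀ s t, IntervalIntegrable a volume s t) (T : ℝ)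
    {η : ℝ} (hη : 0 < η) :
    ∃ δ > 0, ∀ s ∈ Icc 0 T, ∀ t ∈ Icc 0 T, |s - t| < δ → |∫ r in s..t, a r| ≤ η := by
  have hc : Continuous fun t => ∫ r in (0 : ℝ)..t, a r := intervalIntegral.continuous_primitive ha 0
  obtain ⟨δ, hδ, h⟩ := Metric.uniformContinuousOn_iff.1
    (isCompact_Icc.uniformContinuousOn_of_continuous (s := Icc 0 T) hc.continuousOn) η hη
  refine ⟨δ, hδ, fun s hs t ht hst => ?_⟩
  have := h s hs t ht hst
  rw [Real.dist_eq, intervalIntegral.integral_interval_sub_left (ha _ _) (ha _ _),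
    intervalIntegral.integral_symm, abs_neg] at this
  exact this.le

/-- Integral form of Gronwall's inequality with an integrable weight. -/
theorem gronwall_integral {a y : ℝ → ℝ} (ha : ∀ s t, IntervalIntegrable a volume s t)
    (ha0 : ∀ t, 0 ≤ a t) (hy : Continuous y) (hy0 : ∀ t, 0 ≤ y t) {T y₀ : ℝ}
    (h : ∀ t ∈ Icc 0 T, y t ≤ y₀ + ∫ r in (0 : ℝ)..t, a r * y r) {t : ℝ} (ht : t ∈ Icc 0 T) :
    y t ≤ y₀ * Real.exp (2 * ∫ r in (0 : ℝ)..t, a r) := by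
  have hay : ∀ s t, IntervalIntegrable (fun r => a r * y r) volume s t := fun s t =>
    (ha s t).mul_continuousOn hy.continuousOn
  set F : ℝ → ℝ := fun t => y₀ + ∫ r in (0 : ℝ)..t, a r * y r with hF
  have hsub : ∀ s t, F t - F s = ∫ r in s..t, a r * y r := fun s t => by
    rw [← intervalIntegral.integral_interval_sub_left (hay 0 t) (hay 0 s)]
    simp only [hF]; ring
  have hmono : ∀ s t, s ≤ t → F s ≤ F t := fun s t hst => by
    have : 0 ≤ ∫ r in s..t, a r * y r :=
      intervalIntegral.integral_nonneg hst fun r _ => mul_nonneg (ha0 r) (hy0 r)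
    linarith [hsub s t]
  have hstep : ∀ s t, 0 ≤ s → s ≤ t → t ≤ T → ∫ r in s..t, a r ≤ 1 / 2 →
      F t ≤ F s * Real.exp (2 * ∫ r in s..t, a r) := by
    intro s t hs hst htT hα
    set α := ∫ r in s..t, a r with hαd
    have hα0 : 0 ≤ α := intervalIntegral.integral_nonneg hst fun r _ => ha0 r
    have h1 : F t - F s ≤ α * F t := by
      rw [hsub, hαd, ← intervalIntegral.integral_mul_const]
      refine intervalIntegral.integral_mono_on hst (hay s t) ((ha s t).mul_const _) fun r hr => ?_
      refine mul_le_mul_of_nonneg_left ((h r ⟨hs.trans hr.1, hr.2.trans htT⟩).trans ?_) (ha0 r)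
      exact hmono r t hr.2
    have h2 := Real.add_one_le_exp (2 * α)
    -- For `0 ≤ α ≤ 1 / 2` one has `(1 - α) * (1 + 2 * α) ≥ 1`. This is the origin of the factor two
    -- in the exponent.
    have h3 : 1 ≤ (1 - α) * Real.exp (2 * α) := by
      have : (1 - α) * (2 * α + 1) ≤ (1 - α) * Real.exp (2 * α) :=
        mul_le_mul_of_nonneg_left h2 (by linarith)
      nlinarith
    have hFt : 0 ≤ F t := (hy0 t).trans (h t ⟨hs.trans hst, htT⟩)
    calc F t ≤ F t * ((1 - α) * Real.exp (2 * α)) := le_mul_of_one_le_right hFt h3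
      _ = (F t - α * F t) * Real.exp (2 * α) := by ring
      _ ≤ F s * Real.exp (2 * α) := by gcongr; linarith
  -- The interval is cut into equal cells on each of which the weight has integral at most one half,
  -- and the exponential bounds multiply.
  obtain ⟨δ, hδ, hδ'⟩ := exists_delta_integral_le ha T (half_pos one_pos)
  obtain ⟨N, hN⟩ := exists_nat_gt (t / δ)
  have hNpos : (0 : ℝ) < N := (div_nonneg ht.1 hδ.le).trans_lt hN
  have hind : ∀ k : ℕ, k ≤ N → F (k * (t / N)) ≤
      F 0 * Real.exp (2 * ∫ r in (0 : ℝ)..(k * (t / N)), a r) := by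
    intro k
    induction k with
    | zero => intro _; simp
    | succ k ih =>
      intro hk
      have hk' : ((k + 1 : ℕ) : ℝ) ≤ N := by exact_mod_cast hk
      have h0 : 0 ≤ t / N := div_nonneg ht.1 hNpos.le
      have h1 : (k : ℝ) * (t / N) ≤ (k + 1 : ℕ) * (t / N) := by
        gcongr; simp
      have h2 : ((k + 1 : ℕ) : ℝ) * (t / N) ≤ T := by
        refine le_trans ?_ ht.2
        calc _ ≤ N * (t / N) := by gcongr
          _ = t := by field_simp
      have h3 : 0 ≤ (k : ℝ) * (t / N) := by positivity
      have h4 : |(k : ℝ) * (t / N) - (k + 1 : ℕ) * (t / N)| < δ := by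
        rw [abs_sub_comm, abs_of_nonneg (by linarith)]
        push_cast
        have : t / N < δ := by
          rw [div_lt_iff₀ hNpos, mul_comm]; exact (div_lt_iff₀ hδ).1 hN
        linarith
      have h5 := (le_abs_self _).trans (hδ' _ ⟨h3, h1.trans h2⟩ _ ⟨h3.trans h1, h2⟩ h4)
      refine (hstep _ _ h3 h1 h2 h5).trans ?_
      rw [← intervalIntegral.integral_add_adjacent_intervals (ha 0 (k * (t / N))) (ha _ _), mul_add,
        Real.exp_add, ← mul_assoc]
      gcongr
      exact ih (by omega)
  have := hind N le_rfl
  rw [show (N : ℝ) * (t / N) = t by field_simp] at this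
  refine (h t ht).trans (this.trans ?_)
  simp [hF]

/-- Image of an element of `P1` by a map of linear growth. -/
def P1.map {d : ℕ} (μ : P1 d) (X : Rd d → Rd d) (hX : Measurable X) (B : ℝ)
    (hB : ∀ x, ‖X x‖ ≤ B * (1 + ‖x‖)) : P1 d where
  toMeasure := μ.toMeasure.map X
  isProb := Measure.isProbabilityMeasure_map hX.aemeasurable
  finite_moment := by
    rw [lintegral_map (by fun_prop) hX]
    exact (integrable_of_le_norm μ hX.aestronglyMeasurable (a := B) (b := B) fun x => by
      linarith [hB x]).2

theorem tailBound_map {d : ℕ} (μ : P1 d) {X : Rd d → Rd d} (hX : Measurable X) {B : ℝ}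
    (hB : ∀ x, ‖X x‖ ≤ B * (1 + ‖x‖)) :
    TailBound (fun n => ∫⁻ x, ENNReal.ofReal (B * (1 + ‖x‖) - n) ∂μ.toMeasure)
      (μ.map X hX B hB).toMeasure := fun n => by
  change ∫⁻ x, _ ∂(μ.toMeasure.map X) ≤ _
  rw [lintegral_map (by fun_prop) hX]
  exact lintegral_mono fun x => ENNReal.ofReal_le_ofReal (by linarith [hB x])

theorem tendsto_tailBound_map {d : ℕ} (μ : P1 d) (B : ℝ) :
    Tendsto (fun n : ℕ => ∫⁻ x, ENNReal.ofReal (B * (1 + ‖x‖) - n) ∂μ.toMeasure) atTop (𝓝 0) :=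
  tendsto_tail _ (((integrable_const _).add (integrable_norm μ)).const_mul B)

theorem W1_map_le {d : ℕ} (μ : P1 d) {X Y : Rd d → Rd d} (hX : Measurable X) (hY : Measurable Y)
    {B B' : ℝ} (hB : ∀ x, ‖X x‖ ≤ B * (1 + ‖x‖)) (hB' : ∀ x, ‖Y x‖ ≤ B' * (1 + ‖x‖)) {r : ℝ}
    (h : ∀ x, ‖X x - Y x‖ ≤ r * (1 + ‖x‖)) :
    W1 (μ.map X hX B hB) (μ.map Y hY B' hB') ≤ r * (1 + moment μ) := by
  have hr : 0 ≤ r := by simpa using (norm_nonneg _).trans (h 0)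
  have hi : Integrable (fun x : Rd d => 1 + ‖x‖) μ.toMeasure :=
    (integrable_const _).add (integrable_norm _)
  refine W1_le_of_transportCost_le (mul_nonneg hr (by linarith [moment_nonneg μ])) ?_
  refine (transportCost_map_le μ.toMeasure hX hY).trans ?_
  have e : r * (1 + moment μ) = ∫ x, r * (1 + ‖x‖) ∂μ.toMeasure := by
    rw [integral_const_mul, IsWeakSol.integral_one_add_norm]
  rw [e, ofReal_integral_eq_lintegral_ofReal (hi.const_mul r)
    (ae_of_all _ fun x => by positivity)]
  refine lintegral_mono fun x => ?_
  rw [edist_dist, dist_eq_norm]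
  exact ENNReal.ofReal_le_ofReal (h x)

namespace IsWeakSol

variable {d : ℕ} {T : ℝ} {w : ℝ → Rd d → Rd d} {a : ℝ → ℝ} {m : ℝ → P1 d}

theorem measurable_eulerMap (h : IsWeakSol T w a m) {δ : ℝ} (hδ : 0 ≤ δ) :
    ∀ k, Measurable (eulerMap w δ k)
  | 0 => measurable_id
  | k + 1 => (measurable_eulerMap h hδ k).add ((h.stronglyMeasurable_drift (by
      push_cast; linarith)).measurable.comp (measurable_eulerMap h hδ k))

theorem norm_eulerMap_le (h : IsWeakSol T w a m) {δ : ℝ} (hδ : 0 ≤ δ) (k : ℕ) (x : Rd d) :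
    1 + ‖eulerMap w δ k x‖ ≤ (1 + ‖x‖) * Real.exp (∫ r in (0 : ℝ)..(k * δ), a r) := by
  induction k with
  | zero => simp [eulerMap]
  | succ k ih =>
    have hst : (k : ℝ) * δ ≤ (k + 1 : ℕ) * δ := by push_cast; linarith
    have h1 := h.norm_drift_le hst (eulerMap w δ k x)
    rw [← intervalIntegral.integral_add_adjacent_intervals
      (h.integrable.intervalIntegrable (a := 0) (b := k * δ)) h.integrable.intervalIntegrable]
    set α := ∫ r in (k * δ)..((k + 1 : ℕ) * δ), a r
    have h2 := Real.add_one_le_exp α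
    calc 1 + ‖eulerMap w δ (k + 1) x‖
        ≤ 1 + (‖eulerMap w δ k x‖ + α * (1 + ‖eulerMap w δ k x‖)) := by
          gcongr
          exact (norm_add_le _ _).trans (by gcongr)
      _ = (1 + ‖eulerMap w δ k x‖) * (α + 1) := by ring
      _ ≤ ((1 + ‖x‖) * Real.exp (∫ r in (0 : ℝ)..(k * δ), a r)) * Real.exp α := by
          have : 0 ≤ α := intervalIntegral.integral_nonneg hst fun r _ => h.nonneg r
          gcongr
      _ = _ := by rw [mul_assoc, ← Real.exp_add]

theorem integral_le_total (h : IsWeakSol T w a m) {s t : ℝ} (hst : s ≤ t) :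
    ∫ r in s..t, a r ≤ ∫ r, a r := by
  rw [intervalIntegral.integral_of_le hst]
  exact setIntegral_le_integral h.integrable (ae_of_all _ h.nonneg)

theorem norm_eulerMap_le' (h : IsWeakSol T w a m) {δ : ℝ} (hδ : 0 ≤ δ) (k : ℕ) (x : Rd d) :
    ‖eulerMap w δ k x‖ ≤ Real.exp (∫ r, a r) * (1 + ‖x‖) := by
  have h1 := h.norm_eulerMap_le hδ k x
  have h2 : Real.exp (∫ r in (0 : ℝ)..(k * δ), a r) ≤ Real.exp (∫ r, a r) :=
    Real.exp_le_exp.2 (h.integral_le_total (by positivity))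
  have h3 : (1 + ‖x‖) * Real.exp (∫ r in (0 : ℝ)..(k * δ), a r) ≤
    (1 + ‖x‖) * Real.exp (∫ r, a r) := by gcongr
  linarith

/-- The telescoped error of `euler_mollified`, plus two mollification errors at the ends, is made
small. Any weak solution for a Lipschitz field is thereby determined by its initial datum through
the Euler maps. -/
theorem tendsto_integral_eulerMap (h : IsWeakSol T w a m) (hT : 0 < T) {L : NNReal}
    (hL : ∀ t x y, ‖w t x - w t y‖ ≤ L * ‖x - y‖) {τ : ℝ} (hτ : τ ∈ Icc 0 T) {ψ : Rd d → ℝ}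
    {l : NNReal} (hψ : LipschitzWith l ψ) :
    Tendsto (fun N : ℕ => ∫ x, ψ (eulerMap w (τ / (N + 1)) (N + 1) x) ∂(m 0).toMeasure) atTop
      (𝓝 (∫ x, ψ x ∂(m τ).toMeasure)) := by
  -- A common Lipschitz bound for the observable composed with any number of the Euler steps, since
  -- `(1 + δ * L) ^ (N + 1) ≤ exp (L * T)`.
  set Λ : NNReal := l * (Real.exp (L * T)).toNNReal with hΛd
  set A := ∫ r, a r with hA
  have hA0 : 0 ≤ A := integral_nonneg h.nonneg
  rw [Metric.tendsto_nhds]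
  intro θ hθ
  set Lr : ℝ := (L : ℝ) with hLr
  set Λr : ℝ := (Λ : ℝ) with hΛr
  have hL0 : 0 ≤ Lr := NNReal.coe_nonneg L
  have hΛ0 : 0 ≤ Λr := NNReal.coe_nonneg Λ
  have small : ∀ P : ℝ, 0 ≤ P → 0 < θ / (5 * (P + 1)) ∧ P * (θ / (5 * (P + 1))) ≤ θ / 5 := by
    intro P hP
    refine ⟨by positivity, ?_⟩
    rw [mul_div_assoc', div_le_div_iff₀ (by positivity) (by positivity)]
    nlinarith
  -- The order of choices matters: `ε` fixes the constant `C`, then `κ` fixes `n`, and `ω` and `η`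
  -- depend on both. The time step comes last. Each of the four parameters contributes at most `θ /
  -- 5`.
  obtain ⟨hε0, hε1⟩ := small (2 * Λr + T * (Λr * Lr)) (by positivity)
  set ε := θ / (5 * (2 * Λr + T * (Λr * Lr) + 1))
  obtain ⟨C, S, hC, hS⟩ := exists_mollifier d hε0
  obtain ⟨hκ0, hκ1⟩ := small (A * (6 * Λr)) (by positivity)
  set κ := θ / (5 * (A * (6 * Λr) + 1))
  obtain ⟨n, hn⟩ := tendsto_sup_tail h.cont T hκ0
  obtain ⟨hω0, hω1⟩ := small (T * (Λr * Lr) + A * ((1 + n) * (C * Λr))) (by positivity)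
  set ω := θ / (5 * (T * (Λr * Lr) + A * ((1 + n) * (C * Λr)) + 1))
  obtain ⟨hη0, hη1⟩ := small (A * (C * Λr * (2 * n + 2) ^ 2)) (by positivity)
  set η := θ / (5 * (A * (C * Λr * (2 * n + 2) ^ 2) + 1))
  obtain ⟨δ₁, hδ₁, h₁⟩ := exists_modulus h.cont T hω0
  obtain ⟨δ₂, hδ₂, h₂⟩ := exists_delta_integral_le
    (fun s t => h.integrable.intervalIntegrable (a := s) (b := t)) T hη0
  have hlim : Tendsto (fun N : ℕ => τ / ((N : ℝ) + 1)) atTop (𝓝 0) := by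
    have := (tendsto_one_div_add_atTop_nhds_zero_nat (𝕜 := ℝ)).const_mul τ
    simpa [div_eq_mul_inv] using this
  filter_upwards [hlim.eventually_lt_const hδ₁, hlim.eventually_lt_const hδ₂] with N hN1 hN2
  set δ := τ / ((N : ℝ) + 1) with hδd
  have hδ0 : 0 ≤ δ := div_nonneg hτ.1 (by positivity)
  have hNδ : ((N + 1 : ℕ) : ℝ) * δ = τ := by rw [hδd]; push_cast; field_simp
  have hexp : l * (1 + δ.toNNReal * L) ^ (N + 1) ≤ Λ := by
    rw [hΛd]
    gcongr
    rw [← NNReal.coe_le_coe]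
    push_cast
    rw [Real.coe_toNNReal _ hδ0, Real.coe_toNNReal _ (Real.exp_pos _).le]
    calc (1 + δ * Lr) ^ (N + 1) ≤ (Real.exp (δ * Lr)) ^ (N + 1) := by
          gcongr
          linarith [Real.add_one_le_exp (δ * Lr)]
      _ = Real.exp (Lr * τ) := by rw [← Real.exp_nat_mul, ← mul_assoc, hNδ, mul_comm]
      _ ≤ Real.exp (Lr * T) := by
          gcongr
          exact hτ.2
  have hmain := h.euler_mollified hT hL hC hS hn hδ0
    (fun s hs t ht hst => h₁ s hs t ht (hst.trans_lt hN1))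
    (fun s hs t ht hst => h₂ s hs t ht (hst.trans_lt hN2)) Λ (N + 1) ψ l
    (by rw [hNδ]; exact hτ.2) hψ hexp
  rw [hNδ] at hmain
  have hlΛ : l ≤ Λ := by
    refine le_trans ?_ hexp
    exact le_mul_of_one_le_right zero_le (one_le_pow₀ le_self_add)
  have hcomp : ∀ k, LipschitzWith (l * (1 + δ.toNNReal * L) ^ k) fun y => ψ (eulerMap w δ k y) := by
    have : ∀ k, ∀ (ψ : Rd d → ℝ) (l : NNReal), LipschitzWith l ψ →
        LipschitzWith (l * (1 + δ.toNNReal * L) ^ k) fun y => ψ (eulerMap w δ k y) := by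
      intro k
      induction k with
      | zero => intro ψ l hψ; simpa [eulerMap] using hψ
      | succ k ih =>
        intro ψ l hψ
        have h1 := h.lipschitz_comp_add hL
          (by push_cast; linarith : (k : ℝ) * δ ≤ (k + 1 : ℕ) * δ) hψ
        rw [show ((k + 1 : ℕ) : ℝ) * δ - k * δ = δ by push_cast; ring] at h1
        have h2 := ih _ _ h1
        rw [mul_assoc, ← pow_succ'] at h2
        exact h2
    exact fun k => this k ψ l hψ
  have hcompΛ := (hcomp (N + 1)).weaken hexp
  obtain ⟨-, q2, q3, -, -⟩ := hS ψ Λ (hψ.weaken hlΛ)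
  obtain ⟨-, r2, r3, -, -⟩ := hS _ Λ hcompΛ
  have close : ∀ (μ : P1 d) (u v : Rd d → ℝ), LipschitzWith Λ u → LipschitzWith Λ v →
      (∀ x, |u x - v x| ≤ Λ * ε) → |∫ x, u x ∂μ.toMeasure - ∫ x, v x ∂μ.toMeasure| ≤ Λ * ε := by
    intro μ u v hu hv huv
    rw [← integral_sub (integrable_of_lipschitz μ hu) (integrable_of_lipschitz μ hv)]
    have := norm_integral_le_of_norm_le_const (μ := μ.toMeasure) (f := fun x => u x - v x)
      (ae_of_all _ huv)
    simpa using this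
  have c1 := close (m τ) _ _ q2 (hψ.weaken hlΛ) q3
  have c2 := close (m 0) _ _ r2 hcompΛ r3
  rw [Real.dist_eq, abs_sub_comm]
  have hI : ∫ r in (0 : ℝ)..τ, a r ≤ A := h.integral_le_total hτ.1
  have hI0 : 0 ≤ ∫ r in (0 : ℝ)..τ, a r :=
    intervalIntegral.integral_nonneg hτ.1 fun r _ => h.nonneg r
  have htri : ∀ A B C D : ℝ, |A - D| ≤ |B - A| + |B - C| + |C - D| := fun A B C D => by
    have e : A - D = (A - B) + (B - C) + (C - D) := by ring
    rw [e, abs_sub_comm B A]; exact (abs_add_le _ _).trans (add_le_add_left (abs_add_le _ _) _)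
  refine ((htri _ _ _ _).trans (add_le_add (add_le_add c1 hmain) c2)).trans_lt ?_
  have e1 : τ * (Λr * Lr * ω + Λr * Lr * ε) ≤ T * (Λr * Lr * ω + Λr * Lr * ε) := by
    gcongr
    exact hτ.2
  have e2 : (∫ r in (0 : ℝ)..τ, a r) * ((1 + n) * (C * Λr) * ω + 6 * Λr * κ +
      C * Λr * η * (2 * n + 2) ^ 2) ≤ A * ((1 + n) * (C * Λr) * ω + 6 * Λr * κ +
      C * Λr * η * (2 * n + 2) ^ 2) := by
    gcongr
  have e3 : Λr * ε + (T * (Λr * Lr * ω + Λr * Lr * ε) + A * ((1 + n) * (C * Λr) * ω +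
      6 * Λr * κ + C * Λr * η * (2 * n + 2) ^ 2)) + Λr * ε ≤ 4 * (θ / 5) := by
    linear_combination hε1 + hκ1 + hω1 + hη1
  linarith

end IsWeakSol

end Vlasov

/-! ### Stability and uniqueness for Lipschitz fields. -/

namespace Vlasov

theorem continuous_W1_curve {d : ℕ} {m m' : ℝ → P1 d}
    (h : ∀ t, Tendsto (fun s => W1 (m s) (m t)) (𝓝 t) (𝓝 0))
    (h' : ∀ t, Tendsto (fun s => W1 (m' s) (m' t)) (𝓝 t) (𝓝 0)) :
    Continuous fun t => W1 (m t) (m' t) := by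
  refine continuous_iff_continuousAt.2 fun t => tendsto_iff_dist_tendsto_zero.2 ?_
  refine squeeze_zero (fun _ => dist_nonneg) (fun s => abs_W1_sub_le _ _ _ _) ?_
  simpa using (h t).add (h' t)

namespace IsWeakSol

variable {d : ℕ} {T : ℝ} {w w' : ℝ → Rd d → Rd d} {a a' : ℝ → ℝ} {m m' : ℝ → P1 d}

/-- Convergence against Lipschitz functions is weak convergence. The Euler maps have uniform linear
growth, so the images of one measure have common tails, and the convergence upgrades to `W1`. -/
theorem tendsto_W1_eulerMap (h : IsWeakSol T w a m) (hT : 0 < T) {L : NNReal}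
    (hL : ∀ t x y, ‖w t x - w t y‖ ≤ L * ‖x - y‖) {τ : ℝ} (hτ : τ ∈ Icc 0 T)
    {μs : ℕ → P1 d} (hμs : ∀ N : ℕ, (μs N).toMeasure =
      (m 0).toMeasure.map (eulerMap w (τ / (N + 1)) (N + 1))) :
    Tendsto (fun N => W1 (μs N) (m τ)) atTop (𝓝 0) := by
  have hδ : ∀ N : ℕ, 0 ≤ τ / ((N : ℝ) + 1) := fun N => div_nonneg hτ.1 (by positivity)
  refine tendsto_W1_of_tendsto_toPM (tendsto_tailBound_map (m 0) (Real.exp (∫ r, a r)))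
    (fun N => ?_) ?_
  · rw [hμs]
    exact tailBound_map (m 0) (h.measurable_eulerMap (hδ N) (N + 1))
      (h.norm_eulerMap_le' (hδ N) (N + 1))
  · rw [tendsto_iff_forall_lipschitz_integral_tendsto]
    rintro ψ - ⟨l, hl⟩
    refine (h.tendsto_integral_eulerMap hT hL hτ hl).congr fun N => ?_
    change _ = ∫ x, ψ x ∂(μs N).toMeasure
    rw [hμs, integral_map (h.measurable_eulerMap (hδ N) (N + 1)).aemeasurable
      hl.continuous.aestronglyMeasurable]

/-- Discrete Gronwall for two schemes issued from the same point: each step multiplies the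
separation by at most `1 + L * δ` and adds `L` times the integral over the cell of the distance
between the two curves. -/
theorem norm_eulerMap_sub_le (h : IsWeakSol T w a m) (h' : IsWeakSol T w' a' m') {L : NNReal}
    (hL : ∀ t x y, ‖w t x - w' t y‖ ≤ L * (‖x - y‖ + W1 (m t) (m' t))) {δ : ℝ} (hδ : 0 ≤ δ) (k : ℕ)
    (x : Rd d) :
    ‖eulerMap w δ k x - eulerMap w' δ k x‖ ≤
      Real.exp (k * (L * δ)) * (L * ∫ r in (0 : ℝ)..(k * δ), W1 (m r) (m' r)) := by
  have hc := continuous_W1_curve h.cont h'.cont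
  induction k with
  | zero => simp [eulerMap]
  | succ k ih =>
    set s : ℝ := k * δ with hs
    set t : ℝ := (k + 1 : ℕ) * δ with ht
    have hts : t - s = δ := by rw [ht, hs]; push_cast; ring
    have hst : s ≤ t := by linarith
    set z := eulerMap w δ k x
    set z' := eulerMap w' δ k x
    have hJ0 : 0 ≤ ∫ r in s..t, W1 (m r) (m' r) :=
      intervalIntegral.integral_nonneg hst fun r _ => W1_nonneg _ _
    have h1 : ‖drift w s t z - drift w' s t z'‖ ≤
        δ * (L * ‖z - z'‖) + L * ∫ r in s..t, W1 (m r) (m' r) := by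
      unfold drift
      rw [← intervalIntegral.integral_sub (h.integrable_apply z).intervalIntegrable
        (h'.integrable_apply z').intervalIntegrable]
      calc _ ≤ ∫ r in s..t, ((L : ℝ) * ‖z - z'‖ + L * W1 (m r) (m' r)) := by
            refine intervalIntegral.norm_integral_le_of_norm_le hst
              (ae_of_all _ fun r _ => (hL r z z').trans (le_of_eq (mul_add _ _ _)))
              (Continuous.intervalIntegrable (by fun_prop) _ _)
        _ = _ := by
            rw [intervalIntegral.integral_add intervalIntegrable_const
              (Continuous.intervalIntegrable (by fun_prop) _ _), intervalIntegral.integral_const,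
              intervalIntegral.integral_const_mul, hts, smul_eq_mul]
    have hadd : ∫ r in (0 : ℝ)..t, W1 (m r) (m' r) =
        (∫ r in (0 : ℝ)..s, W1 (m r) (m' r)) + ∫ r in s..t, W1 (m r) (m' r) :=
      (intervalIntegral.integral_add_adjacent_intervals (hc.intervalIntegrable _ _)
        (hc.intervalIntegrable _ _)).symm
    have hs0 : 0 ≤ s := by positivity
    have hI0 : 0 ≤ ∫ r in (0 : ℝ)..s, W1 (m r) (m' r) :=
      intervalIntegral.integral_nonneg hs0 fun r _ => W1_nonneg _ _
    rw [hadd]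
    set I := ∫ r in (0 : ℝ)..s, W1 (m r) (m' r)
    set J := ∫ r in s..t, W1 (m r) (m' r)
    have hstep : ‖eulerMap w δ (k + 1) x - eulerMap w' δ (k + 1) x‖ ≤
        (1 + L * δ) * ‖z - z'‖ + L * J := by
      change ‖(z + drift w s t z) - (z' + drift w' s t z')‖ ≤ _
      rw [show (z + drift w s t z) - (z' + drift w' s t z') =
        (z - z') + (drift w s t z - drift w' s t z') by abel]
      refine (norm_add_le _ _).trans ?_
      linarith
    have hL0 : 0 ≤ (L : ℝ) := L.coe_nonneg
    have he := Real.add_one_le_exp (L * δ)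
    have hE : Real.exp ((k + 1 : ℕ) * (L * δ)) = Real.exp (L * δ) * Real.exp (k * (L * δ)) := by
      rw [← Real.exp_add]; congr 1; push_cast; ring
    have h1E : 1 ≤ Real.exp ((k + 1 : ℕ) * (L * δ)) := Real.one_le_exp (by positivity)
    calc _ ≤ (1 + L * δ) * ‖z - z'‖ + L * J := hstep
      _ ≤ Real.exp (L * δ) * (Real.exp (k * (L * δ)) * (L * I)) +
          Real.exp ((k + 1 : ℕ) * (L * δ)) * (L * J) := by
          refine add_le_add (mul_le_mul (by linarith) ih (norm_nonneg _) (by positivity)) ?_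
          exact le_mul_of_one_le_left (by positivity) h1E
      _ = _ := by rw [hE]; ring

/-- Stability, and uniqueness, of solutions for Lipschitz fields. -/
theorem eq_of_lipschitz (h : IsWeakSol T w a m) (h' : IsWeakSol T w' a' m') (hT : 0 < T)
    {L : NNReal} (hLw : ∀ t x y, ‖w t x - w t y‖ ≤ L * ‖x - y‖)
    (hLw' : ∀ t x y, ‖w' t x - w' t y‖ ≤ L * ‖x - y‖)
    (hL : ∀ t x y, ‖w t x - w' t y‖ ≤ L * (‖x - y‖ + W1 (m t) (m' t)))
    (h0 : m 0 = m' 0) {τ : ℝ} (hτ : τ ∈ Icc 0 T) : m τ = m' τ := by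
  have hc := continuous_W1_curve h.cont h'.cont
  set K : ℝ := Real.exp (L * T) * L with hK
  have key : ∀ t ∈ Icc 0 T, W1 (m t) (m' t) ≤ 0 + ∫ r in (0 : ℝ)..t, K * W1 (m r) (m' r) := by
    intro t ht
    rw [zero_add, intervalIntegral.integral_const_mul]
    set I := ∫ r in (0 : ℝ)..t, W1 (m r) (m' r) with hI
    have hI0 : 0 ≤ I := intervalIntegral.integral_nonneg ht.1 fun r _ => W1_nonneg _ _
    have hδ : ∀ N : ℕ, 0 ≤ t / ((N : ℝ) + 1) := fun N => div_nonneg ht.1 (by positivity)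
    have hNδ : ∀ N : ℕ, ((N + 1 : ℕ) : ℝ) * (t / ((N : ℝ) + 1)) = t := fun N => by
      push_cast; field_simp
    let μs : ℕ → P1 d := fun N => (m 0).map _ (h.measurable_eulerMap (hδ N) (N + 1)) _
      (h.norm_eulerMap_le' (hδ N) (N + 1))
    let νs : ℕ → P1 d := fun N => (m' 0).map _ (h'.measurable_eulerMap (hδ N) (N + 1)) _
      (h'.norm_eulerMap_le' (hδ N) (N + 1))
    have l1 : Tendsto (fun N => W1 (μs N) (m t)) atTop (𝓝 0) :=
      h.tendsto_W1_eulerMap hT hLw ht fun N => rfl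
    have l2 : Tendsto (fun N => W1 (νs N) (m' t)) atTop (𝓝 0) :=
      h'.tendsto_W1_eulerMap hT hLw' ht fun N => rfl
    -- Both measures are images of the same initial datum, so running both schemes from the same
    -- point is a coupling. Its cost is bounded pointwise.
    have hmid : ∀ N, W1 (μs N) (νs N) ≤ K * I := by
      intro N
      refine W1_le_of_transportCost_le (by positivity) ?_
      change transportCost ((m 0).toMeasure.map _) ((m' 0).toMeasure.map _) ≤ _
      rw [← h0]
      refine (transportCost_map_le _ (h.measurable_eulerMap (hδ N) (N + 1))
        (h'.measurable_eulerMap (hδ N) (N + 1))).trans ?_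
      calc _ ≤ ∫⁻ _, ENNReal.ofReal (K * I) ∂(m 0).toMeasure := by
            refine lintegral_mono fun x => ?_
            rw [edist_dist, dist_eq_norm]
            refine ENNReal.ofReal_le_ofReal ?_
            refine (h.norm_eulerMap_sub_le h' hL (hδ N) (N + 1) x).trans ?_
            rw [hNδ, hK, mul_assoc]
            refine mul_le_mul_of_nonneg_right (Real.exp_le_exp.2 ?_) (by positivity)
            calc ((N + 1 : ℕ) : ℝ) * (L * (t / ((N : ℝ) + 1)))
                = L * (((N + 1 : ℕ) : ℝ) * (t / ((N : ℝ) + 1))) := by ring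
              _ ≤ L * T := by
                  rw [hNδ]
                  exact mul_le_mul_of_nonneg_left ht.2 L.coe_nonneg
        _ = _ := by simp
    have hle : ∀ N, W1 (m t) (m' t) ≤ W1 (μs N) (m t) + K * I + W1 (νs N) (m' t) := fun N => by
      have h1 := W1_triangle (m t) (μs N) (m' t)
      have h2 := W1_triangle (μs N) (νs N) (m' t)
      rw [W1_comm (m t) (μs N)] at h1
      linarith [hmid N]
    have := ge_of_tendsto' ((l1.add_const (K * I)).add l2) hle
    simpa using this
  have := gronwall_integral (a := fun _ => K) (fun _ _ => intervalIntegrable_const)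
    (fun _ => by positivity) hc (fun _ => W1_nonneg _ _) key hτ
  rw [zero_mul] at this
  exact eq_of_W1_eq_zero (le_antisymm this (W1_nonneg _ _))

end IsWeakSol

end Vlasov

/-! ### Moment bounds and propagation of bounded support. -/

namespace Vlasov

theorem contDiff_comp_norm_sq {d : ℕ} {F : ℝ → ℝ} (hF : ∀ s, 0 ≤ s → ContDiffAt ℝ (⊤ : ℕ∞) F s) :
    ContDiff ℝ (⊤ : ℕ∞) fun x : Rd d => F (‖x‖ ^ 2) :=
  contDiff_iff_contDiffAt.2 fun x =>
    (hF _ (by positivity)).comp x (contDiff_norm_sq ℝ).contDiffAt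

theorem norm_fderiv_comp_norm_sq_le {d : ℕ} {F : ℝ → ℝ} {F' : ℝ} (x : Rd d)
    (hF : HasDerivAt F F' (‖x‖ ^ 2)) :
    ‖fderiv ℝ (fun x : Rd d => F (‖x‖ ^ 2)) x‖ ≤ 2 * |F'| * ‖x‖ := by
  have h1 : HasFDerivAt (fun x : Rd d => ‖x‖ ^ 2) (2 • innerSL ℝ x) x :=
    (hasStrictFDerivAt_norm_sq x).hasFDerivAt
  have h2 := hF.comp_hasFDerivAt x h1
  have h3 : HasFDerivAt (fun x : Rd d => F (‖x‖ ^ 2)) (F' • (2 • innerSL ℝ x)) x := h2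
  rw [h3.fderiv]
  refine ContinuousLinearMap.opNorm_le_bound _ (by positivity) fun z => ?_
  have h4 : (F' • (2 • innerSL ℝ x)) z = F' * (2 * inner ℝ x z) := by simp
  rw [h4, norm_mul, norm_mul, Real.norm_eq_abs F']
  have := norm_inner_le_norm (𝕜 := ℝ) x z
  calc |F'| * (‖(2 : ℝ)‖ * ‖(inner ℝ x z : ℝ)‖) ≤ |F'| * (2 * (‖x‖ * ‖z‖)) := by
        rw [Real.norm_ofNat]; gcongr
    _ = _ := by ring

namespace IsWeakSol

variable {d : ℕ} {T : ℝ} {w : ℝ → Rd d → Rd d} {a : ℝ → ℝ} {m : ℝ → P1 d}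

/-- Gronwall estimate for observables whose growth along the field is controlled. -/
theorem integral_le_of_rate_le (h : IsWeakSol T w a m) {g : Rd d → ℝ}
    (hg : ContDiff ℝ (⊤ : ℕ∞) g) (hg0 : ∀ x, 0 ≤ g x) {Λ : ℝ} (hΛ : ∀ x, ‖fderiv ℝ g x‖ ≤ Λ)
    {b : ℝ → ℝ} (hb : Integrable b) (hb0 : ∀ t, 0 ≤ b t)
    (hr : ∀ᵐ t, rate w m g t ≤ b t * ∫ x, g x ∂(m t).toMeasure) {t : ℝ} (ht : t ∈ Icc 0 T) :
    ∫ x, g x ∂(m t).toMeasure ≤ (∫ x, g x ∂(m 0).toMeasure) * Real.exp (2 * ∫ r, b r) := by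
  have hc : Continuous fun t => ∫ x, g x ∂(m t).toMeasure :=
    continuous_integral_curve h.cont (lipschitzWith_of_fderiv_le hg hΛ)
  have hT : 0 ≤ T := ht.1.trans ht.2
  have hy0 : ∀ t, 0 ≤ ∫ x, g x ∂(m t).toMeasure := fun t => integral_nonneg hg0
  have hbi : ∀ s t, IntervalIntegrable b volume s t := fun s t => hb.intervalIntegrable
  refine (gronwall_integral (y₀ := ∫ x, g x ∂(m 0).toMeasure) hbi hb0 hc hy0
    (fun s hs => ?_) ht).trans ?_
  · rcases hT.eq_or_lt with hT0 | hT0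
    · have : s = 0 := le_antisymm (hs.2.trans hT0.symm.le) hs.1
      simp [this]
    have e := h.integral_sub_eq_integral_rate hT0 hg hΛ ⟨le_rfl, hT⟩ hs
    have : ∫ r in (0 : ℝ)..s, rate w m g r ≤ ∫ r in (0 : ℝ)..s, b r * ∫ x, g x ∂(m r).toMeasure :=
      intervalIntegral.integral_mono_ae hs.1 (h.integrable_rate hg hΛ).intervalIntegrable
        ((hbi 0 s).mul_continuousOn hc.continuousOn) hr
    linarith
  · have : ∫ r in (0 : ℝ)..t, b r ≤ ∫ r, b r := by
      rw [intervalIntegral.integral_of_le ht.1]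
      exact setIntegral_le_integral hb (ae_of_all _ hb0)
    have := hy0 0
    gcongr

theorem integrable_one_add_norm (μ : P1 d) : Integrable (fun x : Rd d => 1 + ‖x‖) μ.toMeasure :=
  (integrable_const _).add (integrable_norm μ)

/-- Uniform bound on the first moment. -/
theorem moment_le (h : IsWeakSol T w a m) {c : ℝ → ℝ} (hc : Integrable c) (hc0 : ∀ t, 0 ≤ c t)
    (hw : ∀ᵐ t, ∀ x, ‖w t x‖ ≤ c t * (1 + ‖x‖ + moment (m t))) {t : ℝ} (ht : t ∈ Icc 0 T) :
    moment (m t) ≤ (1 + moment (m 0)) * Real.exp (6 * ∫ r, c r) := by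
  -- A smooth substitute for the norm: it has gradient at most one and lies between `max 1 ‖x‖` and
  -- `1 + ‖x‖`.
  set g : Rd d → ℝ := fun x => √(1 + ‖x‖ ^ 2) with hgd
  have hg : ContDiff ℝ (⊤ : ℕ∞) g := by
    refine contDiff_comp_norm_sq (F := fun s => √(1 + s)) fun s hs => ?_
    exact (contDiffAt_const.add contDiffAt_id).sqrt (by simp only [id]; positivity)
  have hpos : ∀ x : Rd d, 0 < g x := fun x => Real.sqrt_pos.2 (by positivity)
  have hn : ∀ x : Rd d, ‖x‖ ≤ g x := fun x => Real.le_sqrt_of_sq_le (by linarith)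
  have h1g : ∀ x : Rd d, 1 ≤ g x := fun x => Real.le_sqrt_of_sq_le (by nlinarith [norm_nonneg x])
  have hg1 : ∀ x : Rd d, g x ≤ 1 + ‖x‖ := fun x =>
    Real.sqrt_le_iff.2 ⟨by positivity, by nlinarith [norm_nonneg x]⟩
  have hΛ : ∀ x, ‖fderiv ℝ g x‖ ≤ 1 := fun x => by
    have h1 : HasDerivAt (fun s => √(1 + s)) (1 / (2 * √(1 + ‖x‖ ^ 2))) (‖x‖ ^ 2) :=
      ((hasDerivAt_id _).const_add 1).sqrt (by positivity)
    refine (norm_fderiv_comp_norm_sq_le x h1).trans ?_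
    change 2 * |1 / (2 * g x)| * ‖x‖ ≤ 1
    rw [abs_of_pos (by have := hpos x; positivity)]
    have := hpos x
    rw [show 2 * (1 / (2 * g x)) * ‖x‖ = ‖x‖ / g x by field_simp, div_le_one this]
    exact hn x
  have hgi : ∀ t, Integrable g (m t).toMeasure := fun t =>
    integrable_of_lipschitz (m t) (lipschitzWith_of_fderiv_le hg hΛ)
  have hmom : ∀ t, moment (m t) ≤ ∫ x, g x ∂(m t).toMeasure := fun t =>
    integral_mono (integrable_norm _) (hgi t) hn
  have hone : ∀ t, 1 ≤ ∫ x, g x ∂(m t).toMeasure := fun t => by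
    have := integral_mono (integrable_const (1 : ℝ)) (hgi t) h1g
    simpa using this
  -- The rate is at most `c t * (1 + 2 * moment (m t))`, and both one and the moment are at most `∫
  -- g`, whence the factor three.
  have key := h.integral_le_of_rate_le hg (fun x => (hpos x).le) hΛ (hc.const_mul 3)
    (fun t => mul_nonneg zero_le_three (hc0 t)) ?_ ht
  · rw [integral_const_mul, ← mul_assoc, show (2 : ℝ) * 3 = 6 by norm_num] at key
    refine (hmom t).trans (key.trans ?_)
    gcongr
    rw [← integral_one_add_norm]
    exact integral_mono (hgi 0) (integrable_one_add_norm _) hg1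
  · filter_upwards [hw] with t ht
    have hi : Integrable (fun x : Rd d => 1 + ‖x‖ + moment (m t)) (m t).toMeasure :=
      (integrable_one_add_norm _).add (integrable_const _)
    calc rate w m g t ≤ ∫ x, c t * (1 + ‖x‖ + moment (m t)) ∂(m t).toMeasure := by
          refine (le_abs_self _).trans ?_
          rw [← Real.norm_eq_abs]
          refine norm_integral_le_of_norm_le (hi.const_mul _) (ae_of_all _ fun x => ?_)
          refine ((fderiv ℝ g x).le_of_opNorm_le (hΛ x) _).trans ?_
          rw [one_mul]; exact ht x
      _ = c t * (1 + moment (m t) + moment (m t)) := by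
          rw [integral_const_mul, integral_add (integrable_one_add_norm _) (integrable_const _),
            integral_one_add_norm]
          simp
      _ ≤ c t * (3 * ∫ x, g x ∂(m t).toMeasure) := by
          have := hc0 t
          gcongr
          linarith [hmom t, hone t]
      _ = _ := by ring

/-- Mass cannot escape from a bounded set faster than the flow of the growth rate. -/
theorem measure_eq_zero (h : IsWeakSol T w a m) {Q₀ : ℝ} (hQ₀ : 1 ≤ Q₀)
    (h0 : ∀ᵐ x ∂(m 0).toMeasure, 1 + ‖x‖ ^ 2 ≤ Q₀) {t : ℝ} (ht : t ∈ Icc 0 T) :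
    (m t).toMeasure {x | 4 * (Q₀ * Real.exp (6 * ∫ r, a r)) ≤ 1 + ‖x‖ ^ 2} = 0 := by
  set Q := Q₀ * Real.exp (6 * ∫ r, a r) with hQ
  have hQ0 : 0 < Q := by positivity
  -- The saturation `q / (1 + δ * q)` of `q = 1 + ‖x‖ ^ 2` is bounded, so its powers have bounded
  -- gradient and are admissible observables. With this `δ` it still reaches `2 * Q` where `q ≥ 4 *
  -- Q`.
  set δ := 1 / (4 * Q) with hδ
  have hδ0 : 0 < δ := by positivity
  set p : Rd d → ℝ := fun x => (1 + ‖x‖ ^ 2) / (1 + δ * (1 + ‖x‖ ^ 2)) with hp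
  have hp0 : ∀ x, 0 < p x := fun x => by simp only [hp]; positivity
  have hpq : ∀ x, p x ≤ 1 + ‖x‖ ^ 2 := fun x =>
    div_le_self (by positivity) (by have : 0 ≤ δ * (1 + ‖x‖ ^ 2) := by positivity
                                    linarith)
  have hpδ : ∀ x, p x ≤ δ⁻¹ := fun x => by
    simp only [hp]
    rw [div_le_iff₀ (by positivity), mul_add, ← mul_assoc, inv_mul_cancel₀ hδ0.ne']
    have : 0 < δ⁻¹ := by positivity
    linarith
  have hp2 : ∀ x, 4 * Q ≤ 1 + ‖x‖ ^ 2 → 2 * Q ≤ p x := fun x hx => by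
    simp only [hp]
    rw [le_div_iff₀ (by positivity)]
    have : 2 * Q * (1 + δ * (1 + ‖x‖ ^ 2)) = 2 * Q + (1 + ‖x‖ ^ 2) / 2 := by
      rw [hδ]; field_simp; ring
    linarith
  -- The integral of `p ^ (k + 1)` stays below `Q ^ (k + 1)`, because the Gronwall rate is
  -- proportional to the exponent. Markov's inequality at level `(2 * Q) ^ (k + 1)` then leaves mass
  -- at most `2 ^ (-(k + 1))`.
  have key : ∀ k : ℕ, (m t).toMeasure.real {x | 4 * Q ≤ 1 + ‖x‖ ^ 2} ≤ (1 / 2) ^ (k + 1) := by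
    intro k
    set g : Rd d → ℝ := fun x => p x ^ (k + 1) with hgd
    have hg0 : ∀ x, 0 < g x := fun x => pow_pos (hp0 x) _
    have hg : ContDiff ℝ (⊤ : ℕ∞) g := by
      refine contDiff_comp_norm_sq
        (F := fun s => ((1 + s) / (1 + δ * (1 + s))) ^ (k + 1)) fun s hs => ?_
      have : 1 + δ * (1 + s) ≠ 0 := by positivity
      have i1 : ContDiffAt ℝ (⊤ : ℕ∞) (fun s : ℝ => 1 + s) s := by fun_prop
      have i2 : ContDiffAt ℝ (⊤ : ℕ∞) (fun s : ℝ => 1 + δ * (1 + s)) s := by fun_prop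
      exact (i1.div i2 this).pow _
    have hgrad : ∀ x, ‖fderiv ℝ g x‖ ≤ (k + 1) * g x * (2 * ‖x‖ / (1 + ‖x‖ ^ 2)) := fun x => by
      have hne : 1 + δ * (1 + ‖x‖ ^ 2) ≠ 0 := by positivity
      have h1 : HasDerivAt (fun s => ((1 + s) / (1 + δ * (1 + s))) ^ (k + 1))
          (((k + 1 : ℕ) : ℝ) * p x ^ k * ((1 * (1 + δ * (1 + ‖x‖ ^ 2)) -
            (1 + ‖x‖ ^ 2) * (δ * 1)) / (1 + δ * (1 + ‖x‖ ^ 2)) ^ 2)) (‖x‖ ^ 2) := by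
        have i1 := (hasDerivAt_id (‖x‖ ^ 2)).const_add 1
        exact (i1.div ((i1.const_mul δ).const_add 1) hne).pow (k + 1)
      refine (norm_fderiv_comp_norm_sq_le x h1).trans ?_
      have e : ((k + 1 : ℕ) : ℝ) * p x ^ k * ((1 * (1 + δ * (1 + ‖x‖ ^ 2)) -
            (1 + ‖x‖ ^ 2) * (δ * 1)) / (1 + δ * (1 + ‖x‖ ^ 2)) ^ 2) =
          (k + 1) * g x / ((1 + ‖x‖ ^ 2) * (1 + δ * (1 + ‖x‖ ^ 2))) := by
        simp only [hgd, pow_succ]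
        have : p x = (1 + ‖x‖ ^ 2) / (1 + δ * (1 + ‖x‖ ^ 2)) := rfl
        rw [mul_comm (p x ^ k) (p x)]
        nth_rw 2 [this]
        push_cast
        field_simp
        ring
      rw [e, abs_of_nonneg (by have := (hg0 x).le; positivity)]
      have := (hg0 x).le
      calc 2 * ((k + 1) * g x / ((1 + ‖x‖ ^ 2) * (1 + δ * (1 + ‖x‖ ^ 2)))) * ‖x‖
          ≤ 2 * ((k + 1) * g x / ((1 + ‖x‖ ^ 2) * 1)) * ‖x‖ := by
            gcongr
            have : 0 ≤ δ * (1 + ‖x‖ ^ 2) := by positivity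
            linarith
        _ = _ := by field_simp
    have hΛ : ∀ x, ‖fderiv ℝ g x‖ ≤ (k + 1) * δ⁻¹ ^ (k + 1) * 1 := fun x => by
      refine (hgrad x).trans ?_
      have := (hp0 x).le
      gcongr
      · exact pow_le_pow_left₀ this (hpδ x) _
      · rw [div_le_one (by positivity)]; nlinarith [sq_nonneg (‖x‖ - 1)]
    have hgi : ∀ t, Integrable g (m t).toMeasure := fun t =>
      integrable_of_lipschitz (m t) (lipschitzWith_of_fderiv_le hg hΛ)
    have hb := h.integral_le_of_rate_le hg (fun x => (hg0 x).le) hΛ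
      (h.integrable.const_mul (3 * (k + 1)))
      (fun t => mul_nonneg (by positivity) (h.nonneg t)) ?_ ht
    · have h1 : ∫ x, g x ∂(m 0).toMeasure ≤ Q₀ ^ (k + 1) := by
        have := integral_mono_ae (hgi 0) (integrable_const (Q₀ ^ (k + 1))) (by
          filter_upwards [h0] with x hx
          exact pow_le_pow_left₀ (hp0 x).le ((hpq x).trans hx) _)
        simpa using this
      have h2 : ∫ x, g x ∂(m t).toMeasure ≤ Q ^ (k + 1) := by
        refine hb.trans ?_
        rw [hQ, mul_pow, ← Real.exp_nat_mul, integral_const_mul]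
        refine mul_le_mul h1 (Real.exp_le_exp.2 (le_of_eq ?_)) (Real.exp_pos _).le (by positivity)
        push_cast; ring
      have h3 := mul_meas_ge_le_integral_of_nonneg (ae_of_all _ fun x => (hg0 x).le) (hgi t)
        ((2 * Q) ^ (k + 1))
      have h4 : (m t).toMeasure.real {x | 4 * Q ≤ 1 + ‖x‖ ^ 2} ≤
          (m t).toMeasure.real {x | (2 * Q) ^ (k + 1) ≤ g x} :=
        measureReal_mono fun x hx => pow_le_pow_left₀ (by positivity) (hp2 x hx) _
      have h5 : (2 * Q) ^ (k + 1) * (m t).toMeasure.real {x | 4 * Q ≤ 1 + ‖x‖ ^ 2} ≤ Q ^ (k + 1) :=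
        (mul_le_mul_of_nonneg_left h4 (by positivity)).trans (h3.trans h2)
      rw [mul_pow, mul_comm ((2 : ℝ) ^ (k + 1)), mul_assoc] at h5
      have h6 := le_of_mul_le_mul_left (h5.trans_eq (mul_one _).symm) (by positivity)
      rw [one_div, inv_pow, ← one_div, le_div_iff₀ (by positivity), mul_comm]
      exact h6
    · filter_upwards [h.growth] with t ht
      calc rate w m g t ≤ ∫ x, 3 * (k + 1) * a t * g x ∂(m t).toMeasure := by
            refine (le_abs_self _).trans ?_
            rw [← Real.norm_eq_abs]
            refine norm_integral_le_of_norm_le ((hgi t).const_mul _) (ae_of_all _ fun x => ?_)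
            refine ((fderiv ℝ g x).le_of_opNorm_le (hgrad x) _).trans ?_
            have ha := h.nonneg t
            have := (hg0 x).le
            calc _ ≤ (k + 1) * g x * (2 * ‖x‖ / (1 + ‖x‖ ^ 2)) * (a t * (1 + ‖x‖)) := by
                  gcongr
                  exact ht x
              _ = (k + 1) * g x * a t * ((2 * ‖x‖ * (1 + ‖x‖)) / (1 + ‖x‖ ^ 2)) := by ring
              -- This uses `2 * r * (1 + r) ≤ 3 * (1 + r ^ 2)`.
              _ ≤ (k + 1) * g x * a t * 3 := by
                  gcongr
                  rw [div_le_iff₀ (by positivity)]; nlinarith [sq_nonneg (‖x‖ - 1)]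
              _ = _ := by ring
        _ = _ := by rw [integral_const_mul]
  have hz : (m t).toMeasure.real {x | 4 * Q ≤ 1 + ‖x‖ ^ 2} ≤ 0 := by
    have hlim : Tendsto (fun k : ℕ => (1 / 2 : ℝ) ^ (k + 1)) atTop (𝓝 0) :=
      (tendsto_pow_atTop_nhds_zero_of_lt_one (by norm_num) (by norm_num)).comp
        (tendsto_add_atTop_nat 1)
    exact ge_of_tendsto' hlim key
  exact (measureReal_eq_zero_iff (measure_ne_top _ _)).1 (le_antisymm hz measureReal_nonneg)

theorem support_subset (h : IsWeakSol T w a m) {Q₀ : ℝ} (hQ₀ : 1 ≤ Q₀)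
    (h0 : ∀ᵐ x ∂(m 0).toMeasure, 1 + ‖x‖ ^ 2 ≤ Q₀) {t : ℝ} (ht : t ∈ Icc 0 T) :
    (m t).toMeasure.support ⊆
      Metric.ball 0 (4 * (Q₀ * Real.exp (6 * ∫ r, a r)) + 1) := by
  intro x hx
  by_contra hn
  rw [mem_ball_zero_iff, not_lt] at hn
  have hU : {x : Rd d | 4 * (Q₀ * Real.exp (6 * ∫ r, a r)) < 1 + ‖x‖ ^ 2} ∈ 𝓝 x :=
    (isOpen_lt continuous_const (by fun_prop)).mem_nhds (by
      simp only [mem_ofPred_eq]; nlinarith [sq_nonneg (‖x‖ - 1)])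
  have hpos := (Measure.mem_support_iff_forall x).1 hx _ hU
  refine hpos.ne' (measure_mono_null (fun y hy => ?_) (h.measure_eq_zero hQ₀ h0 ht))
  simp only [mem_ofPred_eq] at hy ⊢
  exact hy.le

end IsWeakSol

end Vlasov

/-! ### Euler schemes for the nonlinear equation. -/

namespace Vlasov

/-- Measure-dependent vector fields of linear growth, continuous in the state and the measure. -/
structure IsField {d : ℕ} (V : ℝ → Rd d → P1 d → Rd d) (c : ℝ → ℝ) : Prop where
  measurable : Measurable fun p : ℝ × Rd d × P1 d => V p.1 p.2.1 p.2.2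
  nonneg : ∀ t, 0 ≤ c t
  integrable : Integrable c
  growth : ∀ᵐ t, ∀ x μ, ‖V t x μ‖ ≤ c t * (1 + ‖x‖ + moment μ)
  continuous_state : ∀ μ, ∀ᵐ t, Continuous fun x => V t x μ
  continuous_measure : ∀ t (μs : ℕ → P1 d) (μ : P1 d), Tendsto (fun n => W1 (μs n) μ) atTop (𝓝 0) →
    ∀ r, TendstoUniformlyOn (fun n x => V t x (μs n)) (fun x => V t x μ) atTop
      (Metric.closedBall 0 r)

/-- `ρ` is the image of `μ` by a map `X` of linear growth. -/
structure IsPush {d : ℕ} (μ : P1 d) (X : Rd d → Rd d) (ρ : P1 d) : Prop where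
  measurable : Measurable X
  growth : ∃ B, ∀ x, ‖X x‖ ≤ B * (1 + ‖x‖)
  eq : ρ.toMeasure = μ.toMeasure.map X

theorem IsPush.moment_eq {d : ℕ} {μ ρ : P1 d} {X : Rd d → Rd d} (h : IsPush μ X ρ) :
    moment ρ = ∫ x, ‖X x‖ ∂μ.toMeasure := by
  rw [moment, h.eq, integral_map h.measurable.aemeasurable (by fun_prop)]

theorem IsPush.integrable {d : ℕ} {μ ρ : P1 d} {X : Rd d → Rd d} (h : IsPush μ X ρ) :
    Integrable (fun x => ‖X x‖) μ.toMeasure := by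
  obtain ⟨B, hB⟩ := h.growth
  exact integrable_of_le_norm μ h.measurable.norm.aestronglyMeasurable (a := B) (b := B) fun x => by
    rw [norm_norm]; linarith [hB x]

theorem exists_isPush {d : ℕ} (μ : P1 d) {X : Rd d → Rd d} (hX : Measurable X) {B : ℝ}
    (hB : ∀ x, ‖X x‖ ≤ B * (1 + ‖x‖)) : ∃ ρ, IsPush μ X ρ :=
  ⟨μ.map X hX B hB, hX, ⟨B, hB⟩, rfl⟩

namespace IsField

variable {d : ℕ} {V : ℝ → Rd d → P1 d → Rd d} {c : ℝ → ℝ}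

theorem integral_le_total (h : IsField V c) {s t : ℝ} (hst : s ≤ t) :
    ∫ r in s..t, c r ≤ ∫ r, c r := by
  rw [intervalIntegral.integral_of_le hst]
  exact setIntegral_le_integral h.integrable (ae_of_all _ h.nonneg)

theorem integral_nonneg (h : IsField V c) {s t : ℝ} (hst : s ≤ t) : 0 ≤ ∫ r in s..t, c r :=
  intervalIntegral.integral_nonneg hst fun r _ => h.nonneg r

theorem norm_integral_le (h : IsField V c) {Y : ℝ → Rd d} {m : ℝ → P1 d} {B : ℝ}
    (hB : ∀ t, 1 + ‖Y t‖ + moment (m t) ≤ B) {s t : ℝ} (hst : s ≤ t) :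
    ‖∫ r in s..t, V r (Y r) (m r)‖ ≤ (∫ r in s..t, c r) * B := by
  rw [← intervalIntegral.integral_mul_const]
  refine intervalIntegral.norm_integral_le_of_norm_le hst ?_
    (h.integrable.mul_const _).intervalIntegrable
  filter_upwards [h.growth] with r hr _
  exact (hr _ _).trans (mul_le_mul_of_nonneg_left (hB r) (h.nonneg r))

theorem integrable_along (h : IsField V c) {Y : ℝ → Rd d} {m : ℝ → P1 d} (hY : Measurable Y)
    (hm : Measurable m) {B : ℝ} (hB : ∀ t, 1 + ‖Y t‖ + moment (m t) ≤ B) :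
    Integrable fun r => V r (Y r) (m r) := by
  refine (h.integrable.mul_const B).mono'
    (h.measurable.comp (measurable_id.prodMk (hY.prodMk hm))).aestronglyMeasurable ?_
  filter_upwards [h.growth] with r hr
  exact (hr _ _).trans (mul_le_mul_of_nonneg_left (hB r) (h.nonneg r))

theorem exists_isPush_step (h : IsField V c) {μ ρ : P1 d} {X : Rd d → Rd d} (hX : IsPush μ X ρ)
    {s t : ℝ} (hst : s ≤ t) : ∃ ρ', IsPush μ (fun x => X x + ∫ r in s..t, V r (X x) ρ) ρ' := by
  obtain ⟨B, hB⟩ := hX.growth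
  refine exists_isPush μ ?_ (B := B + (∫ r in s..t, c r) * (1 + B + moment ρ)) fun x => ?_
  · refine hX.measurable.add ?_
    simp only [intervalIntegral.integral_of_le hst]
    have : Measurable fun p : Rd d × ℝ => V p.2 (X p.1) ρ :=
      h.measurable.comp (measurable_snd.prodMk
        ((hX.measurable.comp measurable_fst).prodMk measurable_const))
    exact (this.stronglyMeasurable.integral_prod_right (f := fun x r => V r (X x) ρ)).measurable
  · have h1 := h.norm_integral_le (Y := fun _ => X x) (m := fun _ => ρ) (fun _ => le_rfl) hst
    have h2 := h.integral_nonneg hst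
    refine (norm_add_le _ _).trans ?_
    have h3 : 1 + ‖X x‖ + moment ρ ≤ (1 + B + moment ρ) * (1 + ‖x‖) := by
      have := mul_nonneg (moment_nonneg ρ) (norm_nonneg x)
      nlinarith [hB x, norm_nonneg x]
    calc _ ≤ B * (1 + ‖x‖) + (∫ r in s..t, c r) * ((1 + B + moment ρ) * (1 + ‖x‖)) :=
          add_le_add (hB x) (h1.trans (mul_le_mul_of_nonneg_left h3 h2))
      _ = _ := by ring

/-- Bound of the moments along Euler schemes. -/
def momentBound (μ : P1 d) (c : ℝ → ℝ) : ℝ := (1 + 2 * moment μ) * Real.exp (2 * ∫ r, c r)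

/-- Linear growth bound of Euler schemes. -/
def growthBound (μ : P1 d) (c : ℝ → ℝ) : ℝ := Real.exp (∫ r, c r) * (1 + momentBound μ c)

theorem momentBound_nonneg (μ : P1 d) (c : ℝ → ℝ) : 0 ≤ momentBound μ c :=
  mul_nonneg (by linarith [moment_nonneg μ]) (Real.exp_pos _).le

theorem growthBound_nonneg (μ : P1 d) (c : ℝ → ℝ) : 0 ≤ growthBound μ c :=
  mul_nonneg (Real.exp_pos _).le (by linarith [momentBound_nonneg μ c])

/-- Averaging the one-step bound controls the moments first: `1 + 2 * moment` grows by at most the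
exponential of twice the integral of `c` over the cell. With the moments bounded by a constant, the
pathwise bound is again a discrete Gronwall estimate. Neither bound depends on `δ`. -/
theorem exists_euler (h : IsField V c) (μ : P1 d) {δ : ℝ} (hδ : 0 < δ) :
    ∃ (E : ℕ → Rd d → Rd d) (ρ : ℕ → P1 d), (∀ k, IsPush μ (E k) (ρ k)) ∧ (∀ x, E 0 x = x) ∧
      (∀ (k : ℕ) x, E (k + 1) x = E k x +
        ∫ r in (k * δ)..((k + 1 : ℕ) * δ), V r (E k x) (ρ k)) ∧
      ∀ k x, 1 + ‖E k x‖ + moment (ρ k) ≤ growthBound μ c * (1 + ‖x‖) := by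
  have hst : ∀ k : ℕ, (k : ℝ) * δ ≤ (k + 1 : ℕ) * δ := fun k => by push_cast; linarith
  -- The map and the law of its image are constructed together, since the next displacement depends
  -- on both.
  let S := {p : (Rd d → Rd d) × P1 d // IsPush μ p.1 p.2}
  have hex : ∀ (k : ℕ) (p : S), ∃ q : S, ∀ x, q.1.1 x = p.1.1 x +
      ∫ r in (k * δ)..((k + 1 : ℕ) * δ), V r (p.1.1 x) p.1.2 := fun k p => by
    obtain ⟨ρ', hρ'⟩ := h.exists_isPush_step p.2 (hst k)
    exact ⟨⟨(_, ρ'), hρ'⟩, fun _ => rfl⟩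
  choose f hf using hex
  have hid : IsPush μ id μ := ⟨measurable_id, ⟨1, fun x => by simp⟩, Measure.map_id.symm⟩
  let p : ℕ → S := fun n => Nat.rec ⟨(id, μ), hid⟩ f n
  have hp : ∀ k x, (p (k + 1)).1.1 x = (p k).1.1 x +
      ∫ r in (k * δ)..((k + 1 : ℕ) * δ), V r ((p k).1.1 x) (p k).1.2 := fun k x => hf k (p k) x
  have hstep : ∀ k x, ‖(p (k + 1)).1.1 x‖ ≤ ‖(p k).1.1 x‖ +
      (∫ r in (k * δ)..((k + 1 : ℕ) * δ), c r) * (1 + ‖(p k).1.1 x‖ + moment (p k).1.2) :=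
    fun k x => by
      rw [hp k x]
      exact (norm_add_le _ _).trans (add_le_add_right (h.norm_integral_le
        (Y := fun _ => (p k).1.1 x) (m := fun _ => (p k).1.2) (fun _ => le_rfl) (hst k)) _)
  have hsum : ∀ k : ℕ, (∫ r in (0 : ℝ)..((k + 1 : ℕ) * δ), c r) =
      (∫ r in (0 : ℝ)..(k * δ), c r) + ∫ r in (k * δ)..((k + 1 : ℕ) * δ), c r := fun k =>
    (intervalIntegral.integral_add_adjacent_intervals h.integrable.intervalIntegrable
      h.integrable.intervalIntegrable).symm
  have hmom : ∀ k : ℕ, 1 + 2 * moment (p k).1.2 ≤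
      (1 + 2 * moment μ) * Real.exp (2 * ∫ r in (0 : ℝ)..(k * δ), c r) := by
    intro k
    induction k with
    | zero =>
      have : (p 0).1.2 = μ := rfl
      simp [this]
    | succ k ih =>
      rw [hsum, mul_add, Real.exp_add, ← mul_assoc]
      set α := ∫ r in (k * δ)..((k + 1 : ℕ) * δ), c r
      have hα : 0 ≤ α := h.integral_nonneg (hst k)
      have h1 : moment (p (k + 1)).1.2 ≤
          moment (p k).1.2 + α * (1 + 2 * moment (p k).1.2) := by
        have hi := (p k).2.integrable
        have hc : Integrable (fun _ : Rd d => (1 : ℝ)) μ.toMeasure := integrable_const _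
        have hc' : Integrable (fun _ : Rd d => moment (p k).1.2) μ.toMeasure := integrable_const _
        have hc1 : Integrable (fun x => 1 + ‖(p k).1.1 x‖) μ.toMeasure := hc.add hi
        have hc2 : Integrable (fun x => 1 + ‖(p k).1.1 x‖ + moment (p k).1.2) μ.toMeasure :=
          hc1.add hc'
        rw [(p (k + 1)).2.moment_eq]
        refine (integral_mono (p (k + 1)).2.integrable
          (hi.add (hc2.const_mul α)) (hstep k)).trans (le_of_eq ?_)
        change ∫ x, (‖(p k).1.1 x‖ + α * (1 + ‖(p k).1.1 x‖ + moment (p k).1.2)) ∂μ.toMeasure = _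
        rw [integral_add hi (hc2.const_mul α), integral_const_mul,
          integral_add hc1 hc', integral_add hc hi, ← (p k).2.moment_eq]
        simp only [integral_const, probReal_univ, smul_eq_mul]
        ring
      have h2 := Real.add_one_le_exp (2 * α)
      calc 1 + 2 * moment (p (k + 1)).1.2 ≤ (1 + 2 * moment (p k).1.2) * (2 * α + 1) := by
            linarith
        _ ≤ _ := mul_le_mul ih h2 (by linarith) (by have := moment_nonneg μ; positivity)
  have hM : ∀ k, moment (p k).1.2 ≤ momentBound μ c := fun k => by
    have h1 := hmom k
    have h2 : Real.exp (2 * ∫ r in (0 : ℝ)..(k * δ), c r) ≤ Real.exp (2 * ∫ r, c r) := by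
      gcongr
      exact h.integral_le_total (by positivity)
    have h3 := mul_le_mul_of_nonneg_left h2
      (by linarith [moment_nonneg μ] : 0 ≤ 1 + 2 * moment μ)
    unfold momentBound
    linarith [moment_nonneg (p k).1.2]
  set M := momentBound μ c with hMd
  have hM0 : 0 ≤ M := momentBound_nonneg μ c
  have hgr : ∀ (k : ℕ) x, 1 + ‖(p k).1.1 x‖ + M ≤
      (1 + ‖x‖ + M) * Real.exp (∫ r in (0 : ℝ)..(k * δ), c r) := by
    intro k x
    induction k with
    | zero =>
      have : (p 0).1.1 x = x := rfl
      simp [this]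
    | succ k ih =>
      rw [hsum, Real.exp_add, ← mul_assoc]
      set α := ∫ r in (k * δ)..((k + 1 : ℕ) * δ), c r with hαd
      have hα : 0 ≤ α := h.integral_nonneg (hst k)
      have h2 := Real.add_one_le_exp α
      have h3 : ‖(p (k + 1)).1.1 x‖ ≤ ‖(p k).1.1 x‖ + α * (1 + ‖(p k).1.1 x‖ + M) :=
        (hstep k x).trans (by
          rw [← hαd]
          gcongr
          exact hM k)
      calc 1 + ‖(p (k + 1)).1.1 x‖ + M ≤ (1 + ‖(p k).1.1 x‖ + M) * (α + 1) := by linarith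
        _ ≤ _ := mul_le_mul ih h2 (by linarith) (by positivity)
  refine ⟨fun k => (p k).1.1, fun k => (p k).1.2, fun k => (p k).2, fun x => rfl, hp,
    fun k x => ?_⟩
  have h1 := hgr k x
  have h2 : Real.exp (∫ r in (0 : ℝ)..(k * δ), c r) ≤ Real.exp (∫ r, c r) := by
    gcongr
    exact h.integral_le_total (by positivity)
  calc 1 + ‖(p k).1.1 x‖ + moment (p k).1.2 ≤ 1 + ‖(p k).1.1 x‖ + M := by linarith [hM k]
    _ ≤ (1 + ‖x‖ + M) * Real.exp (∫ r, c r) := h1.trans (by gcongr)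
    _ ≤ ((1 + M) * (1 + ‖x‖)) * Real.exp (∫ r, c r) := by
        gcongr
        nlinarith [mul_nonneg hM0 (norm_nonneg x)]
    _ = _ := by unfold growthBound; ring

/-- Piecewise constant approximations of solutions. -/
theorem exists_scheme (h : IsField V c) (μ : P1 d) (T : ℝ) {ε : ℝ} (hε : 0 < ε) :
    ∃ (Y : ℝ → Rd d → Rd d) (m : ℝ → P1 d), Measurable (fun p : ℝ × Rd d => Y p.1 p.2) ∧
      Measurable m ∧ (∀ t, IsPush μ (Y t) (m t)) ∧
      (∀ t x, 1 + ‖Y t x‖ + moment (m t) ≤ growthBound μ c * (1 + ‖x‖)) ∧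
      ∀ t ∈ Icc 0 T, ∀ x, ‖x + (∫ r in (0 : ℝ)..t, V r (Y r x) (m r)) - Y t x‖ ≤
        ε * (1 + ‖x‖) := by
  set A := growthBound μ c with hA
  have hA0 : 0 ≤ A := growthBound_nonneg μ c
  obtain ⟨δ₀, hδ₀, hδ⟩ := exists_delta_integral_le
    (fun s t => h.integrable.intervalIntegrable (a := s) (b := t)) T
    (show 0 < ε / (A + 1) by positivity)
  -- The trajectory moves within one cell by at most `A * (1 + ‖x‖)` times the integral of `c` over
  -- it, which is made at most `ε / (A + 1)`. Halving gives the strict inequality required of the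
  -- cell length.
  set δ := δ₀ / 2 with hδd
  have hδ0 : 0 < δ := by positivity
  obtain ⟨E, ρ, hE, hE0, hE1, hEb⟩ := h.exists_euler μ hδ0
  -- The cell `(k * δ, (k + 1) * δ]` has index `k`. Truncated subtraction gives index zero at all
  -- times `s ≤ 0`.
  set i : ℝ → ℕ := fun s => ⌈s / δ⌉₊ - 1 with hi
  have him : Measurable i := by
    have h1 : Measurable fun s : ℝ => ⌈s / δ⌉₊ := Nat.measurable_ceil.comp (by fun_prop)
    exact (measurable_from_nat (f := fun n => n - 1)).comp h1
  have hik : ∀ (k : ℕ) (s : ℝ), k * δ < s → s ≤ (k + 1 : ℕ) * δ → i s = k := by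
    intro k s h1 h2
    have : ⌈s / δ⌉₊ = k + 1 := by
      rw [Nat.ceil_eq_iff (by simp)]
      simp only [add_tsub_cancel_right]
      exact ⟨(lt_div_iff₀ hδ0).2 h1, (div_le_iff₀ hδ0).2 h2⟩
    simp [hi, this]
  have hYm : Measurable fun p : ℝ × Rd d => E (i p.1) p.2 := by
    have h1 : Measurable fun p : ℕ × Rd d => E p.1 p.2 :=
      measurable_from_prod_countable_right fun k => (hE k).measurable
    exact h1.comp ((him.comp measurable_fst).prodMk measurable_snd)
  have hm : Measurable fun t => ρ (i t) := (measurable_from_nat (f := ρ)).comp him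
  have hint : ∀ x s t, IntervalIntegrable (fun r => V r (E (i r) x) (ρ (i r))) volume s t :=
    fun x s t => (h.integrable_along (Y := fun r => E (i r) x)
      (hYm.comp measurable_prodMk_right) hm (fun t => hEb (i t) x)).intervalIntegrable
  have hcell : ∀ (k : ℕ) (t : ℝ) x, k * δ ≤ t → t ≤ (k + 1 : ℕ) * δ →
      ∫ r in (k * δ)..t, V r (E (i r) x) (ρ (i r)) = ∫ r in (k * δ)..t, V r (E k x) (ρ k) := by
    intro k t x h1 h2
    refine intervalIntegral.integral_congr_ae (ae_of_all _ fun r hr => ?_)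
    rw [uIoc_of_le h1] at hr
    rw [hik k r hr.1 (hr.2.trans h2)]
  have hX : ∀ (k : ℕ) x,
      x + ∫ r in (0 : ℝ)..(k * δ), V r (E (i r) x) (ρ (i r)) = E k x := by
    intro k x
    induction k with
    | zero => simp [hE0]
    | succ k ih =>
      have hst : (k : ℝ) * δ ≤ (k + 1 : ℕ) * δ := by push_cast; linarith
      rw [← intervalIntegral.integral_add_adjacent_intervals (hint x 0 (k * δ)) (hint x _ _),
        ← add_assoc, ih, hcell k _ x hst le_rfl, hE1]
  refine ⟨fun t => E (i t), fun t => ρ (i t), hYm, hm, fun t => hE _, fun t => hEb _,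
    fun t ht x => ?_⟩
  rcases ht.1.eq_or_lt with h0 | h0
  · rw [← h0]
    have : i 0 = 0 := by simp [hi]
    simp only [this, hE0, intervalIntegral.integral_same, add_zero, sub_self, norm_zero]
    positivity
  · obtain ⟨k, hk⟩ : ∃ k, ⌈t / δ⌉₊ = k + 1 :=
      Nat.exists_eq_succ_of_ne_zero (Nat.ceil_pos.2 (div_pos h0 hδ0)).ne'
    have hk' := (Nat.ceil_eq_iff (by simp)).1 hk
    simp only [add_tsub_cancel_right] at hk'
    have h1 : k * δ < t := (lt_div_iff₀ hδ0).1 hk'.1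
    have h2 : t ≤ (k + 1 : ℕ) * δ := (div_le_iff₀ hδ0).1 hk'.2
    change ‖x + (∫ r in (0 : ℝ)..t, V r (E (i r) x) (ρ (i r))) - E (i t) x‖ ≤ _
    rw [hik k t h1 h2, ← intervalIntegral.integral_add_adjacent_intervals (hint x 0 (k * δ))
      (hint x _ _), ← add_assoc, hX, hcell k t x h1.le h2, add_sub_cancel_left]
    have h3 := h.norm_integral_le (Y := fun _ => E k x) (m := fun _ => ρ k)
      (fun _ => hEb k x) h1.le
    have h4 := hδ (k * δ) ⟨by positivity, h1.le.trans ht.2⟩ t ht (by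
      rw [abs_sub_comm, abs_of_pos (by linarith)]
      push_cast at h2
      linarith)
    refine h3.trans ?_
    calc _ ≤ ε / (A + 1) * (A * (1 + ‖x‖)) := by
          gcongr
          exact (le_abs_self _).trans h4
      _ = ε * (1 + ‖x‖) * (A / (A + 1)) := by field_simp
      _ ≤ ε * (1 + ‖x‖) := by
          refine mul_le_of_le_one_right (by positivity) ?_
          rw [div_le_one (by positivity)]
          linarith

end IsField

end Vlasov

/-! ### Compactness of curves, and test functions along trajectories. -/

namespace Vlasov

/-- Tychonoff's theorem for countably many copies of the weakly compact set of `isCompact_tailBound`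
extracts one subsequence for all indices. The common tail bound turns weak convergence into `W1`
convergence. -/
theorem exists_subseq_tendsto_W1_pi {d : ℕ} {ι : Type*} [Countable ι] {νs : ℕ → ι → P1 d}
    {τ : ℕ → ℝ≥0∞} (hτ : Tendsto τ atTop (𝓝 0)) (hs : ∀ n i, TailBound τ (νs n i).toMeasure) :
    ∃ θ : ℕ → ℕ, StrictMono θ ∧ ∃ μ : ι → P1 d, ∀ i,
      Tendsto (fun n => W1 (νs (θ n) i) (μ i)) atTop (𝓝 0) := by
  obtain ⟨π, hπ, θ, hθ, hlim⟩ :=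
    (isCompact_univ_pi fun _ : ι => isCompact_tailBound (d := d) hτ).tendsto_subseq
    (x := fun n i => (νs n i).toPM) (fun n i _ => hs n i)
  refine ⟨θ, hθ, fun i => ⟨π i, (π i).2, TailBound.lintegral_enorm_lt_top hτ (hπ i trivial)⟩,
    fun i => tendsto_W1_of_tendsto_toPM hτ (fun n => hs (θ n) i) ?_⟩
  exact tendsto_pi_nhds.1 hlim i

/-- Compactness of equicontinuous families of curves with uniformly integrable first moments. -/
theorem exists_subseq_tendsto_W1_curve {d : ℕ} {ν : ℕ → ℝ → P1 d} {τ : ℕ → ℝ≥0∞}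
    (hτ : Tendsto τ atTop (𝓝 0)) (hs : ∀ n t, TailBound τ (ν n t).toMeasure) {C : ℝ → ℝ}
    (hC : Continuous C) (hν : ∀ n s t, W1 (ν n s) (ν n t) ≤ |C s - C t|) :
    ∃ θ : ℕ → ℕ, StrictMono θ ∧ ∃ m : ℝ → P1 d, ∀ t,
      Tendsto (fun n => W1 (ν (θ n) t) (m t)) atTop (𝓝 0) := by
  obtain ⟨θ, hθ, μ, hμ⟩ := exists_subseq_tendsto_W1_pi (νs := fun n (q : ℚ) => ν n q) hτ
    (fun n q => hs n q)
  -- The limit at an arbitrary time comes from a further subsequence depending on that time.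
  -- Equicontinuity and convergence at nearby rational times then force the original subsequence to
  -- converge to it.
  have hex : ∀ t : ℝ, ∃ ρ : P1 d, ∃ η : ℕ → ℕ, StrictMono η ∧
      Tendsto (fun k => W1 (ν (θ (η k)) t) ρ) atTop (𝓝 0) := fun t => by
    obtain ⟨η, hη, ρ, hρ⟩ := exists_subseq_tendsto_W1_pi (ι := Unit)
      (νs := fun n _ => ν (θ n) t) hτ (fun n _ => hs (θ n) t)
    exact ⟨ρ (), η, hη, hρ ()⟩
  choose m η hη hm using hex
  refine ⟨θ, hθ, m, fun t => ?_⟩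
  have hbound : ∀ (q : ℚ) (n : ℕ), W1 (ν (θ n) t) (m t) ≤
      2 * |C t - C q| + W1 (ν (θ n) q) (μ q) := by
    intro q n
    have h1 : ∀ k, W1 (ν (θ n) t) (m t) ≤ 2 * |C t - C q| + W1 (ν (θ n) q) (μ q) +
        (W1 (ν (θ (η t k)) q) (μ q) + W1 (ν (θ (η t k)) t) (m t)) := fun k => by
      have a1 := W1_triangle (ν (θ n) t) (ν (θ n) q) (m t)
      have a2 := W1_triangle (ν (θ n) q) (μ q) (m t)
      have a3 := W1_triangle (μ q) (ν (θ (η t k)) q) (m t)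
      have a4 := W1_triangle (ν (θ (η t k)) q) (ν (θ (η t k)) t) (m t)
      have a5 := hν (θ n) t q
      have a6 := hν (θ (η t k)) q t
      rw [abs_sub_comm] at a6
      rw [W1_comm (μ q) (ν (θ (η t k)) q)] at a3
      linarith
    have h2 := (((hμ q).comp (hη t).tendsto_atTop).add (hm t)).const_add
      (2 * |C t - C q| + W1 (ν (θ n) q) (μ q))
    have := ge_of_tendsto' h2 h1
    simpa using this
  rw [Metric.tendsto_nhds]
  intro ε hε
  have hopen : IsOpen {s : ℝ | 2 * |C t - C s| < ε / 2} :=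
    isOpen_lt (by fun_prop) continuous_const
  obtain ⟨q, hq⟩ := Rat.denseRange_cast.exists_mem_open hopen
    ⟨t, by simp only [mem_ofPred_eq, sub_self, abs_zero]; linarith⟩
  filter_upwards [(hμ q).eventually_lt_const (half_pos hε)] with n hn
  rw [Real.dist_eq, sub_zero, abs_of_nonneg (W1_nonneg _ _)]
  simp only [mem_ofPred_eq] at hq
  linarith [hbound q n]

theorem absolutelyContinuousOnInterval_of_dist_le {f G : ℝ → ℝ} {a b : ℝ}
    (hG : AbsolutelyContinuousOnInterval G a b) (h : ∀ s t, dist (f s) (f t) ≤ dist (G s) (G t)) :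
    AbsolutelyContinuousOnInterval f a b := by
  rw [absolutelyContinuousOnInterval_iff] at hG ⊢
  intro ε hε
  obtain ⟨δ, hδ, h'⟩ := hG ε hε
  exact ⟨δ, hδ, fun E hE hs => (Finset.sum_le_sum fun i _ => h _ _).trans_lt (h' E hE hs)⟩

theorem IsTestFunction.fderiv_eq_zero {d : ℕ} {T : ℝ} {φ : ℝ × Rd d → ℝ} (hφ : IsTestFunction T φ)
    {t : ℝ} (ht : t ∉ Ioo 0 T) (y : Rd d) : fderiv ℝ φ (t, y) = 0 := by
  by_contra hne
  have : (t, y) ∈ tsupport φ := support_fderiv_subset ℝ (Function.mem_support.2 hne)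
  exact ht (hφ.support_subset this).1

/-- Time and space derivatives combine into one Fréchet derivative in the direction `(1, z)`, a
single continuous compactly supported object in the limit arguments. -/
theorem IsTestFunction.deriv_add_fderiv {d : ℕ} {T : ℝ} {φ : ℝ × Rd d → ℝ}
    (hφ : IsTestFunction T φ) (t : ℝ) (x z : Rd d) :
    deriv (fun s => φ (s, x)) t + fderiv ℝ (fun y => φ (t, y)) x z = fderiv ℝ φ (t, x) (1, z) := by
  have hd : HasFDerivAt φ (fderiv ℝ φ (t, x)) (t, x) :=
    (hφ.smooth.differentiable (by simp) _).hasFDerivAt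
  have h1 : HasDerivAt (fun s => (s, x)) ((1 : ℝ), (0 : Rd d)) t :=
    (hasDerivAt_id t).prodMk (hasDerivAt_const t x)
  have h2 : HasFDerivAt (fun y : Rd d => (t, y)) (ContinuousLinearMap.inr ℝ ℝ (Rd d)) x :=
    hasFDerivAt_prodMk_right t x
  have e1 : deriv (fun s => φ (s, x)) t = fderiv ℝ φ (t, x) (1, 0) :=
    (HasFDerivAt.comp_hasDerivAt t hd h1).deriv
  have e2 : fderiv ℝ (fun y => φ (t, y)) x = (fderiv ℝ φ (t, x)).comp
      (ContinuousLinearMap.inr ℝ ℝ (Rd d)) := (HasFDerivAt.comp x hd h2).fderiv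
  rw [e1, e2, ContinuousLinearMap.comp_apply, ← map_add]
  simp

/-- Test functions along absolutely continuous curves. -/
theorem IsTestFunction.integral_fderiv_curve {d : ℕ} {T : ℝ} {φ : ℝ × Rd d → ℝ}
    (hφ : IsTestFunction T φ) (hT : 0 ≤ T) {w : ℝ → Rd d} (hw : Integrable w) (x : Rd d) :
    ∫ t, fderiv ℝ φ (t, x + ∫ r in (0 : ℝ)..t, w r) (1, w t) = 0 := by
  obtain ⟨K, hK⟩ := hφ.smooth.lipschitzWith_of_hasCompactSupport hφ.compact (by simp)
  set X : ℝ → Rd d := fun t => x + ∫ r in (0 : ℝ)..t, w r with hX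
  set f : ℝ → ℝ := fun t => φ (t, X t) with hf
  have hwi : ∀ s t, IntervalIntegrable w volume s t := fun s t => hw.intervalIntegrable
  have hGi : ∀ s t, IntervalIntegrable (fun r => (K : ℝ) * (1 + ‖w r‖)) volume s t := fun s t =>
    (intervalIntegrable_const.add (hwi s t).norm).const_mul _
  -- The increments of `f` are dominated by those of the primitive of `K * (1 + ‖w‖)`. The
  -- fundamental theorem for absolutely continuous functions then applies, and `f` vanishes at both
  -- endpoints.
  have hac : AbsolutelyContinuousOnInterval f 0 T := by
    refine absolutelyContinuousOnInterval_of_dist_le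
      ((hGi 0 T).absolutelyContinuousOnInterval_intervalIntegral (c := 0) (by simp)) fun s t => ?_
    wlog hst : s ≤ t generalizing s t
    · rw [dist_comm, dist_comm (∫ v in (0 : ℝ)..s, _)]
      exact this t s (le_of_not_ge hst)
    rw [dist_comm (∫ v in (0 : ℝ)..s, _), Real.dist_eq (∫ v in (0 : ℝ)..t, _),
      intervalIntegral.integral_interval_sub_left (hGi _ _) (hGi _ _),
      intervalIntegral.integral_const_mul,
      intervalIntegral.integral_add intervalIntegrable_const (hwi s t).norm]
    have hn : ‖∫ r in s..t, w r‖ ≤ ∫ r in s..t, ‖w r‖ :=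
      intervalIntegral.norm_integral_le_integral_norm hst
    have h0 : 0 ≤ ∫ r in s..t, ‖w r‖ := (norm_nonneg _).trans hn
    have hXd : dist (X s) (X t) ≤ ∫ r in s..t, ‖w r‖ := by
      rw [dist_comm, dist_eq_norm]
      simp only [hX, add_sub_add_left_eq_sub]
      rw [intervalIntegral.integral_interval_sub_left (hwi _ _) (hwi _ _)]
      exact hn
    refine le_trans ?_ (le_abs_self _)
    refine (hK.dist_le_mul _ _).trans ?_
    gcongr
    rw [Prod.dist_eq, intervalIntegral.integral_const, smul_eq_mul, mul_one]
    refine max_le ?_ (by linarith)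
    rw [Real.dist_eq, abs_sub_comm, abs_of_nonneg (by linarith)]
    linarith
  have hzero : ∀ t ∉ Ioo 0 T, ∀ y, φ (t, y) = 0 := fun t ht y => by
    by_contra hne
    exact ht (hφ.support_subset (subset_tsupport _ (Function.mem_support.2 hne))).1
  have h1 := hac.integral_deriv_eq_sub
  have hT0 : f T = 0 := hzero T (by simp) _
  have h00 : f 0 = 0 := hzero 0 (by simp) _
  rw [hT0, h00, sub_zero] at h1
  refine Eq.trans ?_ h1
  rw [intervalIntegral.integral_of_le hT, ← integral_indicator measurableSet_Ioc]
  refine integral_congr_ae ?_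
  filter_upwards [LocallyIntegrable.ae_hasDerivAt_integral hw.locallyIntegrable] with t ht
  have hd : HasFDerivAt φ (fderiv ℝ φ (t, X t)) (t, X t) :=
    (hφ.smooth.differentiable (by simp) _).hasFDerivAt
  have h2 : HasDerivAt (fun s => (s, X s)) ((1 : ℝ), w t) t :=
    (hasDerivAt_id t).prodMk ((ht 0).const_add x)
  have h3 : HasDerivAt f (fderiv ℝ φ (t, X t) (1, w t)) t := HasFDerivAt.comp_hasDerivAt t hd h2
  by_cases htT : t ∈ Ioc 0 T
  · rw [indicator_of_mem htT, h3.deriv]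
  · rw [indicator_of_notMem htT, hφ.fderiv_eq_zero fun h => htT (Ioo_subset_Ioc_self h)]
    rfl

end Vlasov

/-! ### Passage to the limit in the transport term. -/

namespace Vlasov

theorem norm_apply_one_le {d : ℕ} {D : ℝ × Rd d →L[ℝ] ℝ} {Λ : ℝ} (hD : ‖D‖ ≤ Λ) (z : Rd d) :
    ‖D (1, z)‖ ≤ Λ * (1 + ‖z‖) := by
  refine (D.le_of_opNorm_le hD _).trans ?_
  have hΛ : 0 ≤ Λ := (norm_nonneg _).trans hD
  gcongr
  rw [Prod.norm_def]
  exact max_le (by simp) (by simp)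

theorem measurable_apply_one {d : ℕ} {α : Type*} [MeasurableSpace α]
    {D : α → ℝ × Rd d →L[ℝ] ℝ} (hD : Measurable D) {U : α → Rd d} (hU : Measurable U) :
    Measurable fun x => D x (1, U x) := by
  have h2 : Continuous fun q : (ℝ × Rd d →L[ℝ] ℝ) × (ℝ × Rd d) => q.1 q.2 := by fun_prop
  exact h2.measurable.comp (hD.prodMk (measurable_const.prodMk hU))

/-- Passage to the limit in the transport term at a fixed time. -/
theorem tendsto_integral_transport {d : ℕ} {μ : P1 d} {D : Rd d → ℝ × Rd d →L[ℝ] ℝ}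
    (hD : Continuous D) (hDc : HasCompactSupport D) {Λ : ℝ} (hΛ : ∀ y, ‖D y‖ ≤ Λ)
    {Us : ℕ → Rd d → Rd d} {U : Rd d → Rd d} (hUm : ∀ n, Measurable (Us n)) (hU : Continuous U)
    {b : ℝ} (hb : 0 ≤ b) (hUb : ∀ n y, ‖Us n y‖ ≤ b * (1 + ‖y‖))
    (hUU : ∀ r, TendstoUniformlyOn Us U atTop (Metric.closedBall 0 r))
    {X Y : ℕ → Rd d → Rd d} (hXm : ∀ n, Measurable (X n)) {B : ℝ}
    (hYB : ∀ n x, ‖Y n x‖ ≤ B * (1 + ‖x‖))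
    (hXY : ∀ x, Tendsto (fun n => ‖X n x - Y n x‖) atTop (𝓝 0)) {ρs : ℕ → P1 d} {ρ : P1 d}
    (hρ : ∀ n, IsPush μ (Y n) (ρs n)) (hlim : Tendsto (fun n => W1 (ρs n) ρ) atTop (𝓝 0)) :
    Tendsto (fun n => ∫ x, D (X n x) (1, Us n (Y n x)) ∂μ.toMeasure) atTop
      (𝓝 (∫ y, D y (1, U y) ∂ρ.toMeasure)) := by
  have hΛ0 : 0 ≤ Λ := (norm_nonneg _).trans (hΛ 0)
  have hB0 : 0 ≤ B := by simpa using (norm_nonneg _).trans (hYB 0 0)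
  -- As `D` has compact support and `U` is continuous, `g` is bounded and continuous. Weak
  -- convergence of the laws handles `g` along `Y n`, and replacing the actual integrand by it costs
  -- a quantity that vanishes by dominated convergence. No convergence of the maps themselves is
  -- needed.
  set g : Rd d → ℝ := fun y => D y (1, U y) with hg
  have hgc : Continuous g := by fun_prop
  have hgs : HasCompactSupport g := hDc.mono fun y hy => by
    simp only [Function.mem_support, hg] at hy ⊢
    intro h0
    rw [h0] at hy
    exact hy rfl
  obtain ⟨G, hG⟩ := hgs.exists_bound_of_continuous hgc
  have h1 : Tendsto (fun n => ∫ y, g y ∂(ρs n).toMeasure) atTop (𝓝 (∫ y, g y ∂ρ.toMeasure)) :=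
    (ProbabilityMeasure.tendsto_iff_forall_integral_tendsto.1 (tendsto_toPM_of_W1 hlim))
      (BoundedContinuousFunction.ofNormedAddCommGroup g hgc G hG)
  have e1 : ∀ n, ∫ y, g y ∂(ρs n).toMeasure = ∫ x, g (Y n x) ∂μ.toMeasure := fun n => by
    rw [(hρ n).eq, integral_map (hρ n).measurable.aemeasurable hgc.aestronglyMeasurable]
  simp only [e1] at h1
  have hUY : ∀ n x, ‖Us n (Y n x)‖ ≤ b * (1 + B) * (1 + ‖x‖) := fun n x => by
    refine (hUb n _).trans ?_
    rw [mul_assoc]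
    gcongr
    nlinarith [hYB n x, norm_nonneg x]
  have hm1 : ∀ n, Measurable fun x => D (X n x) (1, Us n (Y n x)) := fun n =>
    measurable_apply_one (hD.measurable.comp (hXm n)) ((hUm n).comp (hρ n).measurable)
  have hm2 : ∀ n, Measurable fun x => g (Y n x) := fun n => hgc.measurable.comp (hρ n).measurable
  have hb1 : ∀ n x, ‖D (X n x) (1, Us n (Y n x))‖ ≤ Λ * (1 + b * (1 + B) * (1 + ‖x‖)) :=
    fun n x => (norm_apply_one_le (hΛ _) _).trans (by
      gcongr
      exact hUY n x)
  have hi0 : Integrable (fun x : Rd d => Λ * (1 + b * (1 + B) * (1 + ‖x‖))) μ.toMeasure :=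
    ((integrable_const _).add ((IsWeakSol.integrable_one_add_norm μ).const_mul _)).const_mul _
  have hi1 : ∀ n, Integrable (fun x => D (X n x) (1, Us n (Y n x))) μ.toMeasure := fun n =>
    hi0.mono' (hm1 n).aestronglyMeasurable (ae_of_all _ (hb1 n))
  have hi2 : ∀ n, Integrable (fun x => g (Y n x)) μ.toMeasure := fun n =>
    (integrable_const G).mono' (hm2 n).aestronglyMeasurable (ae_of_all _ fun x => hG _)
  have h2 : Tendsto (fun n => ∫ x, (D (X n x) (1, Us n (Y n x)) - g (Y n x)) ∂μ.toMeasure) atTop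
      (𝓝 (∫ _, (0 : ℝ) ∂μ.toMeasure)) := by
    refine tendsto_integral_of_dominated_convergence _
      (fun n => ((hm1 n).sub (hm2 n)).aestronglyMeasurable) (hi0.add (integrable_const G))
      (fun n => ae_of_all _ fun x => (norm_sub_le _ _).trans (add_le_add (hb1 n x) (hG _)))
      (ae_of_all _ fun x => ?_)
    have hD' : Tendsto (fun n => ‖D (X n x) - D (Y n x)‖) atTop (𝓝 0) := by
      have huc := Metric.uniformContinuous_iff.1 (hDc.uniformContinuous_of_continuous hD)
      rw [Metric.tendsto_nhds]
      intro ε hε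
      obtain ⟨δ, hδ, hδ'⟩ := huc ε hε
      filter_upwards [(hXY x).eventually_lt_const hδ] with n hn
      rw [← dist_eq_norm] at hn
      rw [Real.dist_eq, sub_zero, abs_of_nonneg (norm_nonneg _), ← dist_eq_norm]
      exact hδ' hn
    have hU' : Tendsto (fun n => ‖Us n (Y n x) - U (Y n x)‖) atTop (𝓝 0) := by
      rw [Metric.tendsto_nhds]
      intro ε hε
      -- For fixed `x` all positions `Y n x` remain in one ball, so local uniform convergence of the
      -- fields suffices although the positions vary with `n`.
      filter_upwards [Metric.tendstoUniformlyOn_iff.1 (hUU (B * (1 + ‖x‖))) ε hε] with n hn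
      rw [Real.dist_eq, sub_zero, abs_of_nonneg (norm_nonneg _), ← dist_eq_norm, dist_comm]
      exact hn _ (mem_closedBall_zero_iff.2 (hYB n x))
    have := (hD'.mul_const (1 + b * (1 + B) * (1 + ‖x‖))).add (hU'.const_mul Λ)
    rw [zero_mul, mul_zero, add_zero] at this
    refine squeeze_zero_norm (fun n => ?_) this
    have e : D (X n x) (1, Us n (Y n x)) - g (Y n x) = (D (X n x) - D (Y n x)) (1, Us n (Y n x)) +
        D (Y n x) (0, Us n (Y n x) - U (Y n x)) := by
      have : ((0 : ℝ), Us n (Y n x) - U (Y n x)) = (1, Us n (Y n x)) - (1, U (Y n x)) := by simp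
      rw [this, map_sub]
      simp [hg]
    rw [e]
    refine (norm_add_le _ _).trans (add_le_add ?_ ?_)
    · refine (norm_apply_one_le le_rfl _).trans ?_
      gcongr
      exact hUY n x
    · refine ((D (Y n x)).le_of_opNorm_le (hΛ _) _).trans (le_of_eq ?_)
      simp [Prod.norm_def]
  rw [integral_zero] at h2
  have h3 := h2.add h1
  rw [zero_add] at h3
  refine h3.congr fun n => ?_
  rw [integral_sub (hi1 n) (hi2 n), sub_add_cancel]

namespace IsField

variable {d : ℕ} {V : ℝ → Rd d → P1 d → Rd d} {c : ℝ → ℝ}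

/-- The exceptional set of times in the Carathéodory condition depends on the measure. Countably
many measures `m q` with rational `q` share one null set, and outside it continuity passes to `m t`
by locally uniform convergence. -/
theorem continuous_along (h : IsField V c) {m : ℝ → P1 d}
    (hm : ∀ t, Tendsto (fun s => W1 (m s) (m t)) (𝓝 t) (𝓝 0)) :
    ∀ᵐ t, Continuous fun x => V t x (m t) := by
  have h1 : ∀ᵐ t, ∀ q : ℚ, Continuous fun x => V t x (m q) :=
    ae_all_iff.2 fun q => h.continuous_state (m q)
  filter_upwards [h1] with t ht
  obtain ⟨q, hq⟩ : ∃ q : ℕ → ℚ, Tendsto (fun n => (q n : ℝ)) atTop (𝓝 t) := by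
    have : ∀ n : ℕ, ∃ q : ℚ, |t - q| < 1 / ((n : ℝ) + 1) := fun n =>
      exists_rat_near t (by positivity)
    choose q hq using this
    refine ⟨q, tendsto_iff_dist_tendsto_zero.2 (squeeze_zero (fun _ => dist_nonneg) (fun n => ?_)
      tendsto_one_div_add_atTop_nhds_zero_nat)⟩
    rw [dist_comm, Real.dist_eq]
    exact (hq n).le
  have hloc : TendstoLocallyUniformly (fun n x => V t x (m (q n))) (fun x => V t x (m t))
      atTop := by
    refine tendstoLocallyUniformly_iff_forall_isCompact.2 fun K hK => ?_
    obtain ⟨r, hr⟩ := hK.isBounded.subset_closedBall 0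
    exact (h.continuous_measure t _ _ ((hm t).comp hq) r).mono hr
  exact hloc.continuous (Eventually.of_forall fun n => ht (q n)).frequently

theorem abs_integral_le (h : IsField V c) (t : ℝ) : |∫ r in (0 : ℝ)..t, c r| ≤ ∫ r, c r := by
  rcases le_total 0 t with ht | ht
  · rw [abs_of_nonneg (h.integral_nonneg ht)]
    exact h.integral_le_total ht
  · rw [intervalIntegral.integral_symm, abs_neg, abs_of_nonneg (h.integral_nonneg ht)]
    exact h.integral_le_total ht

end IsField

end Vlasov

/-! ### Existence for the nonlinear equation. -/

namespace Vlasov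

namespace IsField

variable {d : ℕ} {V : ℝ → Rd d → P1 d → Rd d} {c : ℝ → ℝ}

theorem norm_integral_interval_le (h : IsField V c) {Y : ℝ → Rd d} {m : ℝ → P1 d} {B : ℝ}
    (hB : ∀ t, 1 + ‖Y t‖ + moment (m t) ≤ B) (s t : ℝ) :
    ‖∫ r in s..t, V r (Y r) (m r)‖ ≤
      |(∫ r in (0 : ℝ)..s, c r) - ∫ r in (0 : ℝ)..t, c r| * B := by
  have hc : ∀ s t, IntervalIntegrable c volume s t := fun s t => h.integrable.intervalIntegrable
  wlog hst : s ≤ t generalizing s t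
  · rw [intervalIntegral.integral_symm, norm_neg, abs_sub_comm]
    exact this t s (le_of_not_ge hst)
  rw [abs_sub_comm, intervalIntegral.integral_interval_sub_left (hc _ _) (hc _ _),
    abs_of_nonneg (h.integral_nonneg hst)]
  exact h.norm_integral_le hB hst

/-- The weak identity satisfied by an approximation scheme. -/
theorem integral_scheme (h : IsField V c) {T : ℝ} (hT : 0 ≤ T) {μ : P1 d} {Y X : ℝ → Rd d → Rd d}
    {m : ℝ → P1 d} (hY : Measurable fun p : ℝ × Rd d => Y p.1 p.2) (hm : Measurable m) {A : ℝ}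
    (hA : ∀ t x, 1 + ‖Y t x‖ + moment (m t) ≤ A * (1 + ‖x‖))
    (hX : ∀ t x, X t x = x + ∫ r in (0 : ℝ)..t, V r (Y r x) (m r))
    (hXm : Measurable fun p : ℝ × Rd d => X p.1 p.2) {φ : ℝ × Rd d → ℝ} (hφ : IsTestFunction T φ) :
    ∫ t, ∫ x, fderiv ℝ φ (t, X t x) (1, V t (Y t x) (m t)) ∂μ.toMeasure = 0 := by
  obtain ⟨Λ, hΛ⟩ := (hφ.compact.fderiv ℝ).exists_bound_of_continuous
    (hφ.smooth.continuous_fderiv (by simp))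
  have hΛ0 : 0 ≤ Λ := (norm_nonneg _).trans (hΛ 0)
  have hD : Continuous (fderiv ℝ φ) := hφ.smooth.continuous_fderiv (by simp)
  -- After exchanging integrals the identity holds trajectory by trajectory, for each starting
  -- point.
  rw [integral_integral_swap]
  · have : ∀ x, ∫ t, fderiv ℝ φ (t, X t x) (1, V t (Y t x) (m t)) = 0 := fun x => by
      simp only [hX]
      exact hφ.integral_fderiv_curve hT (w := fun t => V t (Y t x) (m t))
        (h.integrable_along (hY.comp measurable_prodMk_right) hm fun t => hA t x) x
    simp [this]
  · have hi : Integrable (fun p : ℝ × Rd d => Λ * ((Ioo 0 T).indicator (fun _ => (1 : ℝ)) p.1 * 1 +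
        c p.1 * (A * (1 + ‖p.2‖)))) (volume.prod μ.toMeasure) := by
      refine Integrable.const_mul (Integrable.add ?_ ?_) _
      · exact Integrable.mul_prod ((integrable_indicator_iff measurableSet_Ioo).2
          (integrableOn_const (by simp))) (integrable_const (1 : ℝ))
      · exact h.integrable.mul_prod ((IsWeakSol.integrable_one_add_norm μ).const_mul A)
    refine hi.mono' ?_ ?_
    · exact (measurable_apply_one (hD.measurable.comp (measurable_fst.prodMk hXm))
        (h.measurable.comp (measurable_fst.prodMk (hY.prodMk
          (hm.comp measurable_fst))))).aestronglyMeasurable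
    · filter_upwards [Measure.quasiMeasurePreserving_fst.ae h.growth] with p hp
      by_cases hpT : p.1 ∈ Ioo 0 T
      · refine (norm_apply_one_le (hΛ _) _).trans ?_
        rw [indicator_of_mem hpT, mul_one]
        have := h.nonneg p.1
        gcongr
        exact (hp _ _).trans (mul_le_mul_of_nonneg_left (hA _ _) this)
      · have : fderiv ℝ φ (p.1, X p.1 p.2) = 0 := hφ.fderiv_eq_zero hpT _
        simp only [Function.uncurry]
        rw [this, indicator_of_notMem hpT]
        have h1 : 0 ≤ A * (1 + ‖p.2‖) := by
          linarith [hA p.1 p.2, norm_nonneg (Y p.1 p.2), moment_nonneg (m p.1)]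
        have := h.nonneg p.1
        simp only [zero_apply, norm_zero]
        positivity

/-- Existence of weak solutions of the nonlinear equation. -/
theorem exists_isWeakSol (h : IsField V c) {T : ℝ} (hT : 0 ≤ T) (μ : P1 d) :
    ∃ (m : ℝ → P1 d) (a : ℝ → ℝ), m 0 = μ ∧ IsWeakSol T (fun t x => V t x (m t)) a m := by
  set A := growthBound μ c with hA
  have hA0 : 0 ≤ A := growthBound_nonneg μ c
  have hμ0 := moment_nonneg μ
  choose Y ρ hYm hρm hpush hYA hclose using fun n : ℕ =>
    h.exists_scheme μ T (ε := 1 / ((n : ℝ) + 1)) (by positivity)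
  -- `X` is the continuous trajectory and `Y` the piecewise constant one at which the field is
  -- evaluated. The former satisfies an exact weak identity and has equicontinuous laws; the latter
  -- is uniformly close, relative to `1 + ‖x‖`.
  set X : ℕ → ℝ → Rd d → Rd d := fun n t x => x + ∫ r in (0 : ℝ)..t, V r (Y n r x) (ρ n r) with hX
  have hVi : ∀ n x, Integrable fun r => V r (Y n r x) (ρ n r) := fun n x =>
    h.integrable_along (Y := fun r => Y n r x) ((hYm n).comp measurable_prodMk_right) (hρm n)
      fun t => hYA n t x
  have hci : ∀ s t, IntervalIntegrable c volume s t := fun s t => h.integrable.intervalIntegrable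
  have hXsub : ∀ n s t x, ‖X n s x - X n t x‖ ≤
      |(∫ r in (0 : ℝ)..s, c r) - ∫ r in (0 : ℝ)..t, c r| * A * (1 + ‖x‖) := fun n s t x => by
    have := h.norm_integral_interval_le (Y := fun r => Y n r x) (m := ρ n)
      (fun t => hYA n t x) t s
    simp only [hX, add_sub_add_left_eq_sub]
    rw [intervalIntegral.integral_interval_sub_left (hVi n x).intervalIntegrable
      (hVi n x).intervalIntegrable, abs_sub_comm, mul_assoc]
    exact this
  have hX0 : ∀ n x, X n 0 x = x := fun n x => by simp [hX]
  set I := ∫ r, c r with hI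
  have hI0 : 0 ≤ I := MeasureTheory.integral_nonneg h.nonneg
  set B := 1 + I * A with hB
  have hB0 : 0 ≤ B := by positivity
  have hXB : ∀ n t x, ‖X n t x‖ ≤ B * (1 + ‖x‖) := fun n t x => by
    have h1 := hXsub n t 0 x
    rw [hX0, intervalIntegral.integral_same, sub_zero] at h1
    have h2 : ‖X n t x‖ ≤ ‖x‖ + ‖X n t x - x‖ := by
      simpa using norm_add_le x (X n t x - x)
    have h3 : |∫ r in (0 : ℝ)..t, c r| * A * (1 + ‖x‖) ≤ I * A * (1 + ‖x‖) := by
      gcongr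
      exact h.abs_integral_le t
    calc ‖X n t x‖ ≤ (1 + ‖x‖) + I * A * (1 + ‖x‖) := by linarith
      _ = _ := by rw [hB]; ring
  have hXmt : ∀ n t, StronglyMeasurable (X n t) := fun n t => by
    have hm : StronglyMeasurable fun p : Rd d × ℝ => V p.2 (Y n p.2 p.1) (ρ n p.2) :=
      (h.measurable.comp (measurable_snd.prodMk (((hYm n).comp measurable_swap).prodMk
        ((hρm n).comp measurable_snd)))).stronglyMeasurable
    have hs : ∀ s t : ℝ, StronglyMeasurable fun x =>
        ∫ r in Ioc s t, V r (Y n r x) (ρ n r) := fun s t =>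
      hm.integral_prod_right (f := fun x r => V r (Y n r x) (ρ n r))
    exact stronglyMeasurable_id.add ((hs _ _).sub (hs _ _))
  have hXm : ∀ n, Measurable fun p : ℝ × Rd d => X n p.1 p.2 := fun n =>
    (stronglyMeasurable_uncurry_of_continuous_of_stronglyMeasurable (u := X n) (fun x =>
      continuous_const.add (intervalIntegral.continuous_primitive
        (fun s t => (hVi n x).intervalIntegrable) 0)) (hXmt n)).measurable
  set ν : ℕ → ℝ → P1 d := fun n t => μ.map (X n t) (hXmt n t).measurable B (hXB n t) with hν
  obtain ⟨C, hC, hCeq⟩ : ∃ C : ℝ → ℝ, Continuous C ∧ ∀ s t,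
      |(∫ r in (0 : ℝ)..s, c r) - ∫ r in (0 : ℝ)..t, c r| * A * (1 + moment μ) = |C s - C t| := by
    refine ⟨fun t => (∫ r in (0 : ℝ)..t, c r) * (A * (1 + moment μ)),
      (intervalIntegral.continuous_primitive hci 0).mul_const _, fun s t => ?_⟩
    rw [← sub_mul, abs_mul, abs_of_nonneg (by positivity : 0 ≤ A * (1 + moment μ)), mul_assoc]
  have hνC : ∀ n s t, W1 (ν n s) (ν n t) ≤ |C s - C t| := fun n s t =>
    (W1_map_le μ _ _ _ _ (hXsub n s t)).trans_eq (hCeq s t)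
  -- All laws are images of `μ` by maps bounded by `B * (1 + ‖x‖)`, so the tails of this one
  -- integrable function serve for every `n` and `t`.
  obtain ⟨θ, hθ, m, hm⟩ := exists_subseq_tendsto_W1_curve (ν := ν) (tendsto_tailBound_map μ B)
    (fun n t => tailBound_map μ _ _) hC hνC
  have hmC : ∀ s t, W1 (m s) (m t) ≤ |C s - C t| := fun s t => by
    have h1 : ∀ n, W1 (m s) (m t) ≤ W1 (ν (θ n) s) (m s) + (|C s - C t| + W1 (ν (θ n) t) (m t)) :=
      fun n => by
        have a1 := W1_triangle (m s) (ν (θ n) s) (m t)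
        have a2 := W1_triangle (ν (θ n) s) (ν (θ n) t) (m t)
        have a3 := hνC (θ n) s t
        rw [W1_comm (m s) (ν (θ n) s)] at a1
        linarith
    have := ge_of_tendsto' ((hm s).add ((hm t).const_add |C s - C t|)) h1
    simpa using this
  have hmcont : ∀ t, Tendsto (fun s => W1 (m s) (m t)) (𝓝 t) (𝓝 0) := fun t => by
    refine squeeze_zero (fun _ => W1_nonneg _ _) (fun s => hmC s t) ?_
    have : Continuous fun s => |C s - C t| := by fun_prop
    simpa using this.tendsto t
  have hm0 : m 0 = μ := by
    have h1 : ∀ n, ν n 0 = μ := fun n => by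
      ext1
      have : X n 0 = id := funext (hX0 n)
      change μ.toMeasure.map (X n 0) = _
      rw [this, Measure.map_id]
    have h2 := hm 0
    simp only [h1] at h2
    exact (eq_of_W1_eq_zero (tendsto_nhds_unique tendsto_const_nhds h2)).symm
  set M := B * (1 + moment μ) with hM
  have hM0 : 0 ≤ M := by positivity
  have hmM : ∀ t, moment (m t) ≤ M := fun t => by
    have h1 : ∀ n, moment (ν n t) ≤ M := fun n => by
      have hp : IsPush μ (X n t) (ν n t) := ⟨(hXmt n t).measurable, ⟨B, hXB n t⟩, rfl⟩
      rw [hp.moment_eq, hM, ← IsWeakSol.integral_one_add_norm, ← integral_const_mul]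
      exact integral_mono hp.integrable ((IsWeakSol.integrable_one_add_norm μ).const_mul B)
        (hXB n t)
    have h2 : ∀ n, moment (m t) ≤ M + W1 (ν (θ n) t) (m t) := fun n => by
      have a1 := abs_moment_sub_le (ν (θ n) t) (m t)
      rw [abs_sub_comm] at a1
      linarith [h1 (θ n), le_abs_self (moment (m t) - moment (ν (θ n) t))]
    simpa using ge_of_tendsto' ((hm t).const_add M) h2
  have hmmeas : Measurable m := (continuous_of_W1 hmcont).measurable
  refine ⟨m, fun t => c t * (1 + M), hm0, ?_, fun t => mul_nonneg (h.nonneg t) (by positivity),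
    h.integrable.mul_const _, ?_, hmcont, ⟨M, hmM⟩, fun φ hφ => ?_⟩
  · exact h.measurable.comp (measurable_fst.prodMk
      (measurable_snd.prodMk (hmmeas.comp measurable_fst)))
  · filter_upwards [h.growth] with t ht x
    refine (ht x (m t)).trans ?_
    rw [mul_assoc]
    refine mul_le_mul_of_nonneg_left ?_ (h.nonneg t)
    nlinarith [hmM t, mul_nonneg hM0 (norm_nonneg x)]
  simp only [hφ.deriv_add_fderiv]
  obtain ⟨Λ, hΛ⟩ := (hφ.compact.fderiv ℝ).exists_bound_of_continuous
    (hφ.smooth.continuous_fderiv (by simp))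
  have hΛ0 : 0 ≤ Λ := (norm_nonneg _).trans (hΛ 0)
  have hD : Continuous (fderiv ℝ φ) := hφ.smooth.continuous_fderiv (by simp)
  have hscheme : ∀ n, ∫ t, ∫ x, fderiv ℝ φ (t, X n t x) (1, V t (Y n t x) (ρ n t))
      ∂μ.toMeasure = 0 := fun n =>
    h.integral_scheme hT (hYm n) (hρm n) (hYA n) (fun _ _ => rfl) (hXm n) hφ
  -- Dominated convergence in time, with the inner limit at almost every time given by
  -- `tendsto_integral_transport`.
  have hlim : Tendsto (fun n => ∫ t, ∫ x, fderiv ℝ φ (t, X (θ n) t x)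
      (1, V t (Y (θ n) t x) (ρ (θ n) t)) ∂μ.toMeasure) atTop
      (𝓝 (∫ t, ∫ x, fderiv ℝ φ (t, x) (1, V t x (m t)) ∂(m t).toMeasure)) := by
    refine tendsto_integral_of_dominated_convergence
      (fun t => Λ * ((Ioo 0 T).indicator (fun _ => (1 : ℝ)) t + c t * (A * (1 + moment μ))))
      (fun n => ?_) ?_ (fun n => ?_) ?_
    · have hmeas : StronglyMeasurable fun p : ℝ × Rd d => fderiv ℝ φ (p.1, X (θ n) p.1 p.2)
          (1, V p.1 (Y (θ n) p.1 p.2) (ρ (θ n) p.1)) :=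
        (measurable_apply_one (hD.measurable.comp (measurable_fst.prodMk (hXm _)))
          (h.measurable.comp (measurable_fst.prodMk ((hYm _).prodMk
            ((hρm _).comp measurable_fst))))).stronglyMeasurable
      exact (hmeas.integral_prod_right (f := fun t x => fderiv ℝ φ (t, X (θ n) t x)
          (1, V t (Y (θ n) t x) (ρ (θ n) t)))).aestronglyMeasurable
    · exact (((integrable_indicator_iff measurableSet_Ioo).2
          (integrableOn_const (by simp))).add (h.integrable.mul_const _)).const_mul _
    · filter_upwards [h.growth] with t ht
      by_cases htT : t ∈ Ioo 0 T
      · have hi := IsWeakSol.integrable_one_add_norm μ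
        have e : Λ * ((Ioo 0 T).indicator (fun _ => (1 : ℝ)) t + c t * (A * (1 + moment μ))) =
            ∫ x, Λ * (1 + c t * A * (1 + ‖x‖)) ∂μ.toMeasure := by
          rw [integral_const_mul, integral_add (integrable_const _) (hi.const_mul _),
            integral_const_mul, IsWeakSol.integral_one_add_norm, indicator_of_mem htT]
          simp [mul_assoc]
        rw [e]
        refine norm_integral_le_of_norm_le
          (((integrable_const _).add (hi.const_mul _)).const_mul _) (ae_of_all _ fun x => ?_)
        refine (norm_apply_one_le (hΛ _) _).trans ?_
        gcongr
        refine (ht _ _).trans ?_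
        rw [mul_assoc]
        exact mul_le_mul_of_nonneg_left (hYA _ _ _) (h.nonneg t)
      · simp only [hφ.fderiv_eq_zero htT, zero_apply, integral_zero, norm_zero,
          indicator_of_notMem htT]
        have := h.nonneg t
        positivity
    · filter_upwards [h.growth, h.continuous_along hmcont] with t ht htc
      by_cases htT : t ∈ Ioo 0 T
      · have htT' : t ∈ Icc 0 T := Ioo_subset_Icc_self htT
        have hone : Tendsto (fun n => 1 / ((θ n : ℝ) + 1)) atTop (𝓝 0) :=
          (tendsto_one_div_add_atTop_nhds_zero_nat (𝕜 := ℝ)).comp hθ.tendsto_atTop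
        have hXY : ∀ x, Tendsto (fun n => ‖X (θ n) t x - Y (θ n) t x‖) atTop (𝓝 0) := fun x =>
          squeeze_zero (fun _ => norm_nonneg _) (fun n => hclose (θ n) t htT' x)
            (by simpa using hone.mul_const (1 + ‖x‖))
        have hYB : ∀ n x, ‖Y n t x‖ ≤ A * (1 + ‖x‖) := fun n x => by
          linarith [hYA n t x, moment_nonneg (ρ n t)]
        -- The compactness argument concerns the laws of `X`. Those of `Y` have the same limit
        -- because the two trajectories are close in mean.
        have hW : Tendsto (fun n => W1 (ρ (θ n) t) (m t)) atTop (𝓝 0) := by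
          have h1 : ∀ n, W1 (ν n t) (ρ n t) ≤ 1 / ((n : ℝ) + 1) * (1 + moment μ) := fun n => by
            have e : ρ n t = μ.map (Y n t) (hpush n t).measurable A (hYB n) := by
              ext1
              exact (hpush n t).eq
            rw [e]
            exact W1_map_le μ _ _ _ _ (hclose n t htT')
          refine squeeze_zero (fun _ => W1_nonneg _ _) (fun n => ?_)
            (by simpa using (hone.mul_const (1 + moment μ)).add (hm t))
          refine (W1_triangle _ (ν (θ n) t) _).trans ?_
          rw [W1_comm (ρ (θ n) t)]
          gcongr
          rw [inv_eq_one_div]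
          exact h1 (θ n)
        have hmomA : ∀ n, moment (ρ n t) ≤ A := fun n => by
          have := hYA n t 0
          rw [norm_zero, add_zero, mul_one] at this
          linarith [norm_nonneg (Y n t 0)]
        have hemb : Continuous fun y : Rd d => (t, y) := by fun_prop
        refine tendsto_integral_transport (D := fun y => fderiv ℝ φ (t, y)) (hD.comp hemb) ?_
          (fun y => hΛ _) (Us := fun n y => V t y (ρ (θ n) t)) (fun n => ?_) htc
          (b := c t * (1 + A)) (mul_nonneg (h.nonneg t) (by positivity)) (fun n y => ?_)
          (h.continuous_measure t _ _ hW) (X := fun n => X (θ n) t) (Y := fun n => Y (θ n) t)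
          (fun n => (hXmt _ t).measurable) (fun n => hYB (θ n)) hXY (fun n => hpush (θ n) t) hW
        · refine HasCompactSupport.intro (hφ.compact.isCompact.image continuous_snd) fun y hy => ?_
          by_contra hne
          exact hy ⟨(t, y), support_fderiv_subset ℝ (Function.mem_support.2 hne), rfl⟩
        · exact h.measurable.comp
            (measurable_const.prodMk (measurable_id.prodMk measurable_const))
        · refine (ht y _).trans ?_
          rw [mul_assoc]
          refine mul_le_mul_of_nonneg_left ?_ (h.nonneg t)
          nlinarith [hmomA (θ n), mul_nonneg hA0 (norm_nonneg y)]
      · simp [hφ.fderiv_eq_zero htT]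
  simp only [hscheme] at hlim
  exact (tendsto_nhds_unique tendsto_const_nhds hlim).symm

end IsField

end Vlasov

/-! ### From the interval to the whole time axis, and admissible initial data. -/

namespace Vlasov

section Extension

variable {d : ℕ} {T : ℝ}

theorem map_leb (T : ℝ) : (leb T).map Subtype.val = volume.restrict (Icc 0 T) :=
  map_comap_subtype_coe measurableSet_Icc volume

theorem ae_of_ae_leb (hT : 0 ≤ T) {p : Icc 0 T → Prop} (h : ∀ᵐ t ∂leb T, p t) :
    ∀ᵐ t : ℝ, t ∈ Icc 0 T → p (projIcc 0 T hT t) := by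
  rw [← ae_restrict_iff' measurableSet_Icc, ← map_leb,
    (MeasurableEmbedding.subtype_coe measurableSet_Icc).ae_map_iff]
  filter_upwards [h] with t ht
  rwa [projIcc_val]

theorem integral_leb {E : Type*} [NormedAddCommGroup E] [NormedSpace ℝ E] (f : ℝ → E) :
    ∫ t : Icc 0 T, f t ∂leb T = ∫ t in Icc 0 T, f t := by
  rw [← map_leb, (MeasurableEmbedding.subtype_coe measurableSet_Icc).integral_map]

theorem lintegral_leb (f : ℝ → ℝ≥0∞) :
    ∫⁻ t : Icc 0 T, f t ∂leb T = ∫⁻ t in Icc 0 T, f t := by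
  rw [← map_leb, (MeasurableEmbedding.subtype_coe measurableSet_Icc).lintegral_map]

open Classical in
/-- Extension by zero to the whole time axis. -/
def zeroExtend {E : Type*} [Zero E] (hT : 0 ≤ T) (f : Icc 0 T → E) (t : ℝ) : E :=
  if t ∈ Icc 0 T then f (projIcc 0 T hT t) else 0

theorem zeroExtend_coe {E : Type*} [Zero E] (hT : 0 ≤ T) (f : Icc 0 T → E) (t : Icc 0 T) :
    zeroExtend hT f t = f t := by
  rw [zeroExtend, if_pos t.2, projIcc_val]

/-- Extension of a time-dependent field by zero to the whole time axis. -/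
def extendField (hT : 0 ≤ T) (v : Icc 0 T → Rd d → P1 d → Rd d) (t : ℝ) (x : Rd d) (μ : P1 d) :
    Rd d :=
  zeroExtend hT (fun s => v s x μ) t

/-- Extension of a growth rate by zero to the whole time axis. -/
def extendRate (hT : 0 ≤ T) (c : Icc 0 T → ℝ) (t : ℝ) : ℝ := zeroExtend hT (fun s => max (c s) 0) t

/-- Vanishing outside the interval preserves every bound. Taking the positive part of the rate makes
it nonnegative at every time without spoiling the growth estimate. -/
theorem isField_extendField (hT : 0 ≤ T) {v : Icc 0 T → Rd d → P1 d → Rd d}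
    (hv_meas : Measurable fun p : Icc (0 : ℝ) T × Rd d × P1 d => v p.1 p.2.1 p.2.2)
    {c : Icc (0 : ℝ) T → ℝ} (hc : Integrable c (leb T))
    (hv_growth : ∀ᵐ t ∂leb T, ∀ x μ, ‖v t x μ‖ ≤ c t * (1 + ‖x‖ + ∫ y, ‖y‖ ∂μ.toMeasure))
    (hv_carath : ∀ μ, IsCaratheodory fun t x => v t x μ)
    (hv_cont : ∀ (μs : ℕ → P1 d) (μ : P1 d),
      Tendsto (fun n => W1 (μs n) μ) atTop (𝓝 0) →
      ∀ C : Set (Rd d), IsCompact C →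
        TendstoUniformlyOn
          (fun n (p : Icc (0 : ℝ) T × Rd d) => v p.1 p.2 (μs n))
          (fun p => v p.1 p.2 μ) atTop (univ ×ˢ C)) :
    IsField (extendField hT v) (extendRate hT c) where
  measurable := by
    refine Measurable.ite (measurable_fst measurableSet_Icc) ?_ measurable_const
    exact hv_meas.comp
      (((continuous_projIcc (h := hT)).measurable.comp measurable_fst).prodMk measurable_snd)
  nonneg t := by
    unfold extendRate zeroExtend
    split_ifs
    · exact le_max_right _ _
    · exact le_rfl
  integrable := by
    have h1 : IntegrableOn (fun t => max (c (projIcc 0 T hT t)) 0) (Icc 0 T) := by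
      rw [IntegrableOn, ← map_leb,
        (MeasurableEmbedding.subtype_coe measurableSet_Icc).integrable_map_iff]
      refine hc.pos_part.congr (ae_of_all _ fun t => ?_)
      simp only [Function.comp_apply, projIcc_val]
    refine ((integrable_indicator_iff measurableSet_Icc).2 h1).congr (ae_of_all _ fun t => ?_)
    by_cases ht : t ∈ Icc 0 T
    · simp only [indicator_of_mem ht, extendRate, zeroExtend, if_pos ht]
    · simp only [indicator_of_notMem ht, extendRate, zeroExtend, if_neg ht]
  growth := by
    filter_upwards [ae_of_ae_leb hT hv_growth] with t ht x μ
    by_cases htT : t ∈ Icc 0 T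
    · simp only [extendField, extendRate, zeroExtend, if_pos htT]
      refine (ht htT x μ).trans (mul_le_mul_of_nonneg_right (le_max_left _ _) ?_)
      have := moment_nonneg μ
      change 0 ≤ 1 + ‖x‖ + moment μ
      positivity
    · simp only [extendField, extendRate, zeroExtend, if_neg htT]
      simp
  continuous_state μ := by
    filter_upwards [ae_of_ae_leb hT (hv_carath μ).2] with t ht
    by_cases htT : t ∈ Icc 0 T
    · simp only [extendField, zeroExtend, if_pos htT]
      exact ht htT
    · simp only [extendField, zeroExtend, if_neg htT]
      exact continuous_const
  continuous_measure t μs μ hμ r := by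
    by_cases htT : t ∈ Icc 0 T
    · simp only [extendField, zeroExtend, if_pos htT]
      have h1 := hv_cont μs μ hμ _ (isCompact_closedBall (0 : Rd d) r)
      rw [Metric.tendstoUniformlyOn_iff] at h1 ⊢
      intro ε hε
      filter_upwards [h1 ε hε] with n hn x hx
      exact hn (projIcc 0 T hT t, x) ⟨mem_univ _, hx⟩
    · simp only [extendField, zeroExtend, if_neg htT]
      rw [Metric.tendstoUniformlyOn_iff]
      intro ε hε
      filter_upwards with n x _
      simpa using hε

/-- Both derivatives of a test function vanish outside `(0, T)`, so the integral over the line sees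
only the interval, however the curve is extended. -/
theorem integral_weak_eq (hT : 0 ≤ T) (v : Icc 0 T → Rd d → P1 d → Rd d) (m : ℝ → P1 d)
    {φ : ℝ × Rd d → ℝ} (hφ : IsTestFunction T φ) :
    ∫ t : Icc 0 T, ∫ x, (deriv (fun s => φ (s, x)) t
      + inner ℝ (v t x (m t)) (gradient (fun y => φ (t, y)) x)) ∂(m t).toMeasure ∂leb T =
    ∫ t : ℝ, ∫ x, (deriv (fun s => φ (s, x)) t
      + fderiv ℝ (fun y => φ (t, y)) x (extendField hT v t x (m t))) ∂(m t).toMeasure := by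
  have h0 : ∀ t ∉ Icc 0 T, ∫ x, (deriv (fun s => φ (s, x)) t + fderiv ℝ (fun y => φ (t, y)) x
      (extendField hT v t x (m t))) ∂(m t).toMeasure = 0 := fun t ht => by
    simp only [hφ.deriv_add_fderiv]
    simp [hφ.fderiv_eq_zero fun h => ht (Ioo_subset_Icc_self h)]
  rw [← setIntegral_eq_integral_of_forall_compl_eq_zero h0, ← integral_leb]
  refine integral_congr_ae (ae_of_all _ fun t => integral_congr_ae (ae_of_all _ fun x => ?_))
  simp only [extendField, zeroExtend_coe]
  rw [inner_gradient_right, conj_trivial]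

theorem IsWeakSol.isSolution (hT : 0 < T) {v : Icc 0 T → Rd d → P1 d → Rd d} {m : ℝ → P1 d}
    {a : ℝ → ℝ} (h : IsWeakSol T (fun t x => extendField hT.le v t x (m t)) a m) :
    IsSolution hT v (m 0).toMeasure fun t => m t where
  continuous t := (h.cont t).comp continuous_subtype_val.continuousAt
  initial := rfl
  integrable := by
    obtain ⟨M, hM⟩ := h.bdd
    have e : ∀ t : Icc 0 T, ∫⁻ x, ‖v t x (m t)‖ₑ ∂(m t).toMeasure =
        ∫⁻ x, ‖extendField hT.le v t x (m t)‖ₑ ∂(m t).toMeasure := fun t => by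
      simp only [extendField, zeroExtend_coe]
    simp only [e]
    rw [lintegral_leb (fun t => ∫⁻ x, ‖extendField hT.le v t x (m t)‖ₑ ∂(m t).toMeasure)]
    refine lt_of_le_of_lt ?_ (h.integrable.mul_const (1 + M)).2
    refine (setLIntegral_le_lintegral _ _).trans (lintegral_mono_ae ?_)
    filter_upwards [h.growth] with t ht
    have ha := h.nonneg t
    have hi := (IsWeakSol.integrable_one_add_norm (m t)).const_mul (a t)
    calc ∫⁻ x, ‖extendField hT.le v t x (m t)‖ₑ ∂(m t).toMeasure
        ≤ ∫⁻ x, ENNReal.ofReal (a t * (1 + ‖x‖)) ∂(m t).toMeasure := by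
          refine lintegral_mono fun x => ?_
          rw [← ofReal_norm]
          exact ENNReal.ofReal_le_ofReal (ht x)
      _ = ENNReal.ofReal (a t * (1 + moment (m t))) := by
          rw [← ofReal_integral_eq_lintegral_ofReal hi (ae_of_all _ fun x => by positivity),
            integral_const_mul, IsWeakSol.integral_one_add_norm]
      _ ≤ ‖a t * (1 + M)‖ₑ := by
          rw [← ofReal_norm]
          refine ENNReal.ofReal_le_ofReal (le_trans ?_ (le_abs_self _))
          gcongr
          exact hM t
  weak φ hφ := by
    rw [integral_weak_eq hT.le v m hφ]
    exact h.weak φ hφ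

/-- The curve is extended by its endpoint values, which keeps it `W1`-continuous. With the law
inserted, the field depends only on time and position, and the moment bound absorbs the law into the
growth rate. -/
theorem IsSolution.isWeakSol {hT : 0 < T} {v : Icc 0 T → Rd d → P1 d → Rd d} {c : ℝ → ℝ}
    (hV : IsField (extendField hT.le v) c) {μ₀ : Measure (Rd d)} {μ : Icc 0 T → P1 d}
    (h : IsSolution hT v μ₀ μ) {M : ℝ} (hM : ∀ t, moment (μ t) ≤ M) :
    IsWeakSol T (fun t x => extendField hT.le v t x (μ (projIcc 0 T hT.le t)))
      (fun t => c t * (1 + M)) fun t => μ (projIcc 0 T hT.le t) := by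
  have hM0 : 0 ≤ M := (moment_nonneg _).trans (hM ⟨0, left_mem_Icc.2 hT.le⟩)
  have hcont : ∀ t, Tendsto (fun s => W1 (μ (projIcc 0 T hT.le s)) (μ (projIcc 0 T hT.le t)))
      (𝓝 t) (𝓝 0) := fun t => (h.continuous _).comp continuous_projIcc.continuousAt
  refine ⟨?_, fun t => mul_nonneg (hV.nonneg t) (by positivity), hV.integrable.mul_const _, ?_,
    hcont, ⟨M, fun t => hM _⟩, fun φ hφ => ?_⟩
  · exact hV.measurable.comp (measurable_fst.prodMk
      (measurable_snd.prodMk ((continuous_of_W1 hcont).measurable.comp measurable_fst)))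
  · filter_upwards [hV.growth] with t ht x
    refine (ht x _).trans ?_
    rw [mul_assoc]
    refine mul_le_mul_of_nonneg_left ?_ (hV.nonneg t)
    nlinarith [hM (projIcc 0 T hT.le t), mul_nonneg hM0 (norm_nonneg x)]
  · have := integral_weak_eq hT.le v (fun t => μ (projIcc 0 T hT.le t)) hφ
    rw [← this]
    simp only [projIcc_val]
    exact h.weak φ hφ

theorem IsSolution.exists_moment_le {hT : 0 < T} {v : Icc 0 T → Rd d → P1 d → Rd d}
    {μ₀ : Measure (Rd d)} {μ : Icc 0 T → P1 d} (h : IsSolution hT v μ₀ μ) :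
    ∃ M, ∀ t, moment (μ t) ≤ M := by
  have hc : Continuous fun t => moment (μ t) := continuous_iff_continuousAt.2 fun t =>
    tendsto_iff_dist_tendsto_zero.2 (squeeze_zero (fun _ => dist_nonneg)
      (fun s => abs_moment_sub_le (μ s) (μ t)) (h.continuous t))
  obtain ⟨M, hM⟩ := isCompact_univ.bddAbove_image hc.continuousOn
  exact ⟨M, fun t => hM ⟨t, trivial, rfl⟩⟩

/-- Uniform moment bound for all solutions with a given initial datum. -/
theorem IsSolution.moment_le {hT : 0 < T} {v : Icc 0 T → Rd d → P1 d → Rd d} {c : ℝ → ℝ}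
    (hV : IsField (extendField hT.le v) c) {μ₀ : P1 d} {μ : Icc 0 T → P1 d}
    (h : IsSolution hT v μ₀.toMeasure μ) (t : Icc 0 T) :
    moment (μ t) ≤ (1 + moment μ₀) * Real.exp (6 * ∫ r, c r) := by
  obtain ⟨M, hM⟩ := h.exists_moment_le
  have h1 := (h.isWeakSol hV hM).moment_le hV.integrable hV.nonneg
    (hV.growth.mono fun t ht x => ht x _) t.2
  have h0 : μ ⟨0, left_mem_Icc.2 hT.le⟩ = μ₀ := P1.ext h.initial
  simpa only [projIcc_val, projIcc_left, h0] using h1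

theorem IsSolution.eq_of_lipschitz {hT : 0 < T} {v : Icc 0 T → Rd d → P1 d → Rd d} {c : ℝ → ℝ}
    (hV : IsField (extendField hT.le v) c) {L : ℝ}
    (hL : ∀ t x y μ ν, ‖v t x μ - v t y ν‖ ≤ L * (‖x - y‖ + W1 μ ν)) {μ₀ : Measure (Rd d)}
    {μ μ' : Icc 0 T → P1 d} (h : IsSolution hT v μ₀ μ) (h' : IsSolution hT v μ₀ μ') : μ = μ' := by
  obtain ⟨M, hM⟩ := h.exists_moment_le
  obtain ⟨M', hM'⟩ := h'.exists_moment_le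
  have hL' : ∀ t x y μ ν, ‖extendField hT.le v t x μ - extendField hT.le v t y ν‖ ≤
      L.toNNReal * (‖x - y‖ + W1 μ ν) := fun t x y μ ν => by
    have h0 : 0 ≤ ‖x - y‖ + W1 μ ν := add_nonneg (norm_nonneg _) (W1_nonneg _ _)
    by_cases ht : t ∈ Icc 0 T
    · simp only [extendField, zeroExtend, if_pos ht]
      exact (hL _ _ _ _ _).trans (mul_le_mul_of_nonneg_right (Real.le_coe_toNNReal L) h0)
    · simp only [extendField, zeroExtend, if_neg ht, sub_self, norm_zero]
      exact mul_nonneg (NNReal.coe_nonneg _) h0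
  funext t
  have hself : ∀ t x y μ, ‖extendField hT.le v t x μ - extendField hT.le v t y μ‖ ≤
      L.toNNReal * ‖x - y‖ := fun t x y μ => by simpa only [W1_self, add_zero] using hL' t x y μ μ
  have := IsWeakSol.eq_of_lipschitz (h.isWeakSol hV hM) (h'.isWeakSol hV hM') hT
    (fun t x y => hself t x y _) (fun t x y => hself t x y _) (fun t x y => hL' t x y _ _)
    (by simpa only [projIcc_left] using P1.ext (h.initial.trans h'.initial.symm)) t.2
  simpa only [projIcc_val] using this

end Extension

/-- Superlinearity gives `φ r ≥ r` for large `r`, so `‖x‖` is at most a constant plus `ψ x`. -/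
theorem IsModerated.lintegral_enorm_lt_top {d : ℕ} {ψ : Rd d → ℝ} (hψ : IsModerated ψ)
    {μ : Measure (Rd d)} [IsFiniteMeasure μ] (h : ∫⁻ x, ENNReal.ofReal (ψ x) ∂μ < ∞) :
    ∫⁻ x, ‖x‖ₑ ∂μ < ∞ := by
  obtain ⟨φ, hφ, C, -, hC⟩ := hψ.comparable
  obtain ⟨R, hR⟩ := eventually_atTop.1 (hφ.superlinear.eventually_ge_atTop 1)
  have hle : ∀ x : Rd d, ‖x‖ ≤ (max R 1 + 1) + ψ x := fun x => by
    have h1 := (hC x).1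
    have h2 := hφ.nonneg _ (norm_nonneg x)
    rcases le_total ‖x‖ (max R 1) with hx | hx
    · linarith
    · have h3 : 0 < ‖x‖ := lt_of_lt_of_le one_pos ((le_max_right _ _).trans hx)
      have h4 := (le_div_iff₀ h3).1 (hR _ ((le_max_left _ _).trans hx))
      have h5 : 1 ≤ max R 1 := le_max_right _ _
      linarith
  calc ∫⁻ x, ‖x‖ₑ ∂μ ≤ ∫⁻ x, (ENNReal.ofReal (max R 1 + 1) + ENNReal.ofReal (ψ x)) ∂μ := by
        refine lintegral_mono fun x => ?_
        rw [← ofReal_norm]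
        exact (ENNReal.ofReal_le_ofReal (hle x)).trans ENNReal.ofReal_add_le
    _ = ENNReal.ofReal (max R 1 + 1) * μ univ + ∫⁻ x, ENNReal.ofReal (ψ x) ∂μ := by
        rw [lintegral_add_left measurable_const, lintegral_const]
    _ < ∞ := ENNReal.add_lt_top.2 ⟨ENNReal.mul_lt_top ENNReal.ofReal_lt_top (measure_lt_top _ _), h⟩

theorem exists_ae_norm_le_of_support_subset {d : ℕ} {μ : Measure (Rd d)} {C : Set (Rd d)}
    (hC : IsCompact C) (h : μ.support ⊆ C) : ∃ r, ∀ᵐ x ∂μ, ‖x‖ ≤ r := by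
  obtain ⟨r, hr⟩ := hC.isBounded.subset_closedBall 0
  refine ⟨r, ?_⟩
  filter_upwards [Measure.support_mem_ae (μ := μ)] with x hx
  exact mem_closedBall_zero_iff.1 (hr (h hx))

end Vlasov
end

/-! ### The three statements. -/

theorem mainTheorem5 {d : ℕ} {T : ℝ} (hT : 0 < T)
    (v : Icc (0 : ℝ) T → Vlasov.Rd d → Vlasov.P1 d → Vlasov.Rd d)
    (hv_meas : Measurable
      fun p : Icc (0 : ℝ) T × Vlasov.Rd d × Vlasov.P1 d => v p.1 p.2.1 p.2.2)
    (c : Icc (0 : ℝ) T → ℝ) (hc : Integrable c (Vlasov.leb T))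
    (hv_growth : ∀ᵐ t ∂Vlasov.leb T, ∀ x μ, ‖v t x μ‖ ≤ c t * (1 + ‖x‖ + ∫ y, ‖y‖ ∂μ.toMeasure))
    (hv_carath : ∀ μ, Vlasov.IsCaratheodory fun t x => v t x μ)
    (hv_cont : ∀ (μs : ℕ → Vlasov.P1 d) (μ : Vlasov.P1 d),
      Tendsto (fun n => Vlasov.W1 (μs n) μ) atTop (𝓝 0) →
      ∀ C : Set (Vlasov.Rd d), IsCompact C →
        TendstoUniformlyOn
          (fun n (p : Icc (0 : ℝ) T × Vlasov.Rd d) => v p.1 p.2 (μs n))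
          (fun p => v p.1 p.2 μ) atTop (univ ×ˢ C)) :
    -- (i) existence
    (∀ (μ₀ : Measure (Vlasov.Rd d)) (ψ : Vlasov.Rd d → ℝ), IsProbabilityMeasure μ₀ →
      Vlasov.IsModerated ψ → ∫⁻ x, ENNReal.ofReal (ψ x) ∂μ₀ < ∞ →
      ∃ μ, Vlasov.IsSolution hT v μ₀ μ) ∧
    -- (ii) existence and uniqueness for Lipschitz fields
    (∀ L : ℝ, (∀ t x y μ ν, ‖v t x μ - v t y ν‖ ≤ L * (‖x - y‖ + Vlasov.W1 μ ν)) →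
      ∀ μ₀ : Vlasov.P1 d, ∃! μ, Vlasov.IsSolution hT v μ₀.toMeasure μ) ∧
    -- (iii) compactly supported initial data
    (∀ (μ₀ : Measure (Vlasov.Rd d)) (C : Set (Vlasov.Rd d)), IsProbabilityMeasure μ₀ →
      IsCompact C → μ₀.support ⊆ C →
      (∃ μ, Vlasov.IsSolution hT v μ₀ μ) ∧
      ∃ R : ℝ, 0 < R ∧ ∀ μ, Vlasov.IsSolution hT v μ₀ μ →
        ∀ t, (μ t).toMeasure.support ⊆ Metric.ball 0 R) := by
  have hV := Vlasov.isField_extendField hT.le hv_meas hc hv_growth hv_carath hv_cont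
  -- Existence holds for every datum with finite first moment. The three statements differ only in
  -- how their data reach `P1`.
  have hex : ∀ μ₀ : Vlasov.P1 d, ∃ μ, Vlasov.IsSolution hT v μ₀.toMeasure μ := fun μ₀ => by
    obtain ⟨m, a, h0, hm⟩ := hV.exists_isWeakSol hT.le μ₀
    rw [← h0]
    exact ⟨_, hm.isSolution hT⟩
  refine ⟨fun μ₀ ψ hμ₀ hψ hint => hex ⟨μ₀, hμ₀, hψ.lintegral_enorm_lt_top hint⟩,
    fun L hL μ₀ => ?_, fun μ₀ C hμ₀ hC hsupp => ?_⟩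
  · obtain ⟨μ, hμ⟩ := hex μ₀
    exact ⟨μ, hμ, fun μ' hμ' => hμ'.eq_of_lipschitz hV hL hμ⟩
  · obtain ⟨r, hr⟩ := Vlasov.exists_ae_norm_le_of_support_subset hC hsupp
    have hfin : ∫⁻ x, ‖x‖ₑ ∂μ₀ < ∞ := by
      refine (lintegral_mono_ae (g := fun _ => ENNReal.ofReal r) ?_).trans_lt ?_
      · filter_upwards [hr] with x hx
        rw [← ofReal_norm]
        exact ENNReal.ofReal_le_ofReal hx
      · simp
    set ρ : Vlasov.P1 d := ⟨μ₀, hμ₀, hfin⟩ with hρ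
    -- This bounds the moments of every solution with this datum. Once the law is frozen, the growth
    -- rate `c t * (1 + M)` does not depend on the solution, and neither does the radius.
    set M := (1 + Vlasov.moment ρ) *
      Real.exp (6 * ∫ t, Vlasov.extendRate hT.le c t) with hM
    refine ⟨hex ρ,
      4 * ((1 + r ^ 2) * Real.exp (6 * ∫ t, Vlasov.extendRate hT.le c t * (1 + M))) + 1,
      by positivity, fun μ hμ t => ?_⟩
    have hw := hμ.isWeakSol hV (Vlasov.IsSolution.moment_le hV (μ₀ := ρ) hμ)
    have h0 : (μ (projIcc 0 T hT.le 0)).toMeasure = μ₀ := by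
      rw [projIcc_left]
      exact hμ.initial
    have := hw.support_subset (Q₀ := 1 + r ^ 2) (by nlinarith [sq_nonneg r]) (by
      rw [h0]
      filter_upwards [hr] with x hx
      gcongr) t.2
    simpa only [projIcc_val] using this
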